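/- Let $W=\{W(y|x)\}$ be a discrete memoryless channel with finite alphabets $\mathcal X,\mathcal Y$, let $g$ be a continuous real-valued function on the probability distributions on $\mathcal X\times\mathcal Y$, let $R>0$ and $E_0\in\mathbb R$, and let $Q_X$ be a distribution on $\mathcal X$ with rational probabilities. All logarithms are natural, $[t]_+=\max\{0,t\}$, $\hat P$ denotes (joint) empirical distributions, and $n\to\infty$ along those block lengths for which the type class $\mathcal T(Q_X)\subset\mathcal X^n$ is non-empty. The random code $\mathcal C_n=\{\boldsymbol x_0,\dots,\boldsymbol x_{M-1}\}$ has $M=e^{nR}$ (rounded up to an integer) codewords, drawn independently and uniformly from $\mathcal T(Q_X)$. Its error probability under the generalized likelihood decoder is $$P_e(\mathcal C_n)=\frac1M\sum_{m}\sum_{m'\neq m}\sum_{\boldsymbol y\in\mathcal Y^n}W(\boldsymbol y|\boldsymbol x_m)\,\frac{\exp\{n g(\hat P_{\boldsymbol x_{m'}\boldsymbol y})\}}{\sum_{\tilde m}\exp\{n g(\hat P_{\boldsymbol x_{\tilde m}\boldsymbol y})\}},$$ and $\mathsf E(\mathcal C_n)=-\frac1n\log P_e(\mathcal C_n)$. Let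 $\mathcal Q(Q_X)$ be the set of joint distributions $Q_{XX'}$ on $\mathcal X\times\mathcal X$ with both marginals equal to $Q_X$. With $I_Q$ the (conditional) mutual information under $Q$ and $D(Q_{Y|X}\|W|Q_X)$ the conditional divergence, put $$\alpha(R,Q_Y)=\max_{Q_{\tilde X|Y}:\,Q_{\tilde X}=Q_X,\,I_Q(\tilde X;Y)\le R}\{g(Q_{\tilde XY})-I_Q(\tilde X;Y)\}+R,$$ $$\beta(R,Q_Y)=\max_{Q_{\tilde X|Y}:\,Q_{\tilde X}=Q_X}\{g(Q_{\tilde XY})+[R-I_Q(\tilde X;Y)]_+\},$$ $$\Gamma(Q_{XX'},R)=\min_{Q_{Y|XX'}}\{D(Q_{Y|X}\|W|Q_X)+I_Q(X';Y|X)+[\max\{g(Q_{XY}),\alpha(R,Q_Y)\}-g(Q_{X'Y})]_+\},$$ $$\Lambda(Q_{XX'},R)=\min_{Q_{Y|XX'}}\{D(Q_{Y|X}\|W|Q_X)+I_Q(X';Y|X)+\beta(R,Q_Y)-g(Q_{X'Y})\},$$ $$E_{\rm trc}(R)=\min_{Q_{XX'}\in\mathcal Q(Q_X):\,I_Q(X;X')\le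 2R}\{\Gamma(Q_{XX'},R)+I_Q(X;X')-R\},$$ let $E_{\rm ex}(R)$ be the same minimum with the constraint $I_Q(X;X')\le R$ in place of $I_Q(X;X')\le 2R$, and let $$\mathcal V(R,E_0)=\{Q_{XX'}\in\mathcal Q(Q_X): I_Q(X;X')\le 2R,\ \Lambda(Q_{XX'},R)+I_Q(X;X')-R\le E_0\},$$ $$\mathcal U(R,E_0)=\{Q_{XX'}\in\mathcal Q(Q_X): I_Q(X;X')\le 2R,\ \Gamma(Q_{XX'},R)+I_Q(X;X')-R\le E_0\},$$ $$E_{\rm ut}^{\rm ub}(R,E_0)=\max_{Q_{XX'}\in\mathcal V(R,E_0)}\min\{2R-I_Q(X;X'),\ E_0-\Lambda(Q_{XX'},R)-I_Q(X;X')+R,\ R\},$$ $$E_{\rm ut}^{\rm lb}(R,E_0)=\max_{Q_{XX'}\in\mathcal U(R,E_0)}\{2R-I_Q(X;X')\}.$$ Then, with $a_n=\mathbb P\{\mathsf E(\mathcal C_n)\ge E_0\}$ (and the conventions $\log 0=-\infty$, $\log\infty=\infty$): (i) If $\mathcal V(R,E_0)\neq\emptyset$ and $E:=E_{\rm ut}^{\rm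 ub}(R,E_0)>0$, then $a_n$ is at most $b_n=\exp\{-\exp\{nE\}\}$ in the double-exponential scale, that is, $\liminf_{n\to\infty}\frac1n\log\left(\frac{\log a_n}{\log b_n}\right)\ge 0$. (ii) If $E_{\rm trc}(R)<E_0<E_{\rm ex}(R)$, then, with $E:=E_{\rm ut}^{\rm lb}(R,E_0)$, $a_n$ is at least $b_n=\exp\{-\exp\{nE\}\}$ in the double-exponential scale, that is, $\limsup_{n\to\infty}\frac1n\log\left(\frac{\log a_n}{\log b_n}\right)\le 0$. -/

import Mathlib

open Filter MeasureTheory ProbabilityTheory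
open scoped ENNReal Topology

namespace RandomCode

noncomputable section

/-! ### Finite joint distributions and information measures (natural logarithms)

Distributions on a finite alphabet are functions into `ℝ` that lie in `stdSimplex`. -/

/-- First marginal of a joint distribution. -/
def fstMarg {A B : Type*} [Fintype B] (Q : A × B → ℝ) (a : A) : ℝ := ∑ b, Q (a, b)

/-- Second marginal of a joint distribution. -/
def sndMarg {A B : Type*} [Fintype A] (Q : A × B → ℝ) (b : B) : ℝ := ∑ a, Q (a, b)

/-- Shannon entropy `-∑ p log p`, with `0 log 0 = 0`. -/
def entropy {A : Type*} [Fintype A] (p : A → ℝ) : ℝ := ∑ a, Real.negMulLog (p a)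

/-- Mutual information `I_Q(A;B) = H(A) + H(B) - H(A,B)`. -/
def mutualInfo {A B : Type*} [Fintype A] [Fintype B] (Q : A × B → ℝ) : ℝ :=
  entropy (fstMarg Q) + entropy (sndMarg Q) - entropy Q

/-- Joint distributions with prescribed marginals. -/
def couplings {A B : Type*} [Fintype A] [Fintype B] (p : A → ℝ) (q : B → ℝ) :
    Set (A × B → ℝ) :=
  {Q | Q ∈ stdSimplex ℝ (A × B) ∧ fstMarg Q = p ∧ sndMarg Q = q}

/-- The `(X,X')` marginal of a distribution of a triple `(X,X',Y)`. -/
def margXX {X Y : Type*} [Fintype Y] (P : X × X × Y → ℝ) (z : X × X) : ℝ :=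
  ∑ y, P (z.1, z.2, y)

/-- The `(X,Y)` marginal of a distribution of a triple `(X,X',Y)`. -/
def margXY {X Y : Type*} [Fintype X] (P : X × X × Y → ℝ) (z : X × Y) : ℝ :=
  ∑ x', P (z.1, x', z.2)

/-- The `(X',Y)` marginal of a distribution of a triple `(X,X',Y)`. -/
def margX'Y {X Y : Type*} [Fintype X] (P : X × X × Y → ℝ) (z : X × Y) : ℝ :=
  ∑ x, P (x, z.1, z.2)

/-- Conditional mutual information
`I(X';Y|X) = H(X,X') + H(X,Y) - H(X) - H(X,X',Y)` of a triple `(X,X',Y)`. -/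
def condMutualInfo {X Y : Type*} [Fintype X] [Fintype Y] (P : X × X × Y → ℝ) : ℝ :=
  entropy (margXX P) + entropy (margXY P) - entropy (fstMarg (margXY P)) - entropy P

/-- Absolute continuity `Q_{Y|X} ≪ W(·|X)` under `Q_X`, that is, finiteness of the conditional
divergence `D(Q_{Y|X} ‖ W | Q_X)`. -/
def FiniteDiv {X Y : Type*} (W : X → Y → ℝ) (Q : X × Y → ℝ) : Prop :=
  ∀ x y, W x y = 0 → Q (x, y) = 0

/-- The conditional divergence `D(Q_{Y|X} ‖ W | Q_X)` as a function of `Q_{XY}`, where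
`Q_{Y|X}(y|x) = Q_{XY}(x,y) / Q_X(x)`. It is only used when `FiniteDiv W Q` holds
(it is `+∞` otherwise). -/
def condDiv {X Y : Type*} [Fintype X] [Fintype Y] (W : X → Y → ℝ) (Q : X × Y → ℝ) : ℝ :=
  ∑ x, ∑ y, Q (x, y) * Real.log (Q (x, y) / fstMarg Q x / W x y)

/-! ### The code ensemble, the decoder and the error probability -/

/-- Empirical distribution of a sequence. -/
def empDist {A : Type*} [DecidableEq A] {n : ℕ} (z : Fin n → A) (a : A) : ℝ :=
  ((Finset.univ.filter fun t => z t = a).card : ℝ) / n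

/-- The type class of `QX` at block length `n`. -/
def typeClass {X : Type*} [DecidableEq X] (n : ℕ) (QX : X → ℝ) : Set (Fin n → X) :=
  {x | empDist x = QX}

/-- Number of codewords `M = e^{nR}`, rounded up to an integer. -/
def numWords (R : ℝ) (n : ℕ) : ℕ := ⌈Real.exp (n * R)⌉₊

/-- The score `exp{n g(P̂_{xy})}` of a codeword `x` given the channel output `y`. -/
def score {X Y : Type*} [DecidableEq X] [DecidableEq Y] (g : (X × Y → ℝ) → ℝ) {n : ℕ}
    (x : Fin n → X) (y : Fin n → Y) : ℝ :=
  Real.exp (n * g (empDist fun t => (x t, y t)))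

/-- The probability that the generalized likelihood decoder decides on message `m`
given the output `y`. -/
def decodeProb {X Y : Type*} [DecidableEq X] [DecidableEq Y] (g : (X × Y → ℝ) → ℝ) {n M : ℕ}
    (C : Fin M → Fin n → X) (y : Fin n → Y) (m : Fin M) : ℝ :=
  score g (C m) y / ∑ k, score g (C k) y

/-- The error probability of the code `C` over the memoryless channel `W`, with equiprobable
messages and the generalized likelihood decoder with metric `g`. -/
def errorProb {X Y : Type*} [Fintype Y] [DecidableEq X] [DecidableEq Y]
    (W : X → Y → ℝ) (g : (X × Y → ℝ) → ℝ) {n M : ℕ} (C : Fin M → Fin n → X) : ℝ :=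
  (1 / (M : ℝ)) * ∑ m, ∑ m' ∈ Finset.univ.filter (fun k => k ≠ m), ∑ y : Fin n → Y,
    (∏ t, W (C m t) (y t)) * decodeProb g C y m'

/-- The exponent `E(C) = -(1/n) log P_e(C)` of a code. -/
def codeExponent {X Y : Type*} [Fintype Y] [DecidableEq X] [DecidableEq Y]
    (W : X → Y → ℝ) (g : (X × Y → ℝ) → ℝ) {n M : ℕ} (C : Fin M → Fin n → X) : ℝ :=
  -(1 / (n : ℝ)) * Real.log (errorProb W g C)

/-- The law of the random constant composition code: the codewords are independent, each one
uniformly distributed over the type class of `QX`. -/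
def codeLaw {X : Type*} [DecidableEq X] [MeasurableSpace X] (QX : X → ℝ) (n M : ℕ) :
    Measure (Fin M → Fin n → X) :=
  Measure.pi fun _ : Fin M => uniformOn (typeClass n QX)

/-- The upper tail probability `P{E(C_n) ≥ E₀}` at rate `R`. -/
def upperTail {X Y : Type*} [Fintype Y] [DecidableEq X] [DecidableEq Y] [MeasurableSpace X]
    (W : X → Y → ℝ) (g : (X × Y → ℝ) → ℝ) (QX : X → ℝ) (R E₀ : ℝ) (n : ℕ) : ℝ≥0∞ :=
  codeLaw QX n (numWords R n) {C | E₀ ≤ codeExponent W g C}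

/-- `n → ∞` along the block lengths for which the type class of `QX` is nonempty. -/
def blockLengths {X : Type*} [DecidableEq X] (QX : X → ℝ) : Filter ℕ :=
  atTop ⊓ 𝓟 {n | (typeClass n QX).Nonempty}

/-! ### Single-letter quantities -/

section SingleLetter

variable {X Y : Type*} [Fintype X] [Fintype Y]

/-- `α(R,Q_Y)`: maximum of `g(Q_{X̃Y}) - I(X̃;Y)` over couplings of `QX` and `QY` with
`I(X̃;Y) ≤ R`, plus `R`. -/
def alpha (g : (X × Y → ℝ) → ℝ) (QX : X → ℝ) (R : ℝ) (QY : Y → ℝ) : ℝ :=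
  sSup ((fun Q => g Q - mutualInfo Q) '' {Q | Q ∈ couplings QX QY ∧ mutualInfo Q ≤ R}) + R

/-- `β(R,Q_Y)`: maximum of `g(Q_{X̃Y}) + [R - I(X̃;Y)]₊` over couplings of `QX` and `QY`. -/
def beta (g : (X × Y → ℝ) → ℝ) (QX : X → ℝ) (R : ℝ) (QY : Y → ℝ) : ℝ :=
  sSup ((fun Q => g Q + max 0 (R - mutualInfo Q)) '' couplings QX QY)

/-- The distributions `Q_{XX'Y} = Q_{XX'} Q_{Y|XX'}` with the given `Q_{XX'}` and any `Q_{Y|XX'}`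
for which `D(Q_{Y|X} ‖ W | Q_X)` is finite. The others never attain the minima below, since
`Q_{Y|XX'} = W(·|X)` has zero divergence. -/
def extensions (W : X → Y → ℝ) (Q : X × X → ℝ) : Set (X × X × Y → ℝ) :=
  {P | P ∈ stdSimplex ℝ (X × X × Y) ∧ margXX P = Q ∧ FiniteDiv W (margXY P)}

/-- `Γ(Q_{XX'},R)`. -/
def Gam (W : X → Y → ℝ) (g : (X × Y → ℝ) → ℝ) (QX : X → ℝ) (R : ℝ) (Q : X × X → ℝ) : ℝ :=
  sInf ((fun P => condDiv W (margXY P) + condMutualInfo P +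
    max 0 (max (g (margXY P)) (alpha g QX R (sndMarg (margXY P))) - g (margX'Y P))) ''
      extensions W Q)

/-- `Λ(Q_{XX'},R)`. -/
def Lam (W : X → Y → ℝ) (g : (X × Y → ℝ) → ℝ) (QX : X → ℝ) (R : ℝ) (Q : X × X → ℝ) : ℝ :=
  sInf ((fun P => condDiv W (margXY P) + condMutualInfo P +
    beta g QX R (sndMarg (margXY P)) - g (margX'Y P)) '' extensions W Q)

/-- The minimum of `Γ(Q_{XX'},R) + I(X;X') - R` over `Q_{XX'}` with both marginals `QX` and
`I(X;X') ≤ S`. -/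
def minExponent (W : X → Y → ℝ) (g : (X × Y → ℝ) → ℝ) (QX : X → ℝ) (R S : ℝ) : ℝ :=
  sInf ((fun Q => Gam W g QX R Q + mutualInfo Q - R) ''
    {Q | Q ∈ couplings QX QX ∧ mutualInfo Q ≤ S})

/-- The typical random code exponent `E_trc(R)`. -/
def Etrc (W : X → Y → ℝ) (g : (X × Y → ℝ) → ℝ) (QX : X → ℝ) (R : ℝ) : ℝ :=
  minExponent W g QX R (2 * R)

/-- The expurgated exponent `E_ex(R)`. -/
def Eex (W : X → Y → ℝ) (g : (X × Y → ℝ) → ℝ) (QX : X → ℝ) (R : ℝ) : ℝ :=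
  minExponent W g QX R R

/-- The set `V(R,E₀)`. -/
def setV (W : X → Y → ℝ) (g : (X × Y → ℝ) → ℝ) (QX : X → ℝ) (R E₀ : ℝ) : Set (X × X → ℝ) :=
  {Q | Q ∈ couplings QX QX ∧ mutualInfo Q ≤ 2 * R ∧
    Lam W g QX R Q + mutualInfo Q - R ≤ E₀}

/-- The set `U(R,E₀)`. -/
def setU (W : X → Y → ℝ) (g : (X × Y → ℝ) → ℝ) (QX : X → ℝ) (R E₀ : ℝ) : Set (X × X → ℝ) :=
  {Q | Q ∈ couplings QX QX ∧ mutualInfo Q ≤ 2 * R ∧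
    Gam W g QX R Q + mutualInfo Q - R ≤ E₀}

/-- `E_ut^ub(R,E₀)` (with value `0` when `V(R,E₀)` is empty). -/
def EutUb (W : X → Y → ℝ) (g : (X × Y → ℝ) → ℝ) (QX : X → ℝ) (R E₀ : ℝ) : ℝ :=
  sSup ((fun Q => min (2 * R - mutualInfo Q)
    (min (E₀ - Lam W g QX R Q - mutualInfo Q + R) R)) '' setV W g QX R E₀)

/-- `E_ut^lb(R,E₀)`. -/
def EutLb (W : X → Y → ℝ) (g : (X × Y → ℝ) → ℝ) (QX : X → ℝ) (R E₀ : ℝ) : ℝ :=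
  sSup ((fun Q => 2 * R - mutualInfo Q) '' setU W g QX R E₀)

end SingleLetter

/-! ### Comparison in the double-exponential scale -/

/-- `(1/n) log (log aₙ / log bₙ)`, for `aₙ ∈ [0,1]` and `bₙ ∈ (0,1)`, as an extended real number
(`⊤` if `aₙ = 0` and `⊥` if `aₙ = 1`). -/
def dexpRatio (a b : ℕ → ℝ≥0∞) (n : ℕ) : EReal :=
  ENNReal.log ((-ENNReal.log (a n)).toENNReal / (-ENNReal.log (b n)).toENNReal) / (n : EReal)

/-- `aₙ ≤ bₙ` in the double-exponential scale: `liminf (1/n) log (log aₙ / log bₙ) ≥ 0`. -/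
def DexpLE (l : Filter ℕ) (a b : ℕ → ℝ≥0∞) : Prop :=
  0 ≤ liminf (dexpRatio a b) l

/-- `aₙ ≥ bₙ` in the double-exponential scale: `limsup (1/n) log (log aₙ / log bₙ) ≤ 0`. -/
def DexpGE (l : Filter ℕ) (a b : ℕ → ℝ≥0∞) : Prop :=
  limsup (dexpRatio a b) l ≤ 0

/-- The sequence `exp{-exp{n E}}`. -/
def doubleExp (E : ℝ) (n : ℕ) : ℝ≥0∞ :=
  ENNReal.ofReal (Real.exp (-Real.exp (n * E)))

end

end RandomCode

open RandomCode

/-!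
The theorem is an instance of the method of types. A pair of codewords of joint type `Q` has
probability about `exp (-n I(Q))`, and, given that the total score `∑ exp (n g)` at an output `y`
is about `exp (n a)`, it contributes to the error probability the sum over the conditional types
of `y` of `exp (-n (D + I(X';Y|X)))` times the probability `exp (-n [max (g, a) - g']₊)` of the
wrong decision. All counts are exact up to factors polynomial in `n` (`sum_exp_entropy_sub_le`,
`exp_entropy_sub_le_card`), and the single-letter quantities are continuous on the simplex, so that
real distributions can be rounded to types (`exists_empDist_near`).

*Upper bound on the tail.* Fix `Q` in `V(R,E₀)` nearly attaining the maximum, and a triple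
distribution nearly attaining `Λ(Q,R)`. Two events are doubly exponentially unlikely: that the
total score at some output exceeds `exp (n β)` by a factor `exp (n F)`, by a Chernoff bound
(`exists_sum_score_le`), and that the code has far fewer than the mean number
`exp (n (2 R - I(Q)))` of pairs of joint type `Q` (`exists_few_pairs_finset`). For the latter the
code is split into two halves. Revealing the first half, the truncated number of its words related
to a random word has, on average over that word, at least a constant fraction of the expected
size; given the first half, the pairs are counted by a sum of independent bounded variables over the
second half. Outside the two events, the pairs of joint type `Q` alone make the error probability
exceed `exp (-n E₀)` (`upperTail_le`).

*Lower bound on the tail.* Under `E_trc < E₀ < E_ex` the exponent is `2 R - I` for some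
`I > R`, and by compactness the cost `Γ + I(X;X') - R` stays above `E₀` when
`I(X;X') ≤ I - γ` (`exists_eutLb_eq`). Hence it is enough that the code has no pair of codewords
with mutual information `I - γ` or more, while being typical otherwise. Each word excludes a
fraction `θ ≈ exp (-n (I - γ))` of the words, and `M θ` is small because `I - γ > R`. Drawing the
words one by one among those compatible with the preceding ones therefore yields a law on codes
whose density with respect to the uniform one is at most `exp (2 M² θ)`, and under which the pair
costs and the scores still behave as under the uniform law, by supermartingale bounds. This gives
a fraction `exp (-2 M² θ) / 2` of good codes (`exists_good_codes`), with
`M² θ ≈ exp (n (2 R - I + γ))`; on these the error probability is at most `exp (-n E₀)`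
(`errorProb_le`, `le_upperTail`).
-/

namespace RandomCode

/-! ### Types: counting sequences of a given conditional type -/

section Types

variable {A B : Type*} [Fintype A] [Fintype B] [DecidableEq A] [DecidableEq B]

/-- Number of occurrences of a letter in a sequence. -/
def letterCount {A : Type*} [DecidableEq A] {n : ℕ} (z : Fin n → A) (a : A) : ℕ :=
  (Finset.univ.filter fun t => z t = a).card

omit [Fintype A] in
lemma empDist_eq_letterCount_div {n : ℕ} (z : Fin n → A) (a : A) :
    empDist z a = (letterCount z a : ℝ) / n := rfl

lemma sum_letterCount {n : ℕ} (z : Fin n → A) : ∑ a, letterCount z a = n := by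
  have := Finset.card_eq_sum_card_fiberwise (s := (Finset.univ : Finset (Fin n)))
    (t := Finset.univ) (f := z) (fun _ _ => Finset.mem_coe.2 (Finset.mem_univ _))
  simpa [letterCount] using this.symm

omit [Fintype A] in
lemma letterCount_le {n : ℕ} (z : Fin n → A) (a : A) : letterCount z a ≤ n := by
  simpa [letterCount] using Finset.card_filter_le (Finset.univ : Finset (Fin n)) (fun t => z t = a)

lemma sum_apply_eq_sum_letterCount {n : ℕ} (z : Fin n → A) (f : A → ℝ) :
    ∑ t, f (z t) = ∑ a, (letterCount z a : ℝ) * f a := by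
  rw [← Finset.sum_fiberwise' Finset.univ z f]
  simp [letterCount]

lemma sum_apply_eq_mul_sum_empDist {n : ℕ} (z : Fin n → A) (f : A → ℝ) :
    ∑ t, f (z t) = n * ∑ a, empDist z a * f a := by
  rcases Nat.eq_zero_or_pos n with rfl | hn
  · simp
  rw [sum_apply_eq_sum_letterCount, Finset.mul_sum]
  refine Finset.sum_congr rfl fun a _ => ?_
  rw [empDist_eq_letterCount_div]
  field_simp

omit [Fintype A] in
lemma empDist_nonneg {n : ℕ} (z : Fin n → A) (a : A) : 0 ≤ empDist z a := by
  unfold empDist; positivity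

lemma empDist_mem_stdSimplex {n : ℕ} (hn : 0 < n) (z : Fin n → A) :
    empDist z ∈ stdSimplex ℝ A := by
  refine ⟨empDist_nonneg z, ?_⟩
  simp_rw [empDist_eq_letterCount_div]
  rw [← Finset.sum_div, ← Nat.cast_sum, sum_letterCount]
  field_simp

omit [Fintype A] in
lemma empDist_apply_pos {n : ℕ} (z : Fin n → A) (t : Fin n) : 0 < empDist z (z t) := by
  have hn : 0 < n := t.pos
  have : 0 < (Finset.univ.filter fun s => z s = z t).card :=
    Finset.card_pos.2 ⟨t, by simp⟩
  unfold empDist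
  positivity

lemma letterCount_comp {C : Type*} [DecidableEq C] {n : ℕ} (z : Fin n → A) (f : A → C) (c : C) :
    letterCount (fun t => f (z t)) c = ∑ a ∈ Finset.univ.filter (fun a => f a = c),
      letterCount z a := by
  unfold letterCount
  rw [Finset.card_eq_sum_card_fiberwise (f := z) (t := Finset.univ.filter (fun a => f a = c))]
  · refine Finset.sum_congr rfl fun a ha => ?_
    congr 1
    ext t
    simp only [Finset.mem_filter, Finset.mem_univ, true_and] at ha ⊢
    constructor
    · exact fun h => h.2
    · exact fun h => ⟨by rw [h, ha], h⟩
  · intro t ht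
    simpa using ht

lemma empDist_comp {C : Type*} [DecidableEq C] {n : ℕ} (z : Fin n → A) (f : A → C) (c : C) :
    empDist (fun t => f (z t)) c = ∑ a ∈ Finset.univ.filter (fun a => f a = c), empDist z a := by
  simp_rw [empDist_eq_letterCount_div]
  rw [letterCount_comp, Nat.cast_sum, Finset.sum_div]

lemma fstMarg_empDist {n : ℕ} (z : Fin n → A × B) :
    fstMarg (empDist z) = empDist fun t => (z t).1 := by
  ext a
  rw [empDist_comp z Prod.fst a, fstMarg]
  exact Finset.sum_bij' (fun b _ => (a, b)) (fun p _ => p.2) (by simp) (by simp) (by simp)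
    (by rintro ⟨x, y⟩ h; simp at h; simp [h]) (by simp)

lemma sndMarg_empDist {n : ℕ} (z : Fin n → A × B) :
    sndMarg (empDist z) = empDist fun t => (z t).2 := by
  ext b
  rw [empDist_comp z Prod.snd b, sndMarg]
  exact Finset.sum_bij' (fun a _ => (a, b)) (fun p _ => p.1) (by simp) (by simp) (by simp)
    (by rintro ⟨x, y⟩ h; simp at h; simp [h]) (by simp)

omit [Fintype A] [Fintype B] in
lemma empDist_equiv {n : ℕ} (e : A ≃ B) (z : Fin n → A) :
    empDist (fun t => e (z t)) = fun b => empDist z (e.symm b) := by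
  ext b
  simp [empDist, Equiv.eq_symm_apply]

omit [DecidableEq A] [DecidableEq B] in
lemma entropy_equiv (e : A ≃ B) (p : A → ℝ) : entropy (fun b => p (e.symm b)) = entropy p :=
  Equiv.sum_comp e.symm fun a => Real.negMulLog (p a)

lemma entropy_empDist_equiv {n : ℕ} (e : A ≃ B) (z : Fin n → A) :
    entropy (empDist fun t => e (z t)) = entropy (empDist z) := by
  rw [empDist_equiv, entropy_equiv]

lemma margXX_empDist {n : ℕ} (x x' : Fin n → A) (y : Fin n → B) :
    margXX (empDist fun t => (x t, x' t, y t)) = empDist fun t => (x t, x' t) := by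
  have h := fstMarg_empDist (fun t => ((x t, x' t), y t))
  have h2 := empDist_equiv (Equiv.prodAssoc A A B) (fun t => ((x t, x' t), y t))
  ext ⟨a, b⟩
  simp only [Equiv.prodAssoc_apply] at h2
  rw [← h]
  simp [margXX, fstMarg, h2]

lemma margXY_empDist {n : ℕ} (x x' : Fin n → A) (y : Fin n → B) :
    margXY (empDist fun t => (x t, x' t, y t)) = empDist fun t => (x t, y t) := by
  let e : (A × B) × A ≃ A × A × B :=
    ⟨fun p => (p.1.1, p.2, p.1.2), fun p => ((p.1, p.2.2), p.2.1), fun _ => rfl, fun _ => rfl⟩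
  have h := fstMarg_empDist (fun t => ((x t, y t), x' t))
  have h2 := empDist_equiv e (fun t => ((x t, y t), x' t))
  ext ⟨a, b⟩
  simp only [e, Equiv.coe_fn_mk] at h2
  rw [← h]
  simp [margXY, fstMarg, h2]

lemma margX'Y_empDist {n : ℕ} (x x' : Fin n → A) (y : Fin n → B) :
    margX'Y (empDist fun t => (x t, x' t, y t)) = empDist fun t => (x' t, y t) := by
  have h := sndMarg_empDist (fun t => (x t, x' t, y t))
  ext ⟨a, b⟩
  rw [← h]
  simp [margX'Y, sndMarg]

lemma entropy_empDist_swap {n : ℕ} (x : Fin n → A) (y : Fin n → B) :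
    entropy (empDist fun t => (x t, y t)) = entropy (empDist fun t => (y t, x t)) :=
  (entropy_empDist_equiv (Equiv.prodComm A B) (fun t => (x t, y t))).symm

lemma mutualInfo_empDist {n : ℕ} (x : Fin n → A) (y : Fin n → B) :
    mutualInfo (empDist fun t => (x t, y t)) =
      entropy (empDist x) + entropy (empDist y) - entropy (empDist fun t => (x t, y t)) := by
  rw [mutualInfo, fstMarg_empDist, sndMarg_empDist]

lemma mutualInfo_empDist_comm {n : ℕ} (x : Fin n → A) (y : Fin n → B) :
    mutualInfo (empDist fun t => (x t, y t)) = mutualInfo (empDist fun t => (y t, x t)) := by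
  rw [mutualInfo_empDist, mutualInfo_empDist, entropy_empDist_swap]; ring

lemma exp_neg_mul_entropy_empDist {n : ℕ} (z : Fin n → A) :
    Real.exp (-(n * entropy (empDist z))) = ∏ t, empDist z (z t) := by
  have h : ∏ t, empDist z (z t) = Real.exp (∑ t, Real.log (empDist z (z t))) := by
    rw [Real.exp_sum]
    exact Finset.prod_congr rfl fun t _ => (Real.exp_log (empDist_apply_pos z t)).symm
  rw [h, sum_apply_eq_mul_sum_empDist z (fun a => Real.log (empDist z a))]
  simp [entropy, Real.negMulLog, Finset.sum_neg_distrib]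

/-- For a fixed sequence `z`, the sequences `y` of each conditional type carry, in total, at most
unit mass when each is weighted by `exp (n (H(z) - H(z,y)))`: this weight is the probability of
`y` under the memoryless channel `P(b|a)` read off the joint type. -/
theorem sum_exp_entropy_sub_le {n : ℕ} (z : Fin n → A) :
    ∑ y : Fin n → B, Real.exp (n * (entropy (empDist z) - entropy (empDist fun t => (z t, y t)))) ≤
      ((n : ℝ) + 1) ^ (Fintype.card A * Fintype.card B) := by
  classical
  have hterm : ∀ y : Fin n → B,
      Real.exp (n * (entropy (empDist z) - entropy (empDist fun t => (z t, y t)))) =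
        ∏ t, empDist (fun t => (z t, y t)) (z t, y t) / empDist z (z t) := by
    intro y
    rw [Finset.prod_div_distrib, ← exp_neg_mul_entropy_empDist z,
      ← exp_neg_mul_entropy_empDist (fun t => (z t, y t)), ← Real.exp_sub]
    congr 1; ring
  -- the joint types of `z` and `y` are labelled by their letter counts, which lie in `{0, …, n}`
  let N : (Fin n → B) → (A × B → Fin (n + 1)) := fun y p =>
    ⟨letterCount (fun t => (z t, y t)) p, Nat.lt_succ_of_le (letterCount_le _ _)⟩
  rw [← Finset.sum_fiberwise Finset.univ N]
  have hclass : ∀ c : A × B → Fin (n + 1), ∑ y ∈ Finset.univ.filter (fun y => N y = c),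
      Real.exp (n * (entropy (empDist z) - entropy (empDist fun t => (z t, y t)))) ≤ 1 := by
    intro c
    by_cases hne : ∃ y, N y = c
    · obtain ⟨y₀, hy₀⟩ := hne
      have hemp : ∀ y, N y = c →
          empDist (fun t => (z t, y t)) = empDist (fun t => (z t, y₀ t)) := by
        intro y hy
        ext p
        have := congrArg Fin.val (congrFun (hy.trans hy₀.symm) p)
        simp only [N] at this
        rw [empDist_eq_letterCount_div, empDist_eq_letterCount_div, this]
      calc _ = ∑ y ∈ Finset.univ.filter (fun y => N y = c),
            ∏ t, empDist (fun t => (z t, y₀ t)) (z t, y t) / empDist z (z t) := by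
            refine Finset.sum_congr rfl fun y hy => ?_
            rw [hterm, hemp y (by simpa using hy)]
        _ ≤ ∑ y : Fin n → B,
            ∏ t, empDist (fun t => (z t, y₀ t)) (z t, y t) / empDist z (z t) := by
            refine Finset.sum_le_sum_of_subset_of_nonneg (Finset.filter_subset _ _) ?_
            intro y _ _
            exact Finset.prod_nonneg fun t _ =>
              div_nonneg (empDist_nonneg _ _) (empDist_nonneg _ _)
        _ = ∏ t, ∑ b, empDist (fun t => (z t, y₀ t)) (z t, b) / empDist z (z t) := by
            rw [Finset.prod_univ_sum, Fintype.piFinset_univ]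
        _ = 1 := by
            refine Finset.prod_eq_one fun t _ => ?_
            rw [← Finset.sum_div]
            have := congrFun (fstMarg_empDist (fun t => (z t, y₀ t))) (z t)
            simp only [fstMarg] at this
            rw [this]
            exact div_self (empDist_apply_pos z t).ne'
    · have : Finset.univ.filter (fun y => N y = c) = ∅ := by
        ext y; simp; exact fun h => hne ⟨y, h⟩
      rw [this]; simp
  calc _ ≤ ∑ _c : A × B → Fin (n + 1), (1 : ℝ) := Finset.sum_le_sum fun c _ => hclass c
    _ = _ := by simp [Fintype.card_prod]

lemma pow_mul_exp_neg_le_factorial (k : ℕ) : (k : ℝ) ^ k * Real.exp (-k) ≤ (k.factorial : ℝ) := by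
  have := Real.pow_div_factorial_le_exp (x := (k : ℝ)) (by positivity) k
  rw [div_le_iff₀ (by positivity)] at this
  rw [Real.exp_neg, ← div_eq_mul_inv, div_le_iff₀ (Real.exp_pos _)]
  linarith

lemma factorial_le_mul_pow_mul_exp_neg (k : ℕ) :
    (k.factorial : ℝ) ≤ Real.exp 1 * (k + 1) * ((k : ℝ) ^ k * Real.exp (-k)) := by
  rcases k with _ | k
  · simp
  have h := Stirling.stirlingSeq'_antitone (Nat.zero_le k)
  simp only [Function.comp_apply, Nat.succ_eq_add_one, zero_add, Stirling.stirlingSeq_one] at h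
  unfold Stirling.stirlingSeq at h
  set m : ℕ := k + 1 with hm
  have hm1 : (1 : ℝ) ≤ m := by exact_mod_cast Nat.succ_le_succ (Nat.zero_le k)
  have hs : 0 < √(2 * (m : ℝ)) * (m / Real.exp 1) ^ m := by positivity
  rw [div_le_iff₀ hs] at h
  have hsq : √(2 * (m : ℝ)) = √2 * √m := by rw [Real.sqrt_mul (by norm_num)]
  have hm2 : √(m : ℝ) ≤ m + 1 := by
    rw [Real.sqrt_le_left (by positivity)]; nlinarith
  have he : ((m : ℝ) / Real.exp 1) ^ m = (m : ℝ) ^ m * Real.exp (-m) := by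
    rw [div_pow, ← Real.exp_nat_mul, Real.exp_neg]; simp [div_eq_mul_inv]
  calc (m.factorial : ℝ) ≤ _ := h
    _ = Real.exp 1 * √m * ((m : ℝ) ^ m * Real.exp (-m)) := by
        rw [he, hsq]
        have : √2 ≠ (0 : ℝ) := by positivity
        field_simp
    _ ≤ _ := by gcongr

lemma mul_entropy_empDist {n : ℕ} (z : Fin n → A) :
    n * entropy (empDist z) =
      n * Real.log n - ∑ a, (letterCount z a : ℝ) * Real.log (letterCount z a) := by
  rcases Nat.eq_zero_or_pos n with rfl | hn
  · simp [letterCount]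
  have hs : (n : ℝ) = ∑ a, (letterCount z a : ℝ) := by
    rw [← Nat.cast_sum, sum_letterCount]
  nth_rewrite 2 [hs]
  rw [entropy, Finset.mul_sum, Finset.sum_mul, ← Finset.sum_sub_distrib]
  refine Finset.sum_congr rfl fun a _ => ?_
  rw [empDist_eq_letterCount_div, Real.negMulLog]
  rcases Nat.eq_zero_or_pos (letterCount z a) with h | h
  · simp [h]
  rw [Real.log_div (by positivity) (by positivity)]
  field_simp
  ring

lemma pow_self_eq_exp (k : ℕ) : (k : ℝ) ^ k = Real.exp (k * Real.log k) := by
  rcases Nat.eq_zero_or_pos k with rfl | h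
  · simp
  rw [mul_comm, Real.exp_mul, Real.exp_log (by positivity), Real.rpow_natCast]

/-- Permuting the coordinates of `y` by permutations fixing `z` produces
`∏ n_a! / ∏ n_ab!` sequences of the same conditional type as `y`. -/
lemma prod_factorial_le_card_mul {n : ℕ} (z : Fin n → A) (y : Fin n → B) :
    ∏ a, (letterCount z a).factorial ≤
      (Finset.univ.filter fun y' : Fin n → B =>
        empDist (fun t => (z t, y' t)) = empDist (fun t => (z t, y t))).card *
      ∏ p : A × B, (letterCount (fun t => (z t, y t)) p).factorial := by
  classical
  have h1 := DomMulAct.stabilizer_card (f := z)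
  have h2 := DomMulAct.stabilizer_card (f := fun t => (z t, y t))
  have e1 : ∏ a, (letterCount z a).factorial =
      Fintype.card {σ : Equiv.Perm (Fin n) // z ∘ σ = z} := by
    rw [h1]; simp [letterCount, Fintype.card_subtype]
  have e2 : ∏ p : A × B, (letterCount (fun t => (z t, y t)) p).factorial =
      Fintype.card {σ : Equiv.Perm (Fin n) // (fun t => (z t, y t)) ∘ σ = fun t => (z t, y t)} := by
    rw [h2]; simp only [letterCount, Fintype.card_subtype]
  rw [e1, e2, Fintype.card_subtype, Fintype.card_subtype]
  rw [mul_comm]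
  -- two permutations fixing `z` give the same sequence iff they differ by a stabilizer of `(z,y)`
  refine Finset.card_le_mul_card_image_of_maps_to
    (f := fun σ : Equiv.Perm (Fin n) => y ∘ σ) ?_ _ ?_
  · intro σ hσ
    simp only [Finset.mem_filter, Finset.mem_univ, true_and] at hσ ⊢
    ext p
    unfold empDist
    congr 2
    refine Finset.card_bij (fun t _ => σ t) ?_ (fun _ _ _ _ h => σ.injective h) ?_
    · intro t ht
      simp only [Finset.mem_filter, Finset.mem_univ, true_and, Function.comp] at ht ⊢
      rw [← ht]; congr 1; exact congrFun hσ t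
    · intro t ht
      refine ⟨σ.symm t, ?_, by simp⟩
      simp only [Finset.mem_filter, Finset.mem_univ, true_and, Function.comp] at ht ⊢
      rw [← ht]
      have := congrFun hσ (σ.symm t)
      simp at this
      simp [this]
  · intro y' _
    by_cases hne : ∃ τ : Equiv.Perm (Fin n), z ∘ τ = z ∧ y ∘ τ = y'
    · obtain ⟨τ, hτz, hτy⟩ := hne
      refine Finset.card_le_card_of_injOn (fun σ => σ * τ⁻¹) ?_ ?_
      · intro σ hσ
        simp only [Finset.coe_filter, Finset.mem_filter, Finset.mem_univ, true_and,
          Set.mem_ofPred_eq] at hσ ⊢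
        funext t
        have hz := congrFun hσ.1 (τ⁻¹ t)
        have hy := congrFun (hσ.2.trans hτy.symm) (τ⁻¹ t)
        have hz' := congrFun hτz (τ⁻¹ t)
        simp [Function.comp] at hz hy hz'
        simp [Function.comp, hz, hy, ← hz']
      · intro σ _ σ' _ h
        exact mul_right_cancel h
    · rw [Finset.card_eq_zero.2]
      · exact Nat.zero_le _
      · ext σ
        simp only [Finset.mem_filter, Finset.mem_univ, true_and, Finset.notMem_empty, iff_false]
        exact fun h => hne ⟨σ, h.1, h.2⟩

/-- Lower bound on the size of a conditional type class. -/
theorem exp_entropy_sub_le_card {n : ℕ} (z : Fin n → A) (y : Fin n → B) :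
    Real.exp (n * (entropy (empDist fun t => (z t, y t)) - entropy (empDist z))) ≤
      (Real.exp 1 * (n + 1)) ^ (Fintype.card A * Fintype.card B) *
      (Finset.univ.filter fun y' : Fin n → B =>
        empDist (fun t => (z t, y' t)) = empDist (fun t => (z t, y t))).card := by
  set w : Fin n → A × B := fun t => (z t, y t) with hw
  set c := (Finset.univ.filter fun y' : Fin n → B =>
        empDist (fun t => (z t, y' t)) = empDist w).card with hc
  have key : (∏ a, ((letterCount z a).factorial : ℝ)) ≤
      c * ∏ p : A × B, ((letterCount w p).factorial : ℝ) := by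
    exact_mod_cast prod_factorial_le_card_mul z y
  have hlow : Real.exp (∑ a, (letterCount z a : ℝ) * Real.log (letterCount z a)) * Real.exp (-n) ≤
      ∏ a, ((letterCount z a).factorial : ℝ) := by
    have : Real.exp (-(n : ℝ)) = ∏ a, Real.exp (-(letterCount z a : ℝ)) := by
      rw [← Real.exp_sum, Finset.sum_neg_distrib, ← Nat.cast_sum, sum_letterCount]
    rw [this, Real.exp_sum, ← Finset.prod_mul_distrib]
    refine Finset.prod_le_prod (fun a _ => by positivity) fun a _ => ?_
    rw [← pow_self_eq_exp]
    exact pow_mul_exp_neg_le_factorial _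
  have hup : ∏ p : A × B, ((letterCount w p).factorial : ℝ) ≤
      (Real.exp 1 * (n + 1)) ^ (Fintype.card A * Fintype.card B) *
      (Real.exp (∑ p, (letterCount w p : ℝ) * Real.log (letterCount w p)) * Real.exp (-n)) := by
    have : Real.exp (-(n : ℝ)) = ∏ p, Real.exp (-(letterCount w p : ℝ)) := by
      rw [← Real.exp_sum, Finset.sum_neg_distrib, ← Nat.cast_sum, sum_letterCount]
    rw [this, Real.exp_sum, ← Finset.prod_mul_distrib, ← Fintype.card_prod, ← Finset.card_univ,
      ← Finset.prod_const, ← Finset.prod_mul_distrib]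
    refine Finset.prod_le_prod (fun a _ => by positivity) fun p _ => ?_
    rw [← pow_self_eq_exp]
    refine (factorial_le_mul_pow_mul_exp_neg _).trans ?_
    have := letterCount_le w p
    gcongr
  have h3 := mul_entropy_empDist w
  have h4 := mul_entropy_empDist z
  have h5 : n * (entropy (empDist w) - entropy (empDist z)) =
      (∑ a, (letterCount z a : ℝ) * Real.log (letterCount z a)) -
      ∑ p, (letterCount w p : ℝ) * Real.log (letterCount w p) := by linarith
  rw [h5, Real.exp_sub, div_le_iff₀ (Real.exp_pos _)]
  have h6 := hlow.trans (key.trans (mul_le_mul_of_nonneg_left hup (Nat.cast_nonneg c)))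
  refine le_of_mul_le_mul_right (h6.trans (le_of_eq ?_)) (Real.exp_pos (-(n : ℝ)))
  ring

end Types

/-! ### Rounding distributions to types -/

section Rounding

variable {A B D : Type*} [Fintype A] [Fintype B] [Fintype D]
  [DecidableEq A] [DecidableEq B] [DecidableEq D]

/-- Nonnegative integer margins with the same total are the margins of a nonnegative integer
matrix. -/
lemma exists_nat_matrix (r : A → ℕ) (s : B → ℕ) (h : ∑ a, r a = ∑ b, s b) :
    ∃ K : A → B → ℕ, (∀ a, ∑ b, K a b = r a) ∧ ∀ b, ∑ a, K a b = s b := by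
  have hcard : Fintype.card (Σ a, Fin (r a)) = Fintype.card (Σ b, Fin (s b)) := by simpa using h
  let e := Fintype.equivOfCardEq hcard
  refine ⟨fun a b => (Finset.univ.filter fun p : Σ a, Fin (r a) =>
    p.1 = a ∧ (e p).1 = b).card, fun a => ?_, fun b => ?_⟩
  · have h1 := Finset.card_eq_sum_card_fiberwise
      (s := Finset.univ.filter fun p : Σ a, Fin (r a) => p.1 = a) (t := Finset.univ)
      (f := fun p => (e p).1) (fun _ _ => Finset.mem_coe.2 (Finset.mem_univ _))
    simp only [Finset.filter_filter] at h1
    rw [← h1, ← Fintype.card_subtype,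
      Fintype.card_congr (Equiv.sigmaSubtype (β := fun a => Fin (r a)) a)]
    simp
  · have h1 := Finset.card_eq_sum_card_fiberwise
      (s := Finset.univ.filter fun p : Σ a, Fin (r a) => (e p).1 = b) (t := Finset.univ)
      (f := fun p => p.1) (fun _ _ => Finset.mem_coe.2 (Finset.mem_univ _))
    simp only [Finset.filter_filter, and_comm] at h1
    rw [← h1, ← Fintype.card_subtype,
      Fintype.card_congr (e.subtypeEquiv (q := fun p => p.1 = b) (fun _ => Iff.rfl)),
      Fintype.card_congr (Equiv.sigmaSubtype (β := fun b => Fin (s b)) b)]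
    simp

lemma exists_letterCount_eq {n : ℕ} (N : A → ℕ) (h : ∑ a, N a = n) :
    ∃ w : Fin n → A, ∀ a, letterCount w a = N a := by
  have hcard : Fintype.card (Fin n) = Fintype.card (Σ a, Fin (N a)) := by simp [h]
  let e := Fintype.equivOfCardEq hcard
  refine ⟨fun t => (e t).1, fun a => ?_⟩
  unfold letterCount
  rw [← Fintype.card_subtype,
      Fintype.card_congr (e.subtypeEquiv (q := fun p => p.1 = a) (fun _ => Iff.rfl)),
      Fintype.card_congr (Equiv.sigmaSubtype (β := fun a => Fin (N a)) a)]
  simp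

omit [Fintype A] in
/-- Sequences with the same letter counts are permutations of each other. -/
lemma exists_perm_of_letterCount_eq {n : ℕ} (z w : Fin n → A)
    (h : ∀ a, letterCount z a = letterCount w a) : ∃ σ : Equiv.Perm (Fin n), w ∘ σ = z := by
  have e : ∀ a, {t // z t = a} ≃ {t // w t = a} := fun a => by
    refine Fintype.equivOfCardEq ?_
    simpa [Fintype.card_subtype, letterCount] using h a
  exact ⟨Equiv.ofFiberEquiv e, funext fun t => Equiv.ofFiberEquiv_map e t⟩

/-- Rounding a distribution to an `n`-type without changing its first two marginals, which are
assumed to be `n`-types already. The mass added by the rounding at `(a, b, ·)` sits at `d₀ a`. -/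
theorem exists_empDist_near {n : ℕ} (hn : 0 < n) (P : A × B × D → ℝ) (hP : ∀ p, 0 ≤ P p)
    (r : A → ℕ) (s : B → ℕ) (hr : ∀ a, n * ∑ b, ∑ d, P (a, b, d) = r a)
    (hs : ∀ b, n * ∑ a, ∑ d, P (a, b, d) = s b) (hsum : ∑ a, r a = n) (d₀ : A → D) :
    ∃ w : Fin n → A × B × D, (∀ a, letterCount (fun t => (w t).1) a = r a) ∧
      (∀ b, letterCount (fun t => (w t).2.1) b = s b) ∧
      (∀ p, |empDist w p - P p| ≤ Fintype.card (A × B × D) / n) ∧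
      ∀ a b d, P (a, b, d) = 0 → d ≠ d₀ a → empDist w (a, b, d) = 0 := by
  have hn' : (0 : ℝ) < n := by exact_mod_cast hn
  -- the counts are rounded down, and the margins so lost are restored by an integer matrix `K` with
  -- the missing margins, whose total is at most the number of cells
  let F : A × B × D → ℕ := fun p => ⌊n * P p⌋₊
  have hF : ∀ p, (F p : ℝ) ≤ n * P p := fun p =>
    Nat.floor_le (mul_nonneg hn'.le (hP p))
  have hF' : ∀ p, n * P p - 1 ≤ (F p : ℝ) := fun p => (Nat.sub_one_lt_floor _).le
  have hra : ∀ a, ∑ b, ∑ d, F (a, b, d) ≤ r a := by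
    intro a
    have : ((∑ b, ∑ d, F (a, b, d) : ℕ) : ℝ) ≤ r a := by
      rw [← hr a, Finset.mul_sum]; push_cast
      refine Finset.sum_le_sum fun b _ => ?_
      rw [Finset.mul_sum]
      exact Finset.sum_le_sum fun d _ => hF _
    exact_mod_cast this
  have hsb : ∀ b, ∑ a, ∑ d, F (a, b, d) ≤ s b := by
    intro b
    have : ((∑ a, ∑ d, F (a, b, d) : ℕ) : ℝ) ≤ s b := by
      rw [← hs b, Finset.mul_sum]; push_cast
      refine Finset.sum_le_sum fun b _ => ?_
      rw [Finset.mul_sum]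
      exact Finset.sum_le_sum fun d _ => hF _
    exact_mod_cast this
  have hrs : ∑ a, r a = ∑ b, s b := by
    have : ((∑ a, r a : ℕ) : ℝ) = (∑ b, s b : ℕ) := by
      push_cast
      simp_rw [← hr, ← hs, ← Finset.mul_sum]
      rw [Finset.sum_comm]
    exact_mod_cast this
  obtain ⟨K, hK1, hK2⟩ := exists_nat_matrix (fun a => r a - ∑ b, ∑ d, F (a, b, d))
    (fun b => s b - ∑ a, ∑ d, F (a, b, d)) (by
      rw [Finset.sum_tsub_distrib _ (fun a _ => hra a), Finset.sum_tsub_distrib _ (fun b _ => hsb b),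
        hrs, Finset.sum_comm (f := fun a b => ∑ d, F (a, b, d))])
  let N : A × B × D → ℕ := fun p => F p + if p.2.2 = d₀ p.1 then K p.1 p.2.1 else 0
  have hNa : ∀ a, ∑ b, ∑ d, N (a, b, d) = r a := by
    intro a
    have : ∑ b, ∑ d, N (a, b, d) = (∑ b, ∑ d, F (a, b, d)) + ∑ b, K a b := by
      simp [N, Finset.sum_add_distrib]
    rw [this, hK1]
    exact Nat.add_sub_cancel' (hra a)
  have hNb : ∀ b, ∑ a, ∑ d, N (a, b, d) = s b := by
    intro b
    have : ∑ a, ∑ d, N (a, b, d) = (∑ a, ∑ d, F (a, b, d)) + ∑ a, K a b := by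
      simp [N, Finset.sum_add_distrib]
    rw [this, hK2]
    exact Nat.add_sub_cancel' (hsb b)
  have hNn : ∑ p, N p = n := by
    rw [Fintype.sum_prod_type, ← hsum]
    refine Finset.sum_congr rfl fun a _ => ?_
    rw [Fintype.sum_prod_type, hNa]
  obtain ⟨w, hw⟩ := exists_letterCount_eq N hNn
  have hKle : ∀ a b, (K a b : ℝ) ≤ Fintype.card (A × B × D) := by
    intro a b
    have h1 : K a b ≤ ∑ a, ∑ b, K a b :=
      (Finset.single_le_sum (f := fun b => K a b) (fun _ _ => Nat.zero_le _)
        (Finset.mem_univ b)).trans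
      (Finset.single_le_sum (f := fun a => ∑ b, K a b) (fun _ _ => Nat.zero_le _)
        (Finset.mem_univ a))
    have h2 : ((∑ a, ∑ b, K a b : ℕ) : ℝ) = n - ∑ p, (F p : ℝ) := by
      have : ∑ a, ∑ b, K a b + ∑ p, F p = n := by
        rw [← hsum, Fintype.sum_prod_type, ← Finset.sum_add_distrib]
        refine Finset.sum_congr rfl fun a _ => ?_
        rw [hK1, Fintype.sum_prod_type]
        exact Nat.sub_add_cancel (hra a)
      rw [eq_sub_iff_add_eq]
      exact_mod_cast this
    have h3 : (n : ℝ) = ∑ p, n * P p := by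
      rw [Fintype.sum_prod_type]
      simp_rw [Fintype.sum_prod_type, ← Finset.mul_sum, Finset.mul_sum (Finset.univ : Finset A), hr]
      exact_mod_cast hsum.symm
    calc (K a b : ℝ) ≤ ((∑ a, ∑ b, K a b : ℕ) : ℝ) := by exact_mod_cast h1
      _ = ∑ p, (n * P p - F p) := by rw [h2, Finset.sum_sub_distrib, ← h3]
      _ ≤ ∑ _p : A × B × D, (1 : ℝ) := Finset.sum_le_sum fun p _ => by linarith [hF' p]
      _ = _ := by simp
  refine ⟨w, fun a => ?_, fun b => ?_, fun p => ?_, fun a b d h0 hd => ?_⟩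
  · rw [letterCount_comp w Prod.fst a, ← hNa a]
    simp_rw [hw]
    rw [Finset.sum_filter, Fintype.sum_prod_type, Finset.sum_eq_single a]
    · simp [Fintype.sum_prod_type]
    · exact fun a' _ h => by simp [h]
    · simp
  · rw [letterCount_comp w (fun p => p.2.1) b, ← hNb b]
    simp_rw [hw]
    rw [Finset.sum_filter, Fintype.sum_prod_type]
    refine Finset.sum_congr rfl fun a _ => ?_
    rw [Fintype.sum_prod_type, Finset.sum_eq_single b]
    · simp
    · exact fun b' _ h => by simp [h]
    · simp
  · rw [empDist_eq_letterCount_div, hw]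
    have hcard : (1 : ℝ) ≤ Fintype.card (A × B × D) := by
      exact_mod_cast Fintype.card_pos_iff.2 ⟨p⟩
    have h1 := hF p
    have h2 := hF' p
    have h3 := hKle p.1 p.2.1
    have h4 : |(N p : ℝ) - n * P p| ≤ Fintype.card (A × B × D) := by
      have h5 : (0 : ℝ) ≤ K p.1 p.2.1 := Nat.cast_nonneg _
      simp only [N]
      rw [abs_le]
      split_ifs <;> push_cast <;> constructor <;> linarith
    have h5 : (N p : ℝ) / n - P p = (N p - n * P p) / n := by field_simp
    rw [h5, abs_div, abs_of_pos hn']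
    gcongr
  · rw [empDist_eq_letterCount_div, hw]
    simp [N, F, h0, hd]

end Rounding

/-! ### Couplings, entropy and mutual information as continuous functions -/

section Continuity

variable {A B : Type*} [Fintype A] [Fintype B]

lemma continuous_entropy : Continuous (entropy : (A → ℝ) → ℝ) := by
  unfold entropy; fun_prop

omit [Fintype A] in
lemma continuous_fstMarg : Continuous (fstMarg : (A × B → ℝ) → A → ℝ) := by
  unfold fstMarg; fun_prop

omit [Fintype B] in
lemma continuous_sndMarg : Continuous (sndMarg : (A × B → ℝ) → B → ℝ) := by
  unfold sndMarg; fun_prop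

omit [Fintype A] in
lemma continuous_margXX : Continuous (margXX : (A × A × B → ℝ) → A × A → ℝ) := by
  unfold margXX; fun_prop

omit [Fintype B] in
lemma continuous_margXY : Continuous (margXY : (A × A × B → ℝ) → A × B → ℝ) := by
  unfold margXY; fun_prop

omit [Fintype B] in
lemma continuous_margX'Y : Continuous (margX'Y : (A × A × B → ℝ) → A × B → ℝ) := by
  unfold margX'Y; fun_prop

lemma continuous_mutualInfo : Continuous (mutualInfo : (A × B → ℝ) → ℝ) := by
  unfold mutualInfo
  exact ((continuous_entropy.comp continuous_fstMarg).add
    (continuous_entropy.comp continuous_sndMarg)).sub continuous_entropy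

lemma sndMarg_mem_stdSimplex {Q : A × B → ℝ} (hQ : Q ∈ stdSimplex ℝ (A × B)) :
    sndMarg Q ∈ stdSimplex ℝ B :=
  ⟨fun b => Finset.sum_nonneg fun a _ => hQ.1 (a, b), by
    rw [← hQ.2, Fintype.sum_prod_type, Finset.sum_comm]; rfl⟩

lemma margXY_mem_stdSimplex {P : A × A × B → ℝ} (hP : P ∈ stdSimplex ℝ (A × A × B)) :
    margXY P ∈ stdSimplex ℝ (A × B) :=
  ⟨fun z => Finset.sum_nonneg fun b _ => hP.1 _, by
    rw [← hP.2]; simp only [margXY, Fintype.sum_prod_type]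
    exact Finset.sum_congr rfl fun a _ => Finset.sum_comm⟩

lemma margX'Y_mem_stdSimplex {P : A × A × B → ℝ} (hP : P ∈ stdSimplex ℝ (A × A × B)) :
    margX'Y P ∈ stdSimplex ℝ (A × B) := sndMarg_mem_stdSimplex hP

lemma exists_dist_lt_of_continuousOn {h : (A → ℝ) → ℝ} (hh : ContinuousOn h (stdSimplex ℝ A))
    {ε : ℝ} (hε : 0 < ε) : ∃ δ > 0, ∀ p ∈ stdSimplex ℝ A, ∀ q ∈ stdSimplex ℝ A,
      dist p q < δ → |h p - h q| < ε := by
  have := (isCompact_stdSimplex ℝ A).uniformContinuousOn_of_continuous hh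
  rw [Metric.uniformContinuousOn_iff] at this
  simpa [Real.dist_eq] using this ε hε

lemma bddAbove_image_of_subset_stdSimplex {h : (A → ℝ) → ℝ}
    (hh : ContinuousOn h (stdSimplex ℝ A)) {S : Set (A → ℝ)} (hS : S ⊆ stdSimplex ℝ A) :
    BddAbove (h '' S) :=
  ((isCompact_stdSimplex ℝ A).bddAbove_image hh).mono (Set.image_mono hS)

lemma bddBelow_image_of_subset_stdSimplex {h : (A → ℝ) → ℝ}
    (hh : ContinuousOn h (stdSimplex ℝ A)) {S : Set (A → ℝ)} (hS : S ⊆ stdSimplex ℝ A) :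
    BddBelow (h '' S) :=
  ((isCompact_stdSimplex ℝ A).bddBelow_image hh).mono (Set.image_mono hS)

/-- A coupling of `p` and `q` can be moved to a coupling of `p` and `q'` at the cost of a
displacement `‖q - q'‖`: columns that are too heavy are scaled down, and the mass so released is
distributed over the columns that are too light. -/
theorem exists_coupling_near {p : A → ℝ} {q q' : B → ℝ} {Q : A × B → ℝ}
    (hQ : Q ∈ couplings p q) (hq' : q' ∈ stdSimplex ℝ B) :
    ∃ Q' ∈ couplings p q', dist Q' Q ≤ dist q q' := by
  obtain ⟨hQs, hp, hq⟩ := hQ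
  have hqs : q ∈ stdSimplex ℝ B := hq ▸ sndMarg_mem_stdSimplex hQs
  have hcol : ∀ b, ∑ a, Q (a, b) = q b := fun b => congrFun hq b
  have hrow : ∀ a, ∑ b, Q (a, b) = p a := fun a => congrFun hp a
  let f : B → ℝ := fun b => min (q b) (q' b) / q b
  have hf0 : ∀ b, 0 ≤ f b := fun b => div_nonneg (le_min (hqs.1 b) (hq'.1 b)) (hqs.1 b)
  have hf1 : ∀ b, f b ≤ 1 := fun b => div_le_one_of_le₀ (min_le_left _ _) (hqs.1 b)
  have hfq : ∀ b, q b * f b = min (q b) (q' b) := by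
    intro b
    rcases (hqs.1 b).eq_or_lt with h | h
    · simp only [f]
      rw [← h]; simp [hq'.1 b]
    · simp only [f]; field_simp
  -- `r` is the mass released by the rows, `s` the mass missing in the columns; when the common total
  -- `S` vanishes, the junk value of the division by `S` is harmless because `r` and `s` vanish
  let r : A → ℝ := fun a => ∑ b, Q (a, b) * (1 - f b)
  let s : B → ℝ := fun b => q' b - min (q b) (q' b)
  have hr0 : ∀ a, 0 ≤ r a := fun a =>
    Finset.sum_nonneg fun b _ => mul_nonneg (hQs.1 _) (by linarith [hf1 b])
  have hs0 : ∀ b, 0 ≤ s b := fun b => by simp [s]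
  have hrs : ∑ a, r a = ∑ b, s b := by
    simp only [r, s]
    rw [Finset.sum_comm, Finset.sum_sub_distrib,
      show ∑ b, q' b = ∑ b, q b from hq'.2.trans hqs.2.symm, ← Finset.sum_sub_distrib]
    refine Finset.sum_congr rfl fun b _ => ?_
    rw [← Finset.sum_mul, hcol, mul_sub, hfq, mul_one]
  set S := ∑ b, s b with hS
  have hS0 : 0 ≤ S := Finset.sum_nonneg fun b _ => hs0 b
  have hrS : ∀ a, r a ≤ S := fun a =>
    hrs ▸ Finset.single_le_sum (f := r) (fun a _ => hr0 a) (Finset.mem_univ a)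
  have hr' : ∀ a, r a * S / S = r a := by
    intro a
    rcases hS0.eq_or_lt with h | h
    · have := hrS a
      have h2 := hr0 a
      rw [← h] at this ⊢
      simp; linarith
    · field_simp
  have hs' : ∀ b, S * s b / S = s b := by
    intro b
    rcases hS0.eq_or_lt with h | h
    · have := Finset.single_le_sum (f := s) (fun a _ => hs0 a) (Finset.mem_univ b)
      have h2 := hs0 b
      rw [← hS, ← h] at this
      rw [← h]
      simp; linarith
    · field_simp
  let Q' : A × B → ℝ := fun z => Q z * f z.2 + r z.1 * s z.2 / S
  have hfst : fstMarg Q' = p := by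
    ext a
    simp only [fstMarg, Q', Finset.sum_add_distrib]
    rw [← Finset.sum_div, ← Finset.mul_sum, ← hS, hr', ← Finset.sum_add_distrib, ← hrow]
    exact Finset.sum_congr rfl fun b _ => by ring
  have hsnd : sndMarg Q' = q' := by
    ext b
    simp only [sndMarg, Q', Finset.sum_add_distrib]
    rw [← Finset.sum_div, ← Finset.sum_mul, ← Finset.sum_mul, hrs, hs', hcol, hfq]
    simp [s]
  refine ⟨Q', ⟨⟨fun z => ?_, ?_⟩, hfst, hsnd⟩, ?_⟩
  · exact add_nonneg (mul_nonneg (hQs.1 z) (hf0 _))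
      (div_nonneg (mul_nonneg (hr0 _) (hs0 _)) hS0)
  · have : ∑ z, Q' z = ∑ b, sndMarg Q' b := by
      rw [Fintype.sum_prod_type, Finset.sum_comm]; rfl
    rw [this, hsnd, hq'.2]
  · refine (dist_pi_le_iff dist_nonneg).2 fun z => ?_
    have hd := dist_le_pi_dist q q' z.2
    rw [Real.dist_eq] at hd ⊢
    have hQle : Q z ≤ q z.2 := by
      rw [← hcol]
      exact Finset.single_le_sum (f := fun a => Q (a, z.2)) (fun a _ => hQs.1 _)
        (Finset.mem_univ z.1)
    have h1 : Q z * (1 - f z.2) ≤ |q z.2 - q' z.2| := by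
      calc Q z * (1 - f z.2) ≤ q z.2 * (1 - f z.2) :=
            mul_le_mul_of_nonneg_right hQle (by linarith [hf1 z.2])
        _ = q z.2 - min (q z.2) (q' z.2) := by rw [mul_sub, hfq, mul_one]
        _ ≤ _ := by
            rcases le_total (q z.2) (q' z.2) with h | h
            · simp [h]
            · simp [h, le_abs_self]
    have h2 : r z.1 * s z.2 / S ≤ |q z.2 - q' z.2| := by
      calc r z.1 * s z.2 / S ≤ S * s z.2 / S := by
            have := hrS z.1
            have := hs0 z.2
            gcongr
        _ = s z.2 := hs' _
        _ ≤ _ := by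
            simp only [s]
            rcases le_total (q z.2) (q' z.2) with h | h
            · rw [min_eq_left h, abs_sub_comm]; exact le_abs_self _
            · simp [h]
    have h3 : 0 ≤ Q z * (1 - f z.2) := mul_nonneg (hQs.1 z) (by linarith [hf1 z.2])
    have h4 : 0 ≤ r z.1 * s z.2 / S := div_nonneg (mul_nonneg (hr0 _) (hs0 _)) hS0
    have h5 : Q' z - Q z = r z.1 * s z.2 / S - Q z * (1 - f z.2) := by simp only [Q']; ring
    rw [h5]
    refine (abs_le.2 ⟨?_, ?_⟩).trans hd <;> linarith

/-- The product distribution. -/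
def prodDist (p : A → ℝ) (q : B → ℝ) (z : A × B) : ℝ := p z.1 * q z.2

lemma prodDist_mem_couplings {p : A → ℝ} {q : B → ℝ} (hp : p ∈ stdSimplex ℝ A)
    (hq : q ∈ stdSimplex ℝ B) : prodDist p q ∈ couplings p q := by
  have h1 : fstMarg (prodDist p q) = p := by
    ext a; simp [fstMarg, prodDist, ← Finset.mul_sum, hq.2]
  have h2 : sndMarg (prodDist p q) = q := by
    ext b; simp [sndMarg, prodDist, ← Finset.sum_mul, hp.2]
  refine ⟨⟨fun z => mul_nonneg (hp.1 _) (hq.1 _), ?_⟩, h1, h2⟩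
  have : ∑ z, prodDist p q z = ∑ a, fstMarg (prodDist p q) a := by
    rw [Fintype.sum_prod_type]; rfl
  rw [this, h1, hp.2]

lemma mutualInfo_prodDist {p : A → ℝ} {q : B → ℝ} (hp : p ∈ stdSimplex ℝ A)
    (hq : q ∈ stdSimplex ℝ B) : mutualInfo (prodDist p q) = 0 := by
  obtain ⟨-, h1, h2⟩ := prodDist_mem_couplings hp hq
  rw [mutualInfo, h1, h2]
  have : entropy (prodDist p q) = entropy p + entropy q := by
    simp only [entropy, prodDist, Fintype.sum_prod_type, Real.negMulLog_mul,
      Finset.sum_add_distrib]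
    rw [Finset.sum_comm]
    simp_rw [← Finset.mul_sum, ← Finset.sum_mul, hp.2, one_mul]
    rw [hq.2, one_mul]
  rw [this]; ring

lemma le_entropy_mix {p q : A → ℝ} (hp : ∀ a, 0 ≤ p a) (hq : ∀ a, 0 ≤ q a) {t : ℝ}
    (ht0 : 0 ≤ t) (ht1 : t ≤ 1) :
    (1 - t) * entropy p + t * entropy q ≤ entropy (fun a => (1 - t) * p a + t * q a) := by
  rw [entropy, entropy, Finset.mul_sum, Finset.mul_sum, ← Finset.sum_add_distrib]
  refine Finset.sum_le_sum fun a _ => ?_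
  exact Real.concaveOn_negMulLog.2 (hp a) (hq a) (by linarith) ht0 (by ring)

/-- Mixing a coupling with the product of its marginals contracts the mutual information. -/
lemma mutualInfo_mix_le {p : A → ℝ} {q : B → ℝ} (hp : p ∈ stdSimplex ℝ A)
    (hq : q ∈ stdSimplex ℝ B) {Q : A × B → ℝ} (hQ : Q ∈ couplings p q) {t : ℝ}
    (ht0 : 0 ≤ t) (ht1 : t ≤ 1) :
    (fun z => (1 - t) * Q z + t * prodDist p q z) ∈ couplings p q ∧
    mutualInfo (fun z => (1 - t) * Q z + t * prodDist p q z) ≤ (1 - t) * mutualInfo Q ∧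
    dist (fun z => (1 - t) * Q z + t * prodDist p q z) Q ≤ t := by
  have hpq := prodDist_mem_couplings hp hq
  have hI := mutualInfo_prodDist hp hq
  set N := prodDist p q with hN
  have h1 : fstMarg (fun z => (1 - t) * Q z + t * N z) = p := by
    ext a
    have e1 := congrFun hQ.2.1 a
    have e2 := congrFun hpq.2.1 a
    simp only [fstMarg] at e1 e2 ⊢
    rw [Finset.sum_add_distrib, ← Finset.mul_sum, ← Finset.mul_sum, e1, e2]; ring
  have h2 : sndMarg (fun z => (1 - t) * Q z + t * N z) = q := by
    ext a
    have e1 := congrFun hQ.2.2 a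
    have e2 := congrFun hpq.2.2 a
    simp only [sndMarg] at e1 e2 ⊢
    rw [Finset.sum_add_distrib, ← Finset.mul_sum, ← Finset.mul_sum, e1, e2]; ring
  refine ⟨⟨⟨fun z => ?_, ?_⟩, h1, h2⟩, ?_, ?_⟩
  · exact add_nonneg (mul_nonneg (by linarith) (hQ.1.1 z)) (mul_nonneg ht0 (hpq.1.1 z))
  · rw [Finset.sum_add_distrib, ← Finset.mul_sum, ← Finset.mul_sum, hQ.1.2, hpq.1.2]; ring
  · have h3 := le_entropy_mix hQ.1.1 hpq.1.1 ht0 ht1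
    rw [mutualInfo, hpq.2.1, hpq.2.2] at hI
    rw [mutualInfo, mutualInfo, h1, h2, hQ.2.1, hQ.2.2]
    have : t * entropy N = t * (entropy p + entropy q) := by
      congr 1; linarith
    linarith
  · refine (dist_pi_le_iff ht0).2 fun z => ?_
    rw [Real.dist_eq]
    have e : (1 - t) * Q z + t * N z - Q z = t * (N z - Q z) := by ring
    rw [e, abs_mul, abs_of_nonneg ht0]
    have b1 := (mem_Icc_of_mem_stdSimplex hQ.1 z)
    have b2 := (mem_Icc_of_mem_stdSimplex hpq.1 z)
    have : |N z - Q z| ≤ 1 := by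
      rw [abs_le]; constructor <;> linarith [b1.1, b1.2, b2.1, b2.2]
    nlinarith

end Continuity

/-! ### Continuity of the single-letter quantities -/

section SingleLetterContinuity

variable {X Y : Type*} [Fintype X] [Fintype Y]
  {g : (X × Y → ℝ) → ℝ} (hg : ContinuousOn g (stdSimplex ℝ (X × Y)))
  {QX : X → ℝ} (hQX : QX ∈ stdSimplex ℝ X) {R : ℝ}

include hg hQX

/-- Up to an arbitrarily small loss, the maximum defining `α` is approached at mutual information
bounded away from `R`, uniformly in the output distribution. -/
theorem exists_coupling_alpha (hR : 0 < R) {ε : ℝ} (hε : 0 < ε) :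
    ∃ δ > 0, ∀ q ∈ stdSimplex ℝ Y, ∃ Q ∈ couplings QX q, mutualInfo Q ≤ R - δ ∧
      alpha g QX R q - ε ≤ g Q - mutualInfo Q + R := by
  have hcont : ContinuousOn (fun Q => g Q - mutualInfo Q) (stdSimplex ℝ (X × Y)) :=
    hg.sub continuous_mutualInfo.continuousOn
  obtain ⟨δ, hδ, hunif⟩ := exists_dist_lt_of_continuousOn hcont (half_pos hε)
  -- a near-maximizer is mixed with the product distribution, with a small weight `t`
  set t := min (δ / 2) 1 with ht
  have ht0 : 0 < t := lt_min (half_pos hδ) one_pos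
  have ht1 : t ≤ 1 := min_le_right _ _
  have htδ : t < δ := (min_le_left _ _).trans_lt (half_lt_self hδ)
  refine ⟨t * R, mul_pos ht0 hR, fun q hq => ?_⟩
  have hne : ((fun Q => g Q - mutualInfo Q) ''
      {Q | Q ∈ couplings QX q ∧ mutualInfo Q ≤ R}).Nonempty :=
    ⟨_, _, ⟨prodDist_mem_couplings hQX hq, by rw [mutualInfo_prodDist hQX hq]; exact hR.le⟩, rfl⟩
  obtain ⟨-, ⟨Q, ⟨hQ, hQI⟩, rfl⟩, hlt⟩ := exists_lt_of_lt_csSup hne (sub_lt_self _ (half_pos hε))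
  obtain ⟨h1, h2, h3⟩ := mutualInfo_mix_le hQX hq hQ ht0.le ht1
  refine ⟨_, h1, ?_, ?_⟩
  · refine h2.trans ?_
    nlinarith
  · have := hunif _ h1.1 _ hQ.1 (h3.trans_lt htδ)
    rw [abs_lt] at this
    simp only [alpha] at hlt ⊢
    linarith [this.1]

lemma exists_alpha_le_add (hR : 0 < R) {ε : ℝ} (hε : 0 < ε) :
    ∃ δ > 0, ∀ q ∈ stdSimplex ℝ Y, ∀ q' ∈ stdSimplex ℝ Y, dist q q' < δ →
      alpha g QX R q ≤ alpha g QX R q' + ε := by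
  have hcont : ContinuousOn (fun Q => g Q - mutualInfo Q) (stdSimplex ℝ (X × Y)) :=
    hg.sub continuous_mutualInfo.continuousOn
  obtain ⟨η, hη, hcore⟩ := exists_coupling_alpha hg hQX hR (half_pos hε)
  obtain ⟨δ₁, hδ₁, h1⟩ := exists_dist_lt_of_continuousOn hcont (half_pos hε)
  obtain ⟨δ₂, hδ₂, h2⟩ := exists_dist_lt_of_continuousOn
    (continuous_mutualInfo (A := X) (B := Y)).continuousOn hη
  refine ⟨min δ₁ δ₂, lt_min hδ₁ hδ₂, fun q hq q' hq' hd => ?_⟩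
  obtain ⟨Q, hQ, hQI, hQv⟩ := hcore q hq
  obtain ⟨Q', hQ', hd'⟩ := exists_coupling_near hQ hq'
  have e1 := h1 _ hQ'.1 _ hQ.1 ((hd'.trans_lt hd).trans_le (min_le_left _ _))
  have e2 := h2 _ hQ'.1 _ hQ.1 ((hd'.trans_lt hd).trans_le (min_le_right _ _))
  rw [abs_lt] at e1 e2
  have h3 : g Q' - mutualInfo Q' ≤ sSup ((fun Q => g Q - mutualInfo Q) ''
      {Q | Q ∈ couplings QX q' ∧ mutualInfo Q ≤ R}) :=
    le_csSup (bddAbove_image_of_subset_stdSimplex hcont fun Q h => h.1.1)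
      ⟨Q', ⟨hQ', by linarith [e2.2]⟩, rfl⟩
  have h4 : alpha g QX R q' = sSup ((fun Q => g Q - mutualInfo Q) ''
      {Q | Q ∈ couplings QX q' ∧ mutualInfo Q ≤ R}) + R := rfl
  linarith [e1.1]

omit hQX in
lemma le_beta {q : Y → ℝ} {Q : X × Y → ℝ} (hQ : Q ∈ couplings QX q) :
    g Q + max 0 (R - mutualInfo Q) ≤ beta g QX R q := by
  have hcont : ContinuousOn (fun Q => g Q + max 0 (R - mutualInfo Q)) (stdSimplex ℝ (X × Y)) :=
    hg.add (continuous_const.max (continuous_const.sub continuous_mutualInfo)).continuousOn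
  exact le_csSup (bddAbove_image_of_subset_stdSimplex hcont fun Q h => h.1) ⟨Q, hQ, rfl⟩

lemma exists_beta_le_add {ε : ℝ} (hε : 0 < ε) :
    ∃ δ > 0, ∀ q ∈ stdSimplex ℝ Y, ∀ q' ∈ stdSimplex ℝ Y, dist q q' < δ →
      beta g QX R q ≤ beta g QX R q' + ε := by
  have hcont : ContinuousOn (fun Q => g Q + max 0 (R - mutualInfo Q)) (stdSimplex ℝ (X × Y)) :=
    hg.add (continuous_const.max (continuous_const.sub continuous_mutualInfo)).continuousOn
  obtain ⟨δ₁, hδ₁, h1⟩ := exists_dist_lt_of_continuousOn hcont hε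
  refine ⟨δ₁, hδ₁, fun q hq q' hq' hd => ?_⟩
  refine csSup_le ⟨_, _, prodDist_mem_couplings hQX hq, rfl⟩ ?_
  rintro - ⟨Q, hQ, rfl⟩
  obtain ⟨Q', hQ', hd'⟩ := exists_coupling_near hQ hq'
  have e1 := h1 _ hQ'.1 _ hQ.1 (hd'.trans_lt hd)
  rw [abs_lt] at e1
  have h3 := le_beta (R := R) hg hQ'
  simp only at e1 ⊢
  linarith [e1.1]

omit hg hQX in
lemma continuousOn_of_le_add {h : (Y → ℝ) → ℝ}
    (hh : ∀ ε > 0, ∃ δ > 0, ∀ q ∈ stdSimplex ℝ Y, ∀ q' ∈ stdSimplex ℝ Y, dist q q' < δ →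
      h q ≤ h q' + ε) : ContinuousOn h (stdSimplex ℝ Y) := by
  rw [Metric.continuousOn_iff]
  intro q hq ε hε
  obtain ⟨δ, hδ, H⟩ := hh (ε / 2) (half_pos hε)
  refine ⟨δ, hδ, fun q' hq' hd => ?_⟩
  rw [Real.dist_eq, abs_lt]
  have h1 := H q hq q' hq' (by rwa [dist_comm])
  have h2 := H q' hq' q hq hd
  constructor <;> linarith

lemma continuousOn_alpha (hR : 0 < R) : ContinuousOn (alpha g QX R) (stdSimplex ℝ Y) :=
  continuousOn_of_le_add fun _ hε => exists_alpha_le_add hg hQX hR hε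

lemma continuousOn_beta : ContinuousOn (beta g QX R) (stdSimplex ℝ Y) :=
  continuousOn_of_le_add fun _ hε => exists_beta_le_add hg hQX hε

omit hg hQX

/-- The exponential cost `H(X,X') - H(X,X',Y) - E log W(Y|X)` of a conditional type of `Y` given
`(X,X')`. It is continuous, and under `FiniteDiv` it is `D(Q_{Y|X} ‖ W | Q_X) + I(X';Y|X)`. -/
noncomputable def channelCost (W : X → Y → ℝ) (P : X × X × Y → ℝ) : ℝ :=
  entropy (margXX P) - entropy P - ∑ x, ∑ y, margXY P (x, y) * Real.log (W x y)

lemma continuous_channelCost (W : X → Y → ℝ) : Continuous (channelCost W) := by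
  unfold channelCost
  refine ((continuous_entropy.comp continuous_margXX).sub continuous_entropy).sub ?_
  have := continuous_margXY (A := X) (B := Y)
  fun_prop

lemma condDiv_add_condMutualInfo {W : X → Y → ℝ} {P : X × X × Y → ℝ} (hP : ∀ z, 0 ≤ P z)
    (hfin : FiniteDiv W (margXY P)) :
    condDiv W (margXY P) + condMutualInfo P = channelCost W P := by
  set Q := margXY P with hQ
  have hQ0 : ∀ z, 0 ≤ Q z := fun z => Finset.sum_nonneg fun _ _ => hP _
  have h : condDiv W Q = entropy (fstMarg Q) - entropy Q -
      ∑ x, ∑ y, Q (x, y) * Real.log (W x y) := by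
    rw [entropy, entropy, Fintype.sum_prod_type, condDiv, ← Finset.sum_sub_distrib,
      ← Finset.sum_sub_distrib]
    refine Finset.sum_congr rfl fun x _ => ?_
    rw [Real.negMulLog]
    nth_rewrite 2 [fstMarg]
    rw [← Finset.sum_neg_distrib, Finset.sum_mul, ← Finset.sum_sub_distrib,
      ← Finset.sum_sub_distrib]
    refine Finset.sum_congr rfl fun y _ => ?_
    rcases (hQ0 (x, y)).eq_or_lt with h0 | h0
    · rw [← h0]; simp
    · have hW : W x y ≠ 0 := fun h => h0.ne' (hfin x y h)
      have hm : 0 < fstMarg Q x := h0.trans_le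
        (Finset.single_le_sum (f := fun y => Q (x, y)) (fun y _ => hQ0 _) (Finset.mem_univ y))
      rw [Real.log_div (div_pos h0 hm).ne' hW, Real.log_div h0.ne' hm.ne', Real.negMulLog]
      ring
  rw [h, condMutualInfo, channelCost]
  ring

/-- The function minimized in the definition of `Γ`. -/
noncomputable def gamCost (W : X → Y → ℝ) (g : (X × Y → ℝ) → ℝ) (QX : X → ℝ) (R : ℝ)
    (P : X × X × Y → ℝ) : ℝ :=
  channelCost W P +
    max 0 (max (g (margXY P)) (alpha g QX R (sndMarg (margXY P))) - g (margX'Y P))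

/-- The function minimized in the definition of `Λ`. -/
noncomputable def lamCost (W : X → Y → ℝ) (g : (X × Y → ℝ) → ℝ) (QX : X → ℝ) (R : ℝ)
    (P : X × X × Y → ℝ) : ℝ :=
  channelCost W P + beta g QX R (sndMarg (margXY P)) - g (margX'Y P)

lemma Gam_eq_sInf (W : X → Y → ℝ) (g : (X × Y → ℝ) → ℝ) (QX : X → ℝ) (R : ℝ)
    (Q : X × X → ℝ) : Gam W g QX R Q = sInf (gamCost W g QX R '' extensions W Q) := by
  rw [Gam]
  congr 1
  refine Set.image_congr fun P hP => ?_
  rw [gamCost, ← condDiv_add_condMutualInfo hP.1.1 hP.2.2]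

lemma Lam_eq_sInf (W : X → Y → ℝ) (g : (X × Y → ℝ) → ℝ) (QX : X → ℝ) (R : ℝ)
    (Q : X × X → ℝ) : Lam W g QX R Q = sInf (lamCost W g QX R '' extensions W Q) := by
  rw [Lam]
  congr 1
  refine Set.image_congr fun P hP => ?_
  rw [lamCost, ← condDiv_add_condMutualInfo hP.1.1 hP.2.2]

lemma continuousOn_comp_margXY (h : ContinuousOn g (stdSimplex ℝ (X × Y))) :
    ContinuousOn (fun P : X × X × Y → ℝ => g (margXY P)) (stdSimplex ℝ (X × X × Y)) :=
  h.comp continuous_margXY.continuousOn fun _ => margXY_mem_stdSimplex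

lemma continuousOn_comp_margX'Y (h : ContinuousOn g (stdSimplex ℝ (X × Y))) :
    ContinuousOn (fun P : X × X × Y → ℝ => g (margX'Y P)) (stdSimplex ℝ (X × X × Y)) :=
  h.comp continuous_margX'Y.continuousOn fun _ => margX'Y_mem_stdSimplex

include hg hQX

lemma continuousOn_gamCost (W : X → Y → ℝ) (hR : 0 < R) :
    ContinuousOn (gamCost W g QX R) (stdSimplex ℝ (X × X × Y)) := by
  have hα : ContinuousOn (fun Q : X × Y → ℝ => alpha g QX R (sndMarg Q))
      (stdSimplex ℝ (X × Y)) :=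
    (continuousOn_alpha hg hQX hR).comp continuous_sndMarg.continuousOn
      fun _ => sndMarg_mem_stdSimplex
  exact (continuous_channelCost W).continuousOn.add
    (ContinuousOn.sup continuousOn_const (((continuousOn_comp_margXY hg).sup
      (continuousOn_comp_margXY hα)).sub (continuousOn_comp_margX'Y hg)))

lemma continuousOn_lamCost (W : X → Y → ℝ) :
    ContinuousOn (lamCost W g QX R) (stdSimplex ℝ (X × X × Y)) := by
  have hβ : ContinuousOn (fun Q : X × Y → ℝ => beta g QX R (sndMarg Q))
      (stdSimplex ℝ (X × Y)) :=
    (continuousOn_beta hg hQX).comp continuous_sndMarg.continuousOn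
      fun _ => sndMarg_mem_stdSimplex
  exact ((continuous_channelCost W).continuousOn.add
    (continuousOn_comp_margXY hβ)).sub (continuousOn_comp_margX'Y hg)

omit hg hQX

lemma extensions_nonempty {W : X → Y → ℝ} (hW : ∀ x, W x ∈ stdSimplex ℝ Y) {Q : X × X → ℝ}
    (hQ : Q ∈ stdSimplex ℝ (X × X)) : (extensions W Q).Nonempty := by
  refine ⟨fun z => Q (z.1, z.2.1) * W z.1 z.2.2, ⟨fun z => ?_, ?_⟩, ?_, ?_⟩
  · exact mul_nonneg (hQ.1 _) ((hW _).1 _)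
  · simp only [Fintype.sum_prod_type, ← Finset.mul_sum, (hW _).2, mul_one]
    rw [← hQ.2, Fintype.sum_prod_type]
  · ext z; simp [margXX, ← Finset.mul_sum, (hW _).2]
  · intro x y h; simp [margXY, h]

end SingleLetterContinuity

/-! ### Counting codes: codes drawn word by word and Chernoff bounds -/

section Sequential

variable {T : Type*}

lemma exp_neg_le_one_sub_half {z : ℝ} (h0 : 0 ≤ z) (h1 : z ≤ 1) : Real.exp (-z) ≤ 1 - z / 2 := by
  have h := Real.add_one_le_exp z
  rw [Real.exp_neg, inv_le_comm₀ (Real.exp_pos _) (by linarith)]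
  refine le_trans ?_ h
  rw [inv_le_iff_one_le_mul₀ (by linarith)]
  nlinarith

lemma exp_le_one_add_two_mul {z : ℝ} (h0 : 0 ≤ z) (h1 : z ≤ 1) : Real.exp z ≤ 1 + 2 * z := by
  have h := Real.abs_exp_sub_one_sub_id_le (x := z) (by rwa [abs_of_nonneg h0])
  have := (abs_le.1 h).2
  nlinarith

variable [Fintype T]

lemma sum_eq_sum_snoc {m : ℕ} (F : (Fin (m + 1) → T) → ℝ) :
    ∑ C, F C = ∑ C : Fin m → T, ∑ x, F (Fin.snoc (α := fun _ => T) C x) := by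
  rw [← Fintype.sum_prod_type']
  refine Fintype.sum_equiv ⟨fun C => (Fin.init C, C (Fin.last m)),
    fun p => Fin.snoc (α := fun _ => T) p.1 p.2, fun C => by simp, fun p => by simp⟩ _ _ ?_
  intro C
  simp

/-- The law of a random code drawn one word at a time, where `κ m C` is the weight function of
word `m` given the preceding words `C`. -/
noncomputable def seqWeight (κ : ∀ m : ℕ, (Fin m → T) → T → ℝ) : ∀ m : ℕ, (Fin m → T) → ℝ
  | 0, _ => 1
  | m + 1, C => seqWeight κ m (Fin.init C) * κ m (Fin.init C) (C (Fin.last m))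

omit [Fintype T] in
lemma seqWeight_nonneg {κ : ∀ m : ℕ, (Fin m → T) → T → ℝ} (hκ : ∀ m C x, 0 ≤ κ m C x) :
    ∀ (m : ℕ) (C : Fin m → T), 0 ≤ seqWeight κ m C
  | 0, _ => zero_le_one
  | m + 1, _ => mul_nonneg (seqWeight_nonneg hκ m _) (hκ _ _ _)

/-- A supermartingale does not increase in expectation. -/
theorem sum_seqWeight_mul_le {κ : ∀ m : ℕ, (Fin m → T) → T → ℝ} (hκ : ∀ m C x, 0 ≤ κ m C x)
    (Φ : ∀ m : ℕ, (Fin m → T) → ℝ) (M : ℕ)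
    (h : ∀ m < M, ∀ C : Fin m → T,
      ∑ x, κ m C x * Φ (m + 1) (Fin.snoc (α := fun _ => T) C x) ≤ Φ m C) :
    ∑ C, seqWeight κ M C * Φ M C ≤ Φ 0 Fin.elim0 := by
  induction M with
  | zero =>
    rw [Fintype.sum_unique]
    simp [seqWeight, Subsingleton.elim (default : Fin 0 → T) Fin.elim0]
  | succ M ih =>
    refine le_trans ?_ (ih fun m hm => h m (hm.trans (Nat.lt_succ_self M)))
    rw [sum_eq_sum_snoc]
    refine Finset.sum_le_sum fun C _ => ?_
    simp only [seqWeight, Fin.init_snoc, Fin.snoc_last, mul_assoc]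
    rw [← Finset.mul_sum]
    exact mul_le_mul_of_nonneg_left (h M (Nat.lt_succ_self M) C) (seqWeight_nonneg hκ _ _)

lemma sum_code_le (Φ : ∀ m : ℕ, (Fin m → T) → ℝ) (M : ℕ)
    (h : ∀ m < M, ∀ C : Fin m → T,
      ∑ x, Φ (m + 1) (Fin.snoc (α := fun _ => T) C x) ≤ Fintype.card T * Φ m C) :
    ∑ C, Φ M C ≤ (Fintype.card T : ℝ) ^ M * Φ 0 Fin.elim0 := by
  induction M with
  | zero =>
    rw [Fintype.sum_unique]
    simp [Subsingleton.elim (default : Fin 0 → T) Fin.elim0]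
  | succ M ih =>
    rw [sum_eq_sum_snoc, pow_succ', mul_assoc]
    refine le_trans (Finset.sum_le_sum fun C _ => h M (Nat.lt_succ_self M) C) ?_
    rw [← Finset.mul_sum]
    exact mul_le_mul_of_nonneg_left (ih fun m hm => h m (hm.trans (Nat.lt_succ_self M)))
      (Nat.cast_nonneg _)

/-- Chernoff bound, upper tail, for the number of codes. -/
theorem card_le_of_sum_ge {u : T → ℝ} (h0 : ∀ x, 0 ≤ u x) (h1 : ∀ x, u x ≤ 1) {c : ℝ}
    (hc : ∑ x, u x ≤ c * Fintype.card T) (M : ℕ) (t : ℝ) :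
    ((Finset.univ.filter fun C : Fin M → T => t ≤ ∑ m, u (C m)).card : ℝ) ≤
      (Fintype.card T : ℝ) ^ M * Real.exp (2 * M * c - t) := by
  have hexp : ∑ x, Real.exp (u x) ≤ Fintype.card T * Real.exp (2 * c) := by
    calc ∑ x, Real.exp (u x) ≤ ∑ x, (1 + 2 * u x) :=
          Finset.sum_le_sum fun x _ => exp_le_one_add_two_mul (h0 x) (h1 x)
      _ = Fintype.card T + 2 * ∑ x, u x := by
          rw [Finset.sum_add_distrib, ← Finset.mul_sum]; simp
      _ ≤ Fintype.card T * (2 * c + 1) := by linarith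
      _ ≤ _ := mul_le_mul_of_nonneg_left (Real.add_one_le_exp _) (Nat.cast_nonneg _)
  have hsum : ∑ C : Fin M → T, Real.exp (∑ m, u (C m)) ≤
      (Fintype.card T : ℝ) ^ M * Real.exp (2 * M * c) := by
    simp_rw [Real.exp_sum]
    rw [← Fintype.sum_pow (fun x => Real.exp (u x))]
    refine (pow_le_pow_left₀ (Finset.sum_nonneg fun x _ => (Real.exp_pos _).le) hexp M).trans ?_
    rw [mul_pow, ← Real.exp_nat_mul]
    apply le_of_eq; congr 2; ring
  rw [Real.exp_sub, ← mul_div_assoc, le_div_iff₀ (Real.exp_pos _)]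
  refine le_trans ?_ hsum
  rw [← nsmul_eq_mul, ← Finset.sum_const]
  refine (Finset.sum_le_sum fun C hC => ?_).trans
    (Finset.sum_le_sum_of_subset_of_nonneg (Finset.subset_univ _) fun C _ _ => (Real.exp_pos _).le)
  exact Real.exp_le_exp.2 (Finset.mem_filter.1 hC).2

/-- Chernoff bound, lower tail, for the number of codes. -/
theorem card_le_of_sum_lt {u : T → ℝ} (h0 : ∀ x, 0 ≤ u x) (h1 : ∀ x, u x ≤ 1) {c : ℝ}
    (hc : c * Fintype.card T ≤ ∑ x, u x) (M : ℕ) (t : ℝ) :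
    ((Finset.univ.filter fun C : Fin M → T => ∑ m, u (C m) < t).card : ℝ) ≤
      (Fintype.card T : ℝ) ^ M * Real.exp (t - M * c / 2) := by
  have hexp : ∑ x, Real.exp (-u x) ≤ Fintype.card T * Real.exp (-(c / 2)) := by
    calc ∑ x, Real.exp (-u x) ≤ ∑ x, (1 - u x / 2) :=
          Finset.sum_le_sum fun x _ => exp_neg_le_one_sub_half (h0 x) (h1 x)
      _ = Fintype.card T - (∑ x, u x) / 2 := by
          rw [Finset.sum_sub_distrib, ← Finset.sum_div]; simp
      _ ≤ Fintype.card T * (-(c / 2) + 1) := by linarith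
      _ ≤ _ := mul_le_mul_of_nonneg_left (Real.add_one_le_exp _) (Nat.cast_nonneg _)
  have hsum : ∑ C : Fin M → T, Real.exp (∑ m, -u (C m)) ≤
      (Fintype.card T : ℝ) ^ M * Real.exp (-(M * c / 2)) := by
    simp_rw [Real.exp_sum]
    rw [← Fintype.sum_pow (fun x => Real.exp (-u x))]
    refine (pow_le_pow_left₀ (Finset.sum_nonneg fun x _ => (Real.exp_pos _).le) hexp M).trans ?_
    rw [mul_pow, ← Real.exp_nat_mul]
    apply le_of_eq; congr 2; ring
  rw [sub_eq_neg_add, Real.exp_add, ← mul_assoc, ← div_le_iff₀ (Real.exp_pos _), div_eq_mul_inv,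
    ← Real.exp_neg]
  refine le_trans ?_ hsum
  rw [← nsmul_eq_mul, ← Finset.sum_const]
  refine (Finset.sum_le_sum fun C hC => ?_).trans
    (Finset.sum_le_sum_of_subset_of_nonneg (Finset.subset_univ _) fun C _ _ => (Real.exp_pos _).le)
  rw [Finset.sum_neg_distrib]
  exact Real.exp_le_exp.2 (neg_le_neg (Finset.mem_filter.1 hC).2.le)

end Sequential

/-! ### Lower tail of the number of related pairs of codewords -/

section Pairs

variable {T : Type*} [Fintype T] (r : T → T → Prop) [DecidableRel r]

/-- Number of words of a code related to `x'`. -/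
def hits {m : ℕ} (C : Fin m → T) (x' : T) : ℕ := ∑ i, if r (C i) x' then 1 else 0

omit [Fintype T] in
lemma hits_snoc {m : ℕ} (C : Fin m → T) (x x' : T) :
    hits r (Fin.snoc (α := fun _ => T) C x) x' = hits r C x' + if r x x' then 1 else 0 := by
  rw [hits, Fin.sum_univ_castSucc]
  simp only [Fin.snoc_castSucc, Fin.snoc_last]
  rfl

/-- Except for a fraction `exp (-L a / (8 b))` of the codes `C` of length `L`, the truncated number
of words of `C` related to a random word has mean at least `L a / 8`. Truncating at `H` makes each
new word add at most `b` to this mean, and conditionally on the past at least `a / 2` on average. -/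
theorem card_truncated_hits_le {a b : ℝ} (ha : 0 < a) (hab : a ≤ b)
    (hrow : ∀ x, ((Finset.univ.filter fun x' => r x x').card : ℝ) ≤ b * Fintype.card T)
    (hcol : ∀ x', a * Fintype.card T ≤ (Finset.univ.filter fun x => r x x').card)
    (L H : ℕ) (hH : 2 * L * b ≤ H) :
    ((Finset.univ.filter fun C : Fin L → T =>
      ∑ x', ((min (hits r C x') H : ℕ) : ℝ) < L * a * Fintype.card T / 8).card : ℝ) ≤
      (Fintype.card T : ℝ) ^ L * Real.exp (-(L * a / (8 * b))) := by
  have hb : 0 < b := ha.trans_le hab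
  set N : ℝ := (Fintype.card T : ℝ) with hN
  rcases (Nat.cast_nonneg (Fintype.card T) : (0 : ℝ) ≤ _).eq_or_lt with hN0 | hN0
  · have : IsEmpty T := Fintype.card_eq_zero_iff.1 (by exact_mod_cast hN0.symm)
    rw [Finset.filter_false_of_mem]
    · simp only [Finset.card_empty, Nat.cast_zero]; positivity
    · intro C _; rw [hN, ← hN0]; simp
  rw [← hN] at hN0
  let G : ∀ m, (Fin m → T) → ℝ := fun m C => ∑ x', ((min (hits r C x') H : ℕ) : ℝ)
  -- a supermartingale: a new word adds at most `b N` to `G`, and at least `a N / 2` on average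
  let Φ : ∀ m, (Fin m → T) → ℝ := fun m C => Real.exp (-(G m C / (b * N)) + m * (a / (4 * b)))
  have hstep : ∀ m < L, ∀ C : Fin m → T,
      ∑ x, Φ (m + 1) (Fin.snoc (α := fun _ => T) C x) ≤ Fintype.card T * Φ m C := by
    intro m hm C
    let d : T → ℝ := fun x => ((Finset.univ.filter fun x' => r x x' ∧ hits r C x' < H).card : ℝ)
    have hG : ∀ x, G (m + 1) (Fin.snoc (α := fun _ => T) C x) = G m C + d x := by
      intro x
      simp only [G, d, Finset.card_filter]
      push_cast
      rw [← Finset.sum_add_distrib]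
      refine Finset.sum_congr rfl fun x' _ => ?_
      rw [hits_snoc]
      norm_cast
      split_ifs <;> grind
    have hd0 : ∀ x, 0 ≤ d x := fun x => Nat.cast_nonneg _
    have hd1 : ∀ x, d x ≤ b * N := fun x => by
      refine le_trans ?_ (hrow x)
      refine Nat.cast_le.2 (Finset.card_le_card fun x' hx' => ?_)
      simp only [Finset.mem_filter, Finset.mem_univ, true_and] at hx' ⊢
      exact hx'.1
    have hhits : ∑ x', (hits r C x' : ℝ) ≤ m * (b * N) := by
      simp only [hits]
      push_cast
      rw [Finset.sum_comm]
      calc _ ≤ ∑ _i : Fin m, b * N := Finset.sum_le_sum fun i _ => by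
            refine le_trans (le_of_eq ?_) (hrow (C i))
            rw [Finset.card_filter]; push_cast; rfl
        _ = _ := by simp
    -- by Markov's inequality, truncation affects at most half of the words
    have hfew : N / 2 ≤ ((Finset.univ.filter fun x' => hits r C x' < H).card : ℝ) := by
      have hsplit : ((Finset.univ.filter fun x' => hits r C x' < H).card : ℝ) +
          ((Finset.univ.filter fun x' => ¬ hits r C x' < H).card : ℝ) = N := by
        rw [hN, ← Finset.card_univ (α := T)]
        exact_mod_cast Finset.card_filter_add_card_filter_not (s := Finset.univ)
          (fun x' => hits r C x' < H)
      have hmark : ((Finset.univ.filter fun x' => ¬ hits r C x' < H).card : ℝ) * H ≤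
          m * (b * N) := by
        refine le_trans ?_ hhits
        rw [← nsmul_eq_mul, ← Finset.sum_const]
        refine (Finset.sum_le_sum fun x' hx' => ?_).trans
          (Finset.sum_le_sum_of_subset_of_nonneg (Finset.subset_univ _)
            fun _ _ _ => Nat.cast_nonneg _)
        have := (Finset.mem_filter.1 hx').2
        exact_mod_cast not_lt.1 this
      have hmL : (m : ℝ) + 1 ≤ L := by exact_mod_cast hm
      have hm0 : (0 : ℝ) ≤ m := Nat.cast_nonneg _
      have hHpos : (0 : ℝ) < H := lt_of_lt_of_le (by
        have : (0 : ℝ) < L := by linarith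
        positivity) hH
      have h3 : (m : ℝ) * (b * N) ≤ N / 2 * H := by
        have : (m : ℝ) * b ≤ H / 2 := by nlinarith
        nlinarith
      have h4 := le_of_mul_le_mul_right (hmark.trans h3) hHpos
      linarith
    have hdsum : a * N * (N / 2) ≤ ∑ x, d x := by
      have : ∑ x, d x = ∑ x' ∈ Finset.univ.filter (fun x' => hits r C x' < H),
          ((Finset.univ.filter fun x => r x x').card : ℝ) := by
        simp only [d, Finset.card_filter]
        push_cast
        rw [Finset.sum_comm, Finset.sum_filter]
        refine Finset.sum_congr rfl fun x' _ => ?_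
        split_ifs with h <;> simp [h]
      rw [this]
      calc a * N * (N / 2) ≤ a * N * ((Finset.univ.filter fun x' => hits r C x' < H).card : ℝ) :=
            mul_le_mul_of_nonneg_left hfew (by positivity)
        _ = ∑ _x' ∈ Finset.univ.filter (fun x' => hits r C x' < H), a * N := by
            rw [Finset.sum_const, nsmul_eq_mul]; ring
        _ ≤ _ := Finset.sum_le_sum fun x' _ => hcol x'
    have hsum : ∑ x, Real.exp (-(d x / (b * N))) ≤ N * Real.exp (-(a / (4 * b))) := by
      have hbN : 0 < b * N := by positivity
      calc ∑ x, Real.exp (-(d x / (b * N))) ≤ ∑ x, (1 - d x / (b * N) / 2) :=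
            Finset.sum_le_sum fun x _ => exp_neg_le_one_sub_half (div_nonneg (hd0 x) hbN.le)
              (div_le_one_of_le₀ (hd1 x) hbN.le)
        _ = N - (∑ x, d x) / (b * N) / 2 := by
            rw [Finset.sum_sub_distrib, ← Finset.sum_div, ← Finset.sum_div]; simp [hN]
        _ ≤ N - a * N * (N / 2) / (b * N) / 2 := by gcongr
        _ = N * (-(a / (4 * b)) + 1) := by field_simp; ring
        _ ≤ _ := mul_le_mul_of_nonneg_left (Real.add_one_le_exp _) hN0.le
    have hfac : ∀ x, Φ (m + 1) (Fin.snoc (α := fun _ => T) C x) =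
        Φ m C * Real.exp (a / (4 * b)) * Real.exp (-(d x / (b * N))) := by
      intro x
      simp only [Φ]
      rw [hG, ← Real.exp_add, ← Real.exp_add]
      congr 1
      push_cast
      ring
    simp_rw [hfac]
    rw [← Finset.mul_sum]
    calc _ ≤ Φ m C * Real.exp (a / (4 * b)) * (N * Real.exp (-(a / (4 * b)))) :=
          mul_le_mul_of_nonneg_left hsum (by positivity)
      _ = N * Φ m C * (Real.exp (a / (4 * b)) * Real.exp (-(a / (4 * b)))) := by ring
      _ = N * Φ m C := by rw [← Real.exp_add]; simp
  have hmain := sum_code_le Φ L hstep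
  have hΦ0 : Φ 0 Fin.elim0 ≤ 1 := by
    simp only [Φ]
    rw [Real.exp_le_one_iff]
    have : 0 ≤ G 0 Fin.elim0 := Finset.sum_nonneg fun _ _ => Nat.cast_nonneg _
    have : 0 ≤ G 0 Fin.elim0 / (b * N) := by positivity
    simp only [CharP.cast_eq_zero, zero_mul, add_zero]
    linarith
  have hmain' : ∑ C, Φ L C ≤ N ^ L :=
    hmain.trans (mul_le_of_le_one_right (by positivity) hΦ0)
  rw [Real.exp_neg, ← div_eq_mul_inv, le_div_iff₀ (Real.exp_pos _)]
  refine le_trans ?_ hmain'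
  rw [← nsmul_eq_mul, ← Finset.sum_const]
  refine (Finset.sum_le_sum fun C hC => ?_).trans
    (Finset.sum_le_sum_of_subset_of_nonneg (Finset.subset_univ _) fun C _ _ => (Real.exp_pos _).le)
  refine Real.exp_le_exp.2 ?_
  have hC' : G L C < L * a * N / 8 := (Finset.mem_filter.1 hC).2
  have : G L C / (b * N) ≤ L * a / (8 * b) := by
    rw [div_le_div_iff₀ (by positivity) (by positivity)]
    nlinarith [mul_le_mul_of_nonneg_right hC'.le hb.le]
  have e : (L : ℝ) * (a / (4 * b)) = 2 * (L * a / (8 * b)) := by field_simp; ring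
  rw [e]
  linarith

/-- The number of related pairs of words of a random code is rarely below a constant fraction
of its mean. The words are split into two halves: the pairs with one word in each half are
counted, first revealing the first half, then the second. -/
theorem exists_few_pairs_finset {a b : ℝ} (ha : 0 < a) (hab : a ≤ b)
    (hrow : ∀ x, ((Finset.univ.filter fun x' => r x x').card : ℝ) ≤ b * Fintype.card T)
    (hcol : ∀ x', a * Fintype.card T ≤ (Finset.univ.filter fun x => r x x').card)
    (L K H : ℕ) (hH : 2 * L * b ≤ H) (hH0 : 0 < H) :
    ∃ S : Finset (Fin (L + K) → T),
      (S.card : ℝ) ≤ (Fintype.card T : ℝ) ^ (L + K) *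
        (Real.exp (-(L * a / (8 * b))) + Real.exp (-(K * L * a / (32 * H)))) ∧
      ∀ C ∉ S, K * L * a / 32 ≤
        ∑ i, ∑ j, if i ≠ j ∧ r (C i) (C j) then (1 : ℝ) else 0 := by
  classical
  set N : ℝ := (Fintype.card T : ℝ) with hN
  have hH0' : (0 : ℝ) < H := by exact_mod_cast hH0
  let S₁ : Finset (Fin L → T) := Finset.univ.filter fun C : Fin L → T =>
      ∑ x', ((min (hits r C x') H : ℕ) : ℝ) < L * a * Fintype.card T / 8
  let u : (Fin L → T) → T → ℝ := fun C x => ((min (hits r C x) H : ℕ) : ℝ) / H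
  let S₂ : (Fin L → T) → Finset (Fin K → T) := fun C₁ =>
    if C₁ ∈ S₁ then ∅ else Finset.univ.filter fun C₂ => ∑ j, u C₁ (C₂ j) < K * L * a / (32 * H)
  let S : Finset ((Fin L → T) × (Fin K → T)) :=
    Finset.univ.filter fun p => p.1 ∈ S₁ ∨ p.2 ∈ S₂ p.1
  have hS₁ : (S₁.card : ℝ) ≤ N ^ L * Real.exp (-(L * a / (8 * b))) :=
    card_truncated_hits_le r ha hab hrow hcol L H hH
  have hS₂ : ∀ C₁, ((S₂ C₁).card : ℝ) ≤ N ^ K * Real.exp (-(K * L * a / (32 * H))) := by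
    intro C₁
    by_cases h : C₁ ∈ S₁
    · simp only [S₂, h, if_true, Finset.card_empty, Nat.cast_zero]; positivity
    · simp only [S₂, h, if_false]
      have hC : L * a * N / 8 ≤ ∑ x', ((min (hits r C₁ x') H : ℕ) : ℝ) := by
        simpa [S₁] using h
      refine (card_le_of_sum_lt (u := u C₁) (c := L * a / (8 * H))
        (fun x => by positivity)
        (fun x => div_le_one_of_le₀ (by exact_mod_cast min_le_right _ _) hH0'.le) ?_ K _).trans
        (le_of_eq ?_)
      · simp only [u]
        rw [← Finset.sum_div, le_div_iff₀ hH0']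
        refine le_trans (le_of_eq ?_) hC
        field_simp
        rw [hN]
      · congr 2; field_simp; ring
  have hScard : (S.card : ℝ) ≤ N ^ (L + K) *
        (Real.exp (-(L * a / (8 * b))) + Real.exp (-(K * L * a / (32 * H)))) := by
    have h1 : S ⊆ (S₁ ×ˢ Finset.univ) ∪ (Finset.univ.filter fun p => p.2 ∈ S₂ p.1) := by
      intro p hp
      simpa [S] using hp
    have h2 : (Finset.univ.filter fun p : (Fin L → T) × (Fin K → T) => p.2 ∈ S₂ p.1).card =
        ∑ C₁, (S₂ C₁).card := by
      rw [Finset.card_filter, Fintype.sum_prod_type]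
      refine Finset.sum_congr rfl fun C₁ _ => ?_
      simp
    have h3 := (Finset.card_le_card h1).trans (Finset.card_union_le _ _)
    rw [h2, Finset.card_product] at h3
    calc (S.card : ℝ) ≤ S₁.card * (Finset.univ : Finset (Fin K → T)).card +
          ∑ C₁, ((S₂ C₁).card : ℝ) := by exact_mod_cast h3
      _ ≤ N ^ L * Real.exp (-(L * a / (8 * b))) * N ^ K +
          ∑ _C₁ : Fin L → T, N ^ K * Real.exp (-(K * L * a / (32 * H))) := by
          refine add_le_add ?_ (Finset.sum_le_sum fun C₁ _ => hS₂ C₁)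
          have : ((Finset.univ : Finset (Fin K → T)).card : ℝ) = N ^ K := by simp [hN]
          rw [this]
          gcongr
      _ = _ := by simp [← hN]; ring
  refine ⟨S.map (Fin.appendEquiv L K).toEmbedding, by simpa using hScard, fun C hC => ?_⟩
  obtain ⟨⟨C₁, C₂⟩, rfl⟩ := (Fin.appendEquiv L K).surjective C
  simp only [Finset.mem_map_equiv, Equiv.symm_apply_apply] at hC
  simp only [S, Finset.mem_filter, Finset.mem_univ, true_and, not_or] at hC
  have hC2 : K * L * a / (32 * H) ≤ ∑ j, u C₁ (C₂ j) := by
    have := hC.2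
    simpa [S₂, hC.1] using this
  have hpair : ∑ j, (hits r C₁ (C₂ j) : ℝ) ≤ ∑ i, ∑ j,
      if i ≠ j ∧ r (Fin.appendEquiv L K (C₁, C₂) i) (Fin.appendEquiv L K (C₁, C₂) j)
        then (1 : ℝ) else 0 := by
    simp only [hits]
    push_cast
    rw [Finset.sum_comm, Fin.sum_univ_add]
    refine le_trans ?_ (le_add_of_nonneg_right (Finset.sum_nonneg fun _ _ =>
      Finset.sum_nonneg fun _ _ => by split_ifs <;> simp))
    refine Finset.sum_le_sum fun i _ => ?_
    rw [Fin.sum_univ_add]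
    refine le_trans (le_of_eq ?_) (le_add_of_nonneg_left
      (Finset.sum_nonneg fun _ _ => by split_ifs <;> simp))
    refine Finset.sum_congr rfl fun j _ => ?_
    have : Fin.castAdd K i ≠ Fin.natAdd L j := by
      intro h
      have := congrArg Fin.val h
      simp at this
      omega
    simp [this]
  refine le_trans ?_ hpair
  calc K * L * a / 32 = K * L * a / (32 * H) * H := by field_simp
    _ ≤ (∑ j, u C₁ (C₂ j)) * H := mul_le_mul_of_nonneg_right hC2 hH0'.le
    _ = ∑ j, ((min (hits r C₁ (C₂ j)) H : ℕ) : ℝ) := by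
        rw [Finset.sum_mul]
        refine Finset.sum_congr rfl fun j _ => ?_
        simp only [u]; field_simp
    _ ≤ _ := Finset.sum_le_sum fun j _ => by exact_mod_cast min_le_left _ _

end Pairs

/-! ### Codes avoiding bad pairs of codewords -/

section Expurgation

variable {T : Type*} [Fintype T] [DecidableEq T] (bad : T → T → Prop) [DecidableRel bad]

/-- The words compatible with all words of `C`. -/
def avail {m : ℕ} (C : Fin m → T) : Finset T := Finset.univ.filter fun x => ∀ i, ¬ bad (C i) x

/-- The uniform law on the words compatible with all preceding ones. -/
noncomputable def availKernel (m : ℕ) (C : Fin m → T) (x : T) : ℝ :=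
  if x ∈ avail bad C then ((avail bad C).card : ℝ)⁻¹ else 0

/-- How much of the set `S` is made unavailable by the words of `C`, with multiplicity. -/
def cover (S : Finset T) {m : ℕ} (C : Fin m → T) : ℕ := ∑ i, (S.filter fun s => bad (C i) s).card

/-- Total cost of the unordered pairs of words of a code. -/
noncomputable def pairSum (J : T → T → ℝ) {m : ℕ} (C : Fin m → T) : ℝ :=
  ∑ i, ∑ j, if i < j then J (C i) (C j) else 0

omit [Fintype T] [DecidableEq T] in
lemma pairSum_snoc (J : T → T → ℝ) {m : ℕ} (C : Fin m → T) (x : T) :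
    pairSum J (Fin.snoc (α := fun _ => T) C x) = pairSum J C + ∑ i, J (C i) x := by
  simp only [pairSum, Fin.sum_univ_castSucc, Fin.snoc_castSucc, Fin.snoc_last,
    Fin.castSucc_lt_castSucc_iff, Fin.castSucc_lt_last, if_true, Finset.sum_add_distrib]
  have h : ∀ i : Fin m, ¬ Fin.last m < i.castSucc := fun i => (Fin.castSucc_lt_last i).not_gt
  simp [h]

omit [Fintype T] [DecidableEq T] in
lemma cover_snoc (S : Finset T) {m : ℕ} (C : Fin m → T) (x : T) :
    cover bad S (Fin.snoc (α := fun _ => T) C x) =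
      cover bad S C + (S.filter fun s => bad x s).card := by
  rw [cover, Fin.sum_univ_castSucc]
  simp only [Fin.snoc_castSucc, Fin.snoc_last]
  rfl

lemma availKernel_nonneg (m : ℕ) (C : Fin m → T) (x : T) : 0 ≤ availKernel bad m C x := by
  unfold availKernel; split_ifs <;> positivity

lemma not_bad_of_seqWeight_ne_zero : ∀ (m : ℕ) (C : Fin m → T),
    seqWeight (availKernel bad) m C ≠ 0 → ∀ i j, i < j → ¬ bad (C i) (C j)
  | 0, _, _ => fun i => i.elim0
  | m + 1, C, h => by
    rw [seqWeight] at h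
    have h1 := not_bad_of_seqWeight_ne_zero m (Fin.init C) (left_ne_zero_of_mul h)
    have h2 : C (Fin.last m) ∈ avail bad (Fin.init C) := by
      by_contra hn
      exact right_ne_zero_of_mul h (by simp [availKernel, hn])
    intro i j hij
    have hi : i ≠ Fin.last m := (hij.trans_le (Fin.le_last j)).ne
    obtain ⟨i, rfl⟩ := Fin.exists_castSucc_eq.2 hi
    by_cases hj : j = Fin.last m
    · subst hj
      exact (Finset.mem_filter.1 h2).2 i
    · obtain ⟨j, rfl⟩ := Fin.exists_castSucc_eq.2 hj
      exact h1 i j (Fin.castSucc_lt_castSucc_iff.1 hij)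

variable {bad} {θ : ℝ} {M : ℕ}

lemma mul_one_sub_le_card_avail
    (hbad : ∀ x', ((Finset.univ.filter fun x => bad x' x).card : ℝ) ≤ θ * Fintype.card T)
    {m : ℕ} (C : Fin m → T) :
    (Fintype.card T : ℝ) * (1 - m * θ) ≤ (avail bad C).card := by
  have h1 : ((Finset.univ.filter fun x => ¬ ∀ i, ¬ bad (C i) x).card : ℝ) ≤
      m * (θ * Fintype.card T) := by
    have : (Finset.univ.filter fun x => ¬ ∀ i, ¬ bad (C i) x) ⊆
        Finset.univ.biUnion fun i => Finset.univ.filter fun x => bad (C i) x := by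
      intro x hx
      simpa using hx
    calc _ ≤ ((∑ i, (Finset.univ.filter fun x => bad (C i) x).card : ℕ) : ℝ) :=
          Nat.cast_le.2 ((Finset.card_le_card this).trans Finset.card_biUnion_le)
      _ ≤ ∑ _i : Fin m, θ * Fintype.card T := by
          push_cast
          exact Finset.sum_le_sum fun i _ => hbad (C i)
      _ = _ := by simp
  have h2 : ((avail bad C).card : ℝ) +
      ((Finset.univ.filter fun x => ¬ ∀ i, ¬ bad (C i) x).card : ℝ) = Fintype.card T := by
    rw [← Finset.card_univ (α := T)]
    exact_mod_cast Finset.card_filter_add_card_filter_not (s := Finset.univ)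
      (fun x => ∀ i, ¬ bad (C i) x)
  linarith

variable [Nonempty T] (hθ : 0 < θ)
  (hbad : ∀ x', ((Finset.univ.filter fun x => bad x' x).card : ℝ) ≤ θ * Fintype.card T)
  (hMθ : 16 * M * θ ≤ 1)

include hθ hbad hMθ

omit [Nonempty T] in
lemma card_mul_exp_le_card_avail {m : ℕ} (hm : m < M) (C : Fin m → T) :
    (Fintype.card T : ℝ) * Real.exp (-(2 * M * θ)) ≤ (avail bad C).card := by
  refine le_trans ?_ (mul_one_sub_le_card_avail hbad C)
  refine mul_le_mul_of_nonneg_left ?_ (Nat.cast_nonneg _)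
  have hm' : (m : ℝ) ≤ M := by exact_mod_cast hm.le
  have h1 : (m : ℝ) * θ ≤ M * θ := mul_le_mul_of_nonneg_right hm' hθ.le
  have h0 : 0 ≤ (M : ℝ) * θ := by positivity
  have := exp_neg_le_one_sub_half (z := 2 * M * θ) (by linarith) (by linarith)
  linarith

lemma card_le_two_mul_card_avail {m : ℕ} (hm : m < M) (C : Fin m → T) :
    (Fintype.card T : ℝ) ≤ 2 * (avail bad C).card := by
  have h := mul_one_sub_le_card_avail hbad C
  have hm' : (m : ℝ) ≤ M := by exact_mod_cast hm.le
  have h1 : (m : ℝ) * θ ≤ M * θ := mul_le_mul_of_nonneg_right hm' hθ.le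
  have hN : (0 : ℝ) < Fintype.card T := by exact_mod_cast Fintype.card_pos
  nlinarith

lemma card_avail_pos {m : ℕ} (hm : m < M) (C : Fin m → T) : (0 : ℝ) < (avail bad C).card := by
  have := card_le_two_mul_card_avail hθ hbad hMθ hm C
  have hN : (0 : ℝ) < Fintype.card T := by exact_mod_cast Fintype.card_pos
  linarith

lemma availKernel_le {m : ℕ} (hm : m < M) (C : Fin m → T) (x : T) :
    availKernel bad m C x ≤ Real.exp (2 * M * θ) / Fintype.card T := by
  have hN : (0 : ℝ) < Fintype.card T := by exact_mod_cast Fintype.card_pos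
  unfold availKernel
  split_ifs
  · have h := card_mul_exp_le_card_avail hθ hbad hMθ hm C
    refine (inv_anti₀ (by positivity) h).trans (le_of_eq ?_)
    rw [Real.exp_neg]
    field_simp
  · positivity

lemma availKernel_le_two {m : ℕ} (hm : m < M) (C : Fin m → T) (x : T) :
    availKernel bad m C x ≤ 2 / Fintype.card T := by
  have hN : (0 : ℝ) < Fintype.card T := by exact_mod_cast Fintype.card_pos
  unfold availKernel
  split_ifs
  · have h := card_le_two_mul_card_avail hθ hbad hMθ hm C
    have h' := card_avail_pos hθ hbad hMθ hm C
    rw [inv_eq_one_div, div_le_div_iff₀ h' hN]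
    linarith
  · positivity

lemma sum_availKernel {m : ℕ} (hm : m < M) (C : Fin m → T) :
    ∑ x, availKernel bad m C x = 1 := by
  have h' := card_avail_pos hθ hbad hMθ hm C
  simp only [availKernel]
  rw [Finset.sum_ite_mem, Finset.univ_inter, Finset.sum_const, nsmul_eq_mul]
  exact mul_inv_cancel₀ h'.ne'

lemma sum_availKernel_mul_le {m : ℕ} (hm : m < M) (C : Fin m → T) {f : T → ℝ}
    (hf : ∀ x, 0 ≤ f x) :
    ∑ x, availKernel bad m C x * f x ≤ 2 / Fintype.card T * ∑ x, f x := by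
  rw [Finset.mul_sum]
  exact Finset.sum_le_sum fun x _ =>
    mul_le_mul_of_nonneg_right (availKernel_le_two hθ hbad hMθ hm C x) (hf x)

lemma one_le_sum_seqWeight : 1 ≤ ∑ C, seqWeight (availKernel bad) M C := by
  have := sum_seqWeight_mul_le (availKernel_nonneg bad) (fun _ _ => (-1 : ℝ)) M
    (fun m hm C => by
      rw [← Finset.sum_mul, sum_availKernel hθ hbad hMθ hm C]; simp)
  simp only [mul_neg, mul_one, Finset.sum_neg_distrib] at this
  linarith

lemma seqWeight_le : ∀ (m : ℕ), m ≤ M → ∀ C : Fin m → T,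
    seqWeight (availKernel bad) m C ≤ (Real.exp (2 * M * θ) / Fintype.card T) ^ m
  | 0, _, _ => by simp [seqWeight]
  | m + 1, hm, C => by
    rw [seqWeight, pow_succ]
    exact mul_le_mul (seqWeight_le m (Nat.le_of_succ_le hm) _)
      (availKernel_le hθ hbad hMθ hm _ _) (availKernel_nonneg _ _ _ _) (by positivity)

/-- Under the sequential law, the pair costs are rarely much larger than their mean. -/
lemma sum_seqWeight_pairSum_le {J : T → T → ℝ} (hJ0 : ∀ x x', 0 ≤ J x x') {c : ℝ} (hc : 0 < c)
    (hM : 0 < M) (hJ : ∀ x', ∑ x, J x' x ≤ c * Fintype.card T) :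
    ∑ C ∈ Finset.univ.filter (fun C : Fin M → T => 8 * M ^ 2 * c < pairSum J C),
      seqWeight (availKernel bad) M C ≤ 1 / 4 := by
  have hM' : (0 : ℝ) < M := by exact_mod_cast hM
  have hN : (0 : ℝ) < Fintype.card T := by exact_mod_cast Fintype.card_pos
  have hmean := sum_seqWeight_mul_le (availKernel_nonneg bad)
    (fun m C => pairSum J C - m * (2 * M * c)) M (fun m hm C => by
      have hm' : (m : ℝ) ≤ M := by exact_mod_cast hm.le
      simp only [pairSum_snoc]
      have h1 : ∑ x, availKernel bad m C x * ∑ i, J (C i) x ≤ 2 * M * c := by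
        refine (sum_availKernel_mul_le hθ hbad hMθ hm C
          fun x => Finset.sum_nonneg fun i _ => hJ0 _ _).trans ?_
        rw [Finset.sum_comm]
        calc _ ≤ 2 / (Fintype.card T : ℝ) * ∑ _i : Fin m, c * Fintype.card T :=
              mul_le_mul_of_nonneg_left (Finset.sum_le_sum fun i _ => hJ _) (by positivity)
          _ = 2 * m * c := by simp; field_simp
          _ ≤ _ := by gcongr
      have h2 : ∑ x, availKernel bad m C x * (pairSum J C + ∑ i, J (C i) x -
          ((m + 1 : ℕ) : ℝ) * (2 * M * c)) = pairSum J C - ((m + 1 : ℕ) : ℝ) * (2 * M * c) +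
          ∑ x, availKernel bad m C x * ∑ i, J (C i) x := by
        have h3 : ∀ x, availKernel bad m C x * (pairSum J C + ∑ i, J (C i) x -
          ((m + 1 : ℕ) : ℝ) * (2 * M * c)) = availKernel bad m C x * (pairSum J C -
          ((m + 1 : ℕ) : ℝ) * (2 * M * c)) + availKernel bad m C x * ∑ i, J (C i) x :=
          fun x => by ring
        simp_rw [h3]
        rw [Finset.sum_add_distrib, ← Finset.sum_mul, sum_availKernel hθ hbad hMθ hm C, one_mul]
      rw [h2]
      push_cast
      linarith)
  have h0 : pairSum J (Fin.elim0 : Fin 0 → T) - ((0 : ℕ) : ℝ) * (2 * M * c) ≤ 0 := by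
    simp [pairSum]
  have hmean2 : ∑ C, seqWeight (availKernel bad) M C * (pairSum J C - M * (2 * M * c)) ≤ 0 :=
    hmean.trans h0
  have htot : ∑ C, seqWeight (availKernel bad) M C ≤ 1 := by
    have := sum_seqWeight_mul_le (availKernel_nonneg bad) (fun _ _ => (1 : ℝ)) M
      (fun m hm C => by
        rw [← Finset.sum_mul, sum_availKernel hθ hbad hMθ hm C]; simp)
    simpa using this
  have hmean3 : ∑ C, seqWeight (availKernel bad) M C * pairSum J C ≤ 2 * M ^ 2 * c := by
    have h3 : ∑ C, seqWeight (availKernel bad) M C * (pairSum J C - M * (2 * M * c)) =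
        ∑ C, seqWeight (availKernel bad) M C * pairSum J C -
        (∑ C, seqWeight (availKernel bad) M C) * (M * (2 * M * c)) := by
      rw [Finset.sum_mul, ← Finset.sum_sub_distrib]
      exact Finset.sum_congr rfl fun C _ => by ring
    have h4 : (∑ C, seqWeight (availKernel bad) M C) * (M * (2 * M * c)) ≤ M * (2 * M * c) :=
      mul_le_of_le_one_left (by positivity) htot
    nlinarith
  have hmark : (∑ C ∈ Finset.univ.filter (fun C : Fin M → T => 8 * M ^ 2 * c < pairSum J C),
      seqWeight (availKernel bad) M C) * (8 * M ^ 2 * c) ≤ 2 * M ^ 2 * c := by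
    refine le_trans ?_ hmean3
    rw [Finset.sum_mul]
    refine (Finset.sum_le_sum fun C hC => ?_).trans (Finset.sum_le_sum_of_subset_of_nonneg
      (Finset.filter_subset _ _) fun C _ _ => mul_nonneg
        (seqWeight_nonneg (availKernel_nonneg bad) _ _)
        (Finset.sum_nonneg fun _ _ => Finset.sum_nonneg fun _ _ => by
          split_ifs
          · exact hJ0 _ _
          · exact le_rfl))
    exact mul_le_mul_of_nonneg_left (Finset.mem_filter.1 hC).2.le
      (seqWeight_nonneg (availKernel_nonneg bad) _ _)
  have hpos : 0 < (M : ℝ) ^ 2 * c := by positivity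
  nlinarith

variable (hsymm : ∀ x x', bad x x' → bad x' x) {p : ℝ} (hp : 0 < p) {S : Finset T}
  (hS : p * Fintype.card T ≤ S.card)

include hp hS

include hsymm in
/-- Under the sequential law, half of `S` stays available, except with probability
`exp (-p / (4 θ))`: each word covers a fraction at most `θ / p` of `S`, and at most `2 θ` on
average. -/
lemma sum_seqWeight_cover_le :
    ∑ C ∈ Finset.univ.filter (fun C : Fin M → T => (S.card : ℝ) < 2 * cover bad S C),
      seqWeight (availKernel bad) M C ≤ Real.exp (-(p / (4 * θ))) := by
  have hN : (0 : ℝ) < Fintype.card T := by exact_mod_cast Fintype.card_pos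
  have hS0 : (0 : ℝ) < S.card := lt_of_lt_of_le (by positivity) hS
  have hmean := sum_seqWeight_mul_le (availKernel_nonneg bad)
    (fun m C => Real.exp (p / θ * (cover bad S C / S.card) - m * (4 * p))) M (fun m hm C => by
      let z : T → ℝ := fun x => p / θ * (((S.filter fun s => bad x s).card : ℝ) / S.card)
      have hz0 : ∀ x, 0 ≤ z x := fun x => by positivity
      have hz1 : ∀ x, z x ≤ 1 := fun x => by
        have h1 : ((S.filter fun s => bad x s).card : ℝ) ≤ θ * Fintype.card T :=
          (Nat.cast_le.2 (Finset.card_le_card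
            (Finset.filter_subset_filter _ (Finset.subset_univ S)))).trans (hbad x)
        simp only [z]
        rw [div_mul_div_comm, div_le_one₀ (by positivity)]
        calc _ ≤ p * (θ * Fintype.card T) := mul_le_mul_of_nonneg_left h1 hp.le
          _ = θ * (p * Fintype.card T) := by ring
          _ ≤ _ := mul_le_mul_of_nonneg_left hS hθ.le
      have hzsum : ∑ x, z x ≤ p * Fintype.card T := by
        simp only [z]
        rw [← Finset.mul_sum, ← Finset.sum_div]
        have h1 : ∑ x, ((S.filter fun s => bad x s).card : ℝ) ≤ S.card * (θ * Fintype.card T) := by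
          simp only [Finset.card_filter]
          push_cast
          rw [Finset.sum_comm, ← nsmul_eq_mul, ← Finset.sum_const]
          refine Finset.sum_le_sum fun s _ => (le_trans ?_ (hbad s))
          rw [Finset.card_filter]
          push_cast
          refine Finset.sum_le_sum fun x _ => ?_
          by_cases h : bad x s
          · simp [h, hsymm _ _ h]
          · simp only [h, if_false]; split_ifs <;> norm_num
        calc _ ≤ p / θ * (S.card * (θ * Fintype.card T) / S.card) := by gcongr
          _ = _ := by field_simp
      have hfac : ∀ x, Real.exp (p / θ * (cover bad S (Fin.snoc (α := fun _ => T) C x) / S.card) -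
          ((m + 1 : ℕ) : ℝ) * (4 * p)) =
          Real.exp (p / θ * (cover bad S C / S.card) - m * (4 * p)) * Real.exp (-(4 * p)) *
            Real.exp (z x) := by
        intro x
        rw [cover_snoc, ← Real.exp_add, ← Real.exp_add]
        congr 1
        simp only [z]
        push_cast
        ring
      simp_rw [hfac]
      have hsum : ∑ x, availKernel bad m C x * Real.exp (z x) ≤ Real.exp (4 * p) := by
        calc _ ≤ ∑ x, availKernel bad m C x * (1 + 2 * z x) :=
              Finset.sum_le_sum fun x _ => mul_le_mul_of_nonneg_left
                (exp_le_one_add_two_mul (hz0 x) (hz1 x)) (availKernel_nonneg _ _ _ _)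
          _ = 1 + 2 * ∑ x, availKernel bad m C x * z x := by
              simp_rw [mul_add, mul_one, Finset.sum_add_distrib, mul_left_comm _ (2 : ℝ)]
              rw [← Finset.mul_sum, sum_availKernel hθ hbad hMθ hm C]
          _ ≤ 1 + 2 * (2 / Fintype.card T * (p * Fintype.card T)) := by
              have := sum_availKernel_mul_le hθ hbad hMθ hm C hz0
              have h2 : 2 / (Fintype.card T : ℝ) * ∑ x, z x ≤
                  2 / Fintype.card T * (p * Fintype.card T) := by gcongr
              linarith
          _ = 4 * p + 1 := by field_simp; ring
          _ ≤ _ := Real.add_one_le_exp _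
      set E := Real.exp (p / θ * (cover bad S C / S.card) - m * (4 * p))
      calc _ = E * Real.exp (-(4 * p)) * ∑ x, availKernel bad m C x * Real.exp (z x) := by
            rw [Finset.mul_sum]
            exact Finset.sum_congr rfl fun x _ => by ring
        _ ≤ E * Real.exp (-(4 * p)) * Real.exp (4 * p) :=
            mul_le_mul_of_nonneg_left hsum (by positivity)
        _ = E := by rw [mul_assoc, ← Real.exp_add]; simp)
  have h0 : Real.exp (p / θ * (cover bad S (Fin.elim0 : Fin 0 → T) / S.card) -
      ((0 : ℕ) : ℝ) * (4 * p)) = 1 := by simp [cover]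
  rw [h0] at hmean
  have hexp : Real.exp (p / (4 * θ)) * ∑ C ∈ Finset.univ.filter
      (fun C : Fin M → T => (S.card : ℝ) < 2 * cover bad S C),
      seqWeight (availKernel bad) M C ≤ 1 := by
    refine le_trans ?_ hmean
    rw [Finset.mul_sum]
    refine (Finset.sum_le_sum fun C hC => ?_).trans (Finset.sum_le_sum_of_subset_of_nonneg
      (Finset.filter_subset _ _) fun C _ _ => mul_nonneg
        (seqWeight_nonneg (availKernel_nonneg bad) _ _) (Real.exp_pos _).le)
    rw [mul_comm]
    refine mul_le_mul_of_nonneg_left (Real.exp_le_exp.2 ?_)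
      (seqWeight_nonneg (availKernel_nonneg bad) _ _)
    have hC' := (Finset.mem_filter.1 hC).2
    have h1 : (1 : ℝ) / 2 ≤ cover bad S C / S.card := by
      rw [div_le_div_iff₀ two_pos hS0]; linarith
    have h2 : p / θ * (1 / 2) ≤ p / θ * (cover bad S C / S.card) := by gcongr
    have h3 : (M : ℝ) * (4 * p) ≤ p / (4 * θ) := by
      rw [le_div_iff₀ (by positivity)]
      nlinarith
    have h4 : p / θ * (1 / 2) = 2 * (p / (4 * θ)) := by field_simp; norm_num
    linarith
  rw [Real.exp_neg, ← one_div, le_div_iff₀ (Real.exp_pos _), mul_comm]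
  exact hexp

/-- Under the sequential law, as long as half of `S` stays available, the code rarely has
few words in `S`. -/
lemma sum_seqWeight_few_le :
    ∑ C ∈ Finset.univ.filter (fun C : Fin M → T => (2 * cover bad S C : ℝ) ≤ S.card ∧
        ∑ m, (if C m ∈ S then (1 : ℝ) else 0) < M * p / 8),
      seqWeight (availKernel bad) M C ≤ Real.exp (-(M * p / 8)) := by
  classical
  have hN : (0 : ℝ) < Fintype.card T := by exact_mod_cast Fintype.card_pos
  let cnt : ∀ m, (Fin m → T) → ℝ := fun m C => ∑ i, if C i ∈ S then (1 : ℝ) else 0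
  have hmean := sum_seqWeight_mul_le (availKernel_nonneg bad)
    (fun m C => if (2 * cover bad S C : ℝ) ≤ S.card then Real.exp (-cnt m C + m * (p / 4)) else 0)
    M (fun m hm C => by
      by_cases hcov : (2 * cover bad S C : ℝ) ≤ S.card
      swap
      · refine (Finset.sum_eq_zero fun x _ => ?_).le.trans (by simp [hcov])
        rw [if_neg, mul_zero]
        rw [cover_snoc]
        push_cast
        intro h
        have : (0 : ℝ) ≤ (S.filter fun s => bad x s).card := Nat.cast_nonneg _
        linarith
      rw [if_pos hcov]
      have hcnt : ∀ x, cnt (m + 1) (Fin.snoc (α := fun _ => T) C x) =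
          cnt m C + if x ∈ S then 1 else 0 := by
        intro x
        simp only [cnt]
        rw [Fin.sum_univ_castSucc]
        simp only [Fin.snoc_castSucc, Fin.snoc_last]
      have hmass : p / 2 ≤ ∑ x, availKernel bad m C x * if x ∈ S then 1 else 0 := by
        have hA := card_avail_pos hθ hbad hMθ hm C
        have hAN : ((avail bad C).card : ℝ) ≤ Fintype.card T := by
          exact_mod_cast Finset.card_le_univ _
        have h1 : ∑ x, availKernel bad m C x * (if x ∈ S then 1 else 0) =
            ((avail bad C ∩ S).card : ℝ) / (avail bad C).card := by
          simp only [availKernel, mul_ite, mul_one, mul_zero]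
          rw [Finset.sum_ite_mem, Finset.univ_inter, Finset.sum_ite_mem, Finset.inter_comm,
            Finset.sum_const, nsmul_eq_mul, div_eq_mul_inv]
        have h2 : S ⊆ (avail bad C ∩ S) ∪ Finset.univ.biUnion
            fun i => S.filter fun s => bad (C i) s := by
          intro s hs
          by_cases h : ∀ i, ¬ bad (C i) s
          · exact Finset.mem_union_left _ (Finset.mem_inter.2 ⟨by simpa [avail] using h, hs⟩)
          · push Not at h
            obtain ⟨i, hi⟩ := h
            exact Finset.mem_union_right _ (Finset.mem_biUnion.2
              ⟨i, Finset.mem_univ _, Finset.mem_filter.2 ⟨hs, hi⟩⟩)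
        have h3 : (S.card : ℝ) ≤ (avail bad C ∩ S).card + cover bad S C := by
          exact_mod_cast (Finset.card_le_card h2).trans ((Finset.card_union_le _ _).trans
            (Nat.add_le_add_left Finset.card_biUnion_le _))
        rw [h1, div_le_div_iff₀ two_pos hA]
        nlinarith
      have hterm : ∀ x, availKernel bad m C x *
          (if (2 * cover bad S (Fin.snoc (α := fun _ => T) C x) : ℝ) ≤ S.card then
            Real.exp (-cnt (m + 1) (Fin.snoc (α := fun _ => T) C x) +
              ((m + 1 : ℕ) : ℝ) * (p / 4)) else 0) ≤
          Real.exp (-cnt m C + m * (p / 4)) * Real.exp (p / 4) *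
          (availKernel bad m C x - (availKernel bad m C x * if x ∈ S then 1 else 0) / 2) := by
        intro x
        have hk := availKernel_nonneg bad m C x
        have hexp : Real.exp (-(if x ∈ S then (1 : ℝ) else 0)) ≤
            1 - (if x ∈ S then (1 : ℝ) else 0) / 2 :=
          exp_neg_le_one_sub_half (by split_ifs <;> norm_num) (by split_ifs <;> norm_num)
        calc _ ≤ availKernel bad m C x * Real.exp (-cnt (m + 1) (Fin.snoc (α := fun _ => T) C x) +
              ((m + 1 : ℕ) : ℝ) * (p / 4)) := by
              refine mul_le_mul_of_nonneg_left ?_ hk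
              split_ifs
              · exact le_rfl
              · exact (Real.exp_pos _).le
          _ = Real.exp (-cnt m C + m * (p / 4)) * Real.exp (p / 4) *
              (availKernel bad m C x * Real.exp (-(if x ∈ S then (1 : ℝ) else 0))) := by
              rw [hcnt, mul_left_comm, ← Real.exp_add, ← Real.exp_add]
              congr 2
              push_cast
              ring
          _ ≤ Real.exp (-cnt m C + m * (p / 4)) * Real.exp (p / 4) *
              (availKernel bad m C x * (1 - (if x ∈ S then (1 : ℝ) else 0) / 2)) := by gcongr
          _ = _ := by ring
      refine (Finset.sum_le_sum fun x _ => hterm x).trans ?_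
      rw [← Finset.mul_sum, Finset.sum_sub_distrib, ← Finset.sum_div,
        sum_availKernel hθ hbad hMθ hm C]
      have h5 : 1 - (∑ x, availKernel bad m C x * if x ∈ S then 1 else 0) / 2 ≤
          Real.exp (-(p / 4)) := by
        have := Real.add_one_le_exp (-(p / 4))
        linarith
      calc _ ≤ Real.exp (-cnt m C + m * (p / 4)) * Real.exp (p / 4) * Real.exp (-(p / 4)) :=
            mul_le_mul_of_nonneg_left h5 (by positivity)
        _ = _ := by rw [mul_assoc, ← Real.exp_add]; simp)
  have h0 : (if (2 * cover bad S (Fin.elim0 : Fin 0 → T) : ℝ) ≤ S.card then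
      Real.exp (-cnt 0 Fin.elim0 + ((0 : ℕ) : ℝ) * (p / 4)) else 0) ≤ 1 := by
    simp [cover, cnt]
  have hmean2 := hmean.trans h0
  have hexp : Real.exp (M * p / 8) * ∑ C ∈ Finset.univ.filter
      (fun C : Fin M → T => (2 * cover bad S C : ℝ) ≤ S.card ∧
        ∑ m, (if C m ∈ S then (1 : ℝ) else 0) < M * p / 8),
      seqWeight (availKernel bad) M C ≤ 1 := by
    refine le_trans ?_ hmean2
    rw [Finset.mul_sum]
    refine (Finset.sum_le_sum fun C hC => ?_).trans (Finset.sum_le_sum_of_subset_of_nonneg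
      (Finset.filter_subset _ _) fun C _ _ => mul_nonneg
        (seqWeight_nonneg (availKernel_nonneg bad) _ _) (by
          split_ifs
          · exact (Real.exp_pos _).le
          · exact le_rfl))
    obtain ⟨hC1, hC2⟩ := (Finset.mem_filter.1 hC).2
    rw [mul_comm, if_pos hC1]
    refine mul_le_mul_of_nonneg_left (Real.exp_le_exp.2 ?_)
      (seqWeight_nonneg (availKernel_nonneg bad) _ _)
    simp only [cnt]
    linarith
  rw [Real.exp_neg, ← one_div, le_div_iff₀ (Real.exp_pos _), mul_comm]
  exact hexp

omit hp hS

omit hθ hbad hMθ [Nonempty T] in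
/-- If each word excludes a fraction at most `θ` of the words, with `16 M θ ≤ 1`, then a fraction
`exp (-2 M² θ) / 2` of the codes avoids all bad pairs and moreover behaves like a typical code,
both for a pair cost and for the numbers of words in given sets `S k` of density at least `p k`. -/
theorem exists_good_codes [Nonempty T] {ι : Type*} [Fintype ι] (hθ : 0 < θ) {p : ι → ℝ}
    (hp : ∀ k, 0 < p k)
    (hbad : ∀ x', ((Finset.univ.filter fun x => bad x' x).card : ℝ) ≤ θ * Fintype.card T)
    (hsymm : ∀ x x', bad x x' → bad x' x)
    (hM : 0 < M) (hMθ : 16 * M * θ ≤ 1) {J : T → T → ℝ} (hJ0 : ∀ x x', 0 ≤ J x x')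
    {c : ℝ} (hc : 0 < c) (hJ : ∀ x', ∑ x, J x' x ≤ c * Fintype.card T)
    (S : ι → Finset T) (hS : ∀ k, p k * Fintype.card T ≤ (S k).card)
    (hι : ∑ k, (Real.exp (-(p k / (4 * θ))) + Real.exp (-(M * p k / 8))) ≤ 1 / 4) :
    ∃ 𝒢 : Finset (Fin M → T),
      Real.exp (-(2 * M ^ 2 * θ)) / 2 * (Fintype.card T : ℝ) ^ M ≤ 𝒢.card ∧
      ∀ C ∈ 𝒢, (∀ i j, i ≠ j → ¬ bad (C i) (C j)) ∧ pairSum J C ≤ 8 * M ^ 2 * c ∧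
        ∀ k, M * p k / 8 ≤ ∑ m, if C m ∈ S k then (1 : ℝ) else 0 := by
  classical
  have hN : (0 : ℝ) < Fintype.card T := by exact_mod_cast Fintype.card_pos
  set w := seqWeight (availKernel bad) M with hw
  have hw0 : ∀ C, 0 ≤ w C := seqWeight_nonneg (availKernel_nonneg bad) M
  -- `F₁`, `F₂ k`, `F₃ k` are the exceptional events: excessive pair cost, too little of `S k` left
  -- available, and too few words in `S k`
  let F₁ : Finset (Fin M → T) := Finset.univ.filter fun C => 8 * M ^ 2 * c < pairSum J C
  let F₂ : ι → Finset (Fin M → T) := fun k =>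
    Finset.univ.filter fun C => ((S k).card : ℝ) < 2 * cover bad (S k) C
  let F₃ : ι → Finset (Fin M → T) := fun k =>
    Finset.univ.filter fun C => (2 * cover bad (S k) C : ℝ) ≤ (S k).card ∧
        ∑ m, (if C m ∈ S k then (1 : ℝ) else 0) < M * p k / 8
  let F := F₁ ∪ Finset.univ.biUnion fun k => F₂ k ∪ F₃ k
  have hF : ∑ C ∈ F, w C ≤ 1 / 2 := by
    have hunion : ∀ A B : Finset (Fin M → T), ∑ C ∈ A ∪ B, w C ≤ ∑ C ∈ A, w C + ∑ C ∈ B, w C := by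
      intro A B
      rw [← Finset.sum_union_inter]
      exact le_add_of_nonneg_right (Finset.sum_nonneg fun C _ => hw0 C)
    have hbi : ∑ C ∈ Finset.univ.biUnion (fun k => F₂ k ∪ F₃ k), w C ≤
        ∑ k, ∑ C ∈ F₂ k ∪ F₃ k, w C := by
      generalize (Finset.univ : Finset ι) = s
      induction s using Finset.induction_on with
      | empty => simp
      | insert k s hk ih =>
        rw [Finset.biUnion_insert, Finset.sum_insert hk]
        exact (hunion _ _).trans (add_le_add_right ih _)
    have h1 : ∑ C ∈ F₁, w C ≤ 1 / 4 := sum_seqWeight_pairSum_le hθ hbad hMθ hJ0 hc hM hJ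
    have h2 : ∀ k, ∑ C ∈ F₂ k ∪ F₃ k, w C ≤
        Real.exp (-(p k / (4 * θ))) + Real.exp (-(M * p k / 8)) := fun k =>
      (hunion _ _).trans (add_le_add (sum_seqWeight_cover_le hθ hbad hMθ hsymm (hp k) (hS k))
        (sum_seqWeight_few_le hθ hbad hMθ (hp k) (hS k)))
    have h3 : ∑ k, ∑ C ∈ F₂ k ∪ F₃ k, w C ≤ 1 / 4 :=
      (Finset.sum_le_sum fun k _ => h2 k).trans hι
    linarith [hunion F₁ (Finset.univ.biUnion fun k => F₂ k ∪ F₃ k)]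
  refine ⟨Finset.univ.filter fun C => C ∉ F ∧ w C ≠ 0, ?_, fun C hC => ?_⟩
  · have h1 : 1 / 2 ≤ ∑ C ∈ Finset.univ.filter (fun C => C ∉ F ∧ w C ≠ 0), w C := by
      have h2 := one_le_sum_seqWeight hθ hbad hMθ
      rw [← hw, ← Finset.sum_filter_add_sum_filter_not Finset.univ (fun C => C ∈ F)] at h2
      have h3 : ∑ C ∈ Finset.univ.filter (fun C => C ∈ F), w C = ∑ C ∈ F, w C := by
        congr 1; ext C; simp
      have h4 : ∑ C ∈ Finset.univ.filter (fun C => C ∉ F), w C =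
          ∑ C ∈ Finset.univ.filter (fun C => C ∉ F ∧ w C ≠ 0), w C := by
        rw [← Finset.filter_filter, Finset.sum_filter_ne_zero]
      linarith
    -- the weight of a code is at most `exp (2 M² θ)` times its uniform probability, so a set of weight
    -- `1 / 2` cannot be too small
    have h5 : ∑ C ∈ Finset.univ.filter (fun C => C ∉ F ∧ w C ≠ 0), w C ≤
        (Finset.univ.filter (fun C => C ∉ F ∧ w C ≠ 0)).card *
          (Real.exp (2 * M * θ) / Fintype.card T) ^ M := by
      rw [← nsmul_eq_mul, ← Finset.sum_const]
      exact Finset.sum_le_sum fun C _ => seqWeight_le hθ hbad hMθ M le_rfl C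
    have h6 : (Real.exp (2 * M * θ) / Fintype.card T) ^ M =
        Real.exp (2 * M ^ 2 * θ) / (Fintype.card T : ℝ) ^ M := by
      rw [div_pow, ← Real.exp_nat_mul]; congr 2; ring
    rw [h6] at h5
    have h7 := h1.trans h5
    rw [← mul_div_assoc, le_div_iff₀ (by positivity)] at h7
    rw [Real.exp_neg]
    have hE := Real.exp_pos (2 * M ^ 2 * θ)
    rw [div_mul_eq_mul_div, div_le_iff₀ two_pos, inv_mul_le_iff₀ hE]
    linarith
  · obtain ⟨hCF, hC0⟩ := (Finset.mem_filter.1 hC).2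
    simp only [F, Finset.mem_union, Finset.mem_biUnion, Finset.mem_univ, true_and, not_or,
      not_exists] at hCF
    obtain ⟨hC1, hC2⟩ := hCF
    have hlt := not_bad_of_seqWeight_ne_zero bad M C hC0
    refine ⟨fun i j hij hb => ?_, ?_, fun k => ?_⟩
    · rcases lt_or_gt_of_ne hij with h | h
      · exact hlt i j h hb
      · exact hlt j i h (hsymm _ _ hb)
    · simpa [F₁] using hC1
    · have h2 := (hC2 k).1
      have h3 := (hC2 k).2
      simp only [F₂, Finset.mem_filter, Finset.mem_univ, true_and, not_lt] at h2
      simp only [F₃, Finset.mem_filter, Finset.mem_univ, true_and, not_and, not_lt] at h3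
      exact h3 h2

end Expurgation

/-! ### Exponential and double-exponential asymptotics -/

section Asymptotics

lemma eventually_mul_pow_le_exp (c : ℝ) (k : ℕ) {ε : ℝ} (hε : 0 < ε) :
    ∀ᶠ n : ℕ in atTop, c * ((n : ℝ) + 1) ^ k ≤ Real.exp (n * ε) := by
  have h := isLittleO_pow_exp_pos_mul_atTop (k := k) hε
  have hlim : Tendsto (fun n : ℕ => (n : ℝ) + 1) atTop atTop :=
    tendsto_atTop_add_const_right _ _ tendsto_natCast_atTop_atTop
  have h2 := (h.comp_tendsto hlim).def (c := Real.exp (-ε) / (|c| + 1)) (by positivity)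
  filter_upwards [h2] with n hn
  simp only [Function.comp_apply, Real.norm_eq_abs, Real.abs_exp] at hn
  rw [abs_of_nonneg (by positivity)] at hn
  have hc : 0 < |c| + 1 := by positivity
  have hexp : Real.exp (-ε) * Real.exp (ε * ((n : ℝ) + 1)) = Real.exp (n * ε) := by
    rw [← Real.exp_add]; congr 1; ring
  calc c * ((n : ℝ) + 1) ^ k ≤ (|c| + 1) * ((n : ℝ) + 1) ^ k := by
        gcongr; linarith [le_abs_self c]
    _ ≤ (|c| + 1) * (Real.exp (-ε) / (|c| + 1) * Real.exp (ε * (n + 1))) := by gcongr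
    _ = Real.exp (-ε) * Real.exp (ε * (n + 1)) := by field_simp
    _ = _ := hexp

lemma exp_le_numWords (R : ℝ) (n : ℕ) : Real.exp (n * R) ≤ numWords R n := Nat.le_ceil _

lemma numWords_le {R : ℝ} (hR : 0 < R) (n : ℕ) : (numWords R n : ℝ) ≤ 2 * Real.exp (n * R) := by
  have h := (Nat.ceil_lt_add_one (Real.exp_pos (n * R)).le).le
  have h1 : 1 ≤ Real.exp (n * R) := Real.one_le_exp (by positivity)
  unfold numWords
  linarith

lemma two_le_numWords {R : ℝ} (hR : 0 < R) {n : ℕ} (hn : 0 < n) : 2 ≤ numWords R n := by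
  have h1 : 1 < Real.exp (n * R) := Real.one_lt_exp_iff.2 (by positivity)
  have h2 : (1 : ℝ) < numWords R n := h1.trans_le (exp_le_numWords R n)
  exact_mod_cast h2

end Asymptotics

section DoubleExponential

lemma neg_log_doubleExp (E : ℝ) (n : ℕ) :
    -ENNReal.log (doubleExp E n) = ((Real.exp (n * E) : ℝ) : EReal) := by
  rw [doubleExp, ENNReal.log_ofReal_of_pos (Real.exp_pos _), Real.log_exp]
  simp

lemma ofReal_exp_div (E F : ℝ) (n : ℕ) :
    ENNReal.log ((((Real.exp (n * F) : ℝ) : EReal)).toENNReal /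
      (((Real.exp (n * E) : ℝ) : EReal)).toENNReal) = ((n * (F - E) : ℝ) : EReal) := by
  rw [EReal.toENNReal_of_ne_top (EReal.coe_ne_top _), EReal.toENNReal_of_ne_top (EReal.coe_ne_top _),
    EReal.toReal_coe, EReal.toReal_coe, ← ENNReal.ofReal_div_of_pos (Real.exp_pos _),
    ← Real.exp_sub, ENNReal.log_ofReal_of_pos (Real.exp_pos _), Real.log_exp]
  congr 1; ring

lemma coe_mul_div_natCast (F : ℝ) {n : ℕ} (hn : 0 < n) :
    ((n * F : ℝ) : EReal) / (n : EReal) = (F : EReal) := by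
  have hn' : (n : ℝ) ≠ 0 := by positivity
  have : (n : EReal) = ((n : ℝ) : EReal) := rfl
  rw [this, ← EReal.coe_div]
  congr 1
  field_simp

lemma le_dexpRatio {a : ℕ → ℝ≥0∞} {E F : ℝ} {n : ℕ} (hn : 0 < n) (h : a n ≤ doubleExp F n) :
    ((F - E : ℝ) : EReal) ≤ dexpRatio a (doubleExp E) n := by
  rw [dexpRatio, neg_log_doubleExp, ← coe_mul_div_natCast (F - E) hn, ← ofReal_exp_div]
  refine EReal.div_le_div_right_of_nonneg (by positivity) (ENNReal.log_monotone ?_)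
  refine ENNReal.div_le_div_right (EReal.toENNReal_le_toENNReal ?_) _
  rw [← neg_log_doubleExp]
  exact EReal.neg_le_neg_iff.2 (ENNReal.log_monotone h)

lemma dexpRatio_le {a : ℕ → ℝ≥0∞} {E F : ℝ} {n : ℕ} (hn : 0 < n) (h : doubleExp F n ≤ a n) :
    dexpRatio a (doubleExp E) n ≤ ((F - E : ℝ) : EReal) := by
  rw [dexpRatio, neg_log_doubleExp, ← coe_mul_div_natCast (F - E) hn, ← ofReal_exp_div]
  refine EReal.div_le_div_right_of_nonneg (by positivity) (ENNReal.log_monotone ?_)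
  refine ENNReal.div_le_div_right (EReal.toENNReal_le_toENNReal ?_) _
  rw [← neg_log_doubleExp]
  exact EReal.neg_le_neg_iff.2 (ENNReal.log_monotone h)

variable {l : Filter ℕ} {a : ℕ → ℝ≥0∞} {E : ℝ}

/-- An upper bound by `exp (-exp (n (E - ε)))`, for all `ε > 0`, is one in the double-exponential
scale. -/
theorem dexpLE_of_eventually_le (hl : l ≤ atTop)
    (h : ∀ ε > 0, ∀ᶠ n in l, a n ≤ doubleExp (E - ε) n) : DexpLE l a (doubleExp E) := by
  rw [DexpLE]
  by_contra hlt
  rw [not_le] at hlt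
  obtain ⟨x, hx1, hx2⟩ := EReal.lt_iff_exists_real_btwn.1 hlt
  have hx : 0 < -x := by
    have : x < 0 := by exact_mod_cast hx2
    linarith
  refine absurd hx1 (not_lt.2 (le_liminf_of_le (by isBoundedDefault) ?_))
  filter_upwards [h (-x) hx, hl (eventually_gt_atTop 0)] with n hn hn0
  have := le_dexpRatio (E := E) hn0 hn
  simpa using this

/-- A lower bound by `exp (-exp (n (E + ε)))`, for all `ε > 0`, is one in the double-exponential
scale. -/
theorem dexpGE_of_eventually_le (hl : l ≤ atTop)
    (h : ∀ ε > 0, ∀ᶠ n in l, doubleExp (E + ε) n ≤ a n) : DexpGE l a (doubleExp E) := by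
  rw [DexpGE]
  by_contra hlt
  rw [not_le] at hlt
  obtain ⟨x, hx1, hx2⟩ := EReal.lt_iff_exists_real_btwn.1 hlt
  have hx : 0 < x := by exact_mod_cast hx1
  refine absurd hx2 (not_lt.2 (limsup_le_of_le (by isBoundedDefault) ?_))
  filter_upwards [h x hx, hl (eventually_gt_atTop 0)] with n hn hn0
  have := dexpRatio_le (E := E) hn0 hn
  simpa using this

end DoubleExponential

/-! ### The law of the random code -/

section CodeLaw

variable {X : Type*} [Fintype X] [DecidableEq X] [MeasurableSpace X] [MeasurableSingletonClass X]
  {QX : X → ℝ} {n : ℕ} [Fintype (typeClass n QX)] [Nonempty (typeClass n QX)]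

instance : IsProbabilityMeasure (uniformOn (typeClass n QX)) :=
  isProbabilityMeasure_uniformOn (Set.toFinite _) Set.Nonempty.of_subtype

instance (M : ℕ) : IsProbabilityMeasure (codeLaw QX n M) := by
  unfold codeLaw; infer_instance

lemma codeLaw_singleton {M : ℕ} (C : Fin M → typeClass n QX) :
    codeLaw QX n M {fun m => (C m : Fin n → X)} =
      ENNReal.ofReal (((Fintype.card (typeClass n QX) : ℝ) ^ M)⁻¹) := by
  have hpos : (0 : ℝ) < Fintype.card (typeClass n QX) := by exact_mod_cast Fintype.card_pos
  have h1 : ∀ m, uniformOn (typeClass n QX) {(C m : Fin n → X)} =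
      ENNReal.ofReal ((Fintype.card (typeClass n QX) : ℝ)⁻¹) := by
    intro m
    rw [uniformOn, cond_apply (Set.toFinite _).measurableSet,
      Set.inter_eq_right.2 (Set.singleton_subset_iff.2 (C m).2), Measure.count_singleton, mul_one,
      Measure.count_apply_finite _ (Set.toFinite _), ENNReal.ofReal_inv_of_pos hpos,
      ENNReal.ofReal_natCast]
    congr 2
    rw [← Set.toFinset_card]
    congr 1
    ext; simp
  rw [codeLaw, Measure.pi_singleton]
  simp_rw [h1]
  rw [Finset.prod_const, Finset.card_univ, Fintype.card_fin, ← inv_pow,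
    ENNReal.ofReal_pow (by positivity)]

lemma codeLaw_image {M : ℕ} (G : Finset (Fin M → typeClass n QX)) :
    codeLaw QX n M ((fun (C : Fin M → typeClass n QX) (m : Fin M) => (C m : Fin n → X)) '' G) =
      ENNReal.ofReal (G.card / (Fintype.card (typeClass n QX) : ℝ) ^ M) := by
  classical
  have hinj : Function.Injective
      (fun (C : Fin M → typeClass n QX) (m : Fin M) => (C m : Fin n → X)) := by
    intro C C' h
    funext m
    exact Subtype.ext (congrFun h m)
  rw [← Finset.coe_image, ← sum_measure_singleton, Finset.sum_image (fun _ _ _ _ h => hinj h)]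
  simp_rw [codeLaw_singleton]
  rw [Finset.sum_const, nsmul_eq_mul, div_eq_mul_inv, ENNReal.ofReal_mul (by positivity),
    ENNReal.ofReal_natCast]

lemma le_codeLaw {M : ℕ} {S : Set (Fin M → Fin n → X)} (G : Finset (Fin M → typeClass n QX))
    (hG : ∀ C ∈ G, (fun m => (C m : Fin n → X)) ∈ S) :
    ENNReal.ofReal (G.card / (Fintype.card (typeClass n QX) : ℝ) ^ M) ≤ codeLaw QX n M S := by
  rw [← codeLaw_image]
  refine measure_mono ?_
  rintro - ⟨C, hC, rfl⟩
  exact hG C hC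

lemma codeLaw_le {M : ℕ} {S : Set (Fin M → Fin n → X)} (G : Finset (Fin M → typeClass n QX))
    (hG : ∀ C ∉ G, (fun m => (C m : Fin n → X)) ∉ S) :
    codeLaw QX n M S ≤ ENNReal.ofReal (G.card / (Fintype.card (typeClass n QX) : ℝ) ^ M) := by
  have hpos : (0 : ℝ) < Fintype.card (typeClass n QX) := by exact_mod_cast Fintype.card_pos
  have hall := codeLaw_image (Finset.univ : Finset (Fin M → typeClass n QX))
  rw [Finset.card_univ, Fintype.card_fun, Fintype.card_fin, Nat.cast_pow,
    div_self (pow_pos hpos M).ne', ENNReal.ofReal_one] at hall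
  rw [← codeLaw_image]
  have hnull := (prob_compl_eq_zero_iff (Set.toFinite _).measurableSet).2 hall
  refine le_of_le_of_eq ((measure_mono ?_).trans (measure_union_le _ _))
    ((congrArg _ hnull).trans (add_zero _))
  intro D hD
  by_cases h : ∃ C : Fin M → typeClass n QX, (fun m => (C m : Fin n → X)) = D
  · obtain ⟨C, rfl⟩ := h
    left
    refine ⟨C, ?_, rfl⟩
    by_contra hC
    exact hG C hC hD
  · right
    exact fun ⟨C, _, hC⟩ => h ⟨C, hC⟩

end CodeLaw

/-! ### Joint types of a uniform word of the type class with a fixed sequence -/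

section TypeClassSums

variable {X A : Type*} [Fintype X] [DecidableEq X] [Fintype A] [DecidableEq A]
  {QX : X → ℝ} {n : ℕ} [Fintype (typeClass n QX)] [Nonempty (typeClass n QX)]

omit [Fintype (typeClass n QX)] [Nonempty (typeClass n QX)] in
lemma typeClass_pos (hQX : QX ∈ stdSimplex ℝ X) {x : Fin n → X} (hx : x ∈ typeClass n QX) :
    0 < n := by
  rcases Nat.eq_zero_or_pos n with rfl | h
  · have h1 := hQX.2
    have h2 : empDist x = QX := hx
    rw [← h2] at h1
    simp [empDist] at h1
  · exact h

omit [Fintype A] in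
lemma entropy_empDist_unit_prod (x : Fin n → X) :
    entropy (empDist fun t => ((), x t)) = entropy (empDist x) :=
  entropy_empDist_equiv (Equiv.punitProd X).symm x

lemma entropy_empDist_unit (hn : 0 < n) : entropy (empDist fun _ : Fin n => ()) = 0 := by
  have hn' : (n : ℝ) ≠ 0 := by positivity
  simp [entropy, empDist, hn']

lemma exp_entropy_le_card_typeClass (hQX : QX ∈ stdSimplex ℝ X) :
    Real.exp (n * entropy QX) ≤
      (Real.exp 1 * (n + 1)) ^ Fintype.card X * Fintype.card (typeClass n QX) := by
  obtain ⟨x, hx⟩ := ‹Nonempty (typeClass n QX)›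
  have hn := typeClass_pos hQX hx
  have h := exp_entropy_sub_le_card (fun _ : Fin n => ()) x
  rw [entropy_empDist_unit hn, entropy_empDist_unit_prod, sub_zero, Fintype.card_unit, one_mul,
    show empDist x = QX from hx] at h
  refine h.trans (mul_le_mul_of_nonneg_left ?_ (by positivity))
  rw [← Fintype.card_coe]
  refine Nat.cast_le.2 (Fintype.card_le_of_injective
    (fun y => ⟨y.1, ?_⟩) fun a b hab => Subtype.ext (Subtype.mk.inj hab))
  have h2 := (Finset.mem_filter.1 y.2).2
  have h3 := congrArg sndMarg h2
  rw [sndMarg_empDist, sndMarg_empDist] at h3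
  exact h3.trans hx

lemma card_typeClass_le (hQX : QX ∈ stdSimplex ℝ X) :
    (Fintype.card (typeClass n QX) : ℝ) ≤
      (n + 1) ^ Fintype.card X * Real.exp (n * entropy QX) := by
  obtain ⟨x, hx⟩ := ‹Nonempty (typeClass n QX)›
  have hn := typeClass_pos hQX hx
  have h := sum_exp_entropy_sub_le (B := X) (fun _ : Fin n => ())
  simp only [entropy_empDist_unit hn, entropy_empDist_unit_prod, zero_sub, Fintype.card_unit,
    one_mul] at h
  have h2 : ∑ x : typeClass n QX, Real.exp (-(n * entropy QX)) ≤
      ((n : ℝ) + 1) ^ Fintype.card X := by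
    refine le_trans ?_ h
    calc _ = ∑ x : typeClass n QX, Real.exp (n * -entropy (empDist x.1)) := by
          refine Finset.sum_congr rfl fun x _ => ?_
          rw [show empDist x.1 = QX from x.2]; ring_nf
      _ = ∑ y ∈ Finset.univ.map (Function.Embedding.subtype (· ∈ typeClass n QX)),
            Real.exp (n * -entropy (empDist y)) := by rw [Finset.sum_map]; rfl
      _ ≤ _ := Finset.sum_le_sum_of_subset_of_nonneg (Finset.subset_univ _)
          fun _ _ _ => (Real.exp_pos _).le
  rw [Finset.sum_const, nsmul_eq_mul, Finset.card_univ, Real.exp_neg, ← div_eq_mul_inv,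
    div_le_iff₀ (Real.exp_pos _)] at h2
  exact h2

/-- On average over the type class, `exp (n I(x;z))` is polynomial in `n`. -/
theorem sum_exp_mutualInfo_le (hQX : QX ∈ stdSimplex ℝ X) (z : Fin n → A) :
    ∑ x : typeClass n QX, Real.exp (n * mutualInfo (empDist fun t => (x.1 t, z t))) ≤
      ((n : ℝ) + 1) ^ (Fintype.card A * Fintype.card X) *
        (Real.exp 1 * (n + 1)) ^ Fintype.card X * Fintype.card (typeClass n QX) := by
  have h := sum_exp_entropy_sub_le (B := X) z
  have h1 : ∑ x : typeClass n QX, Real.exp (n * mutualInfo (empDist fun t => (x.1 t, z t))) ≤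
      Real.exp (n * entropy QX) * ∑ y : Fin n → X, Real.exp (n * (entropy (empDist z) -
        entropy (empDist fun t => (z t, y t)))) := by
    calc _ = ∑ x : typeClass n QX, Real.exp (n * entropy QX) * Real.exp (n * (entropy (empDist z) -
        entropy (empDist fun t => (z t, x.1 t)))) := by
          refine Finset.sum_congr rfl fun x _ => ?_
          rw [mutualInfo_empDist, show empDist x.1 = QX from x.2, entropy_empDist_swap,
            ← Real.exp_add]
          ring_nf
      _ = ∑ y ∈ Finset.univ.map (Function.Embedding.subtype (· ∈ typeClass n QX)),
            Real.exp (n * entropy QX) * Real.exp (n * (entropy (empDist z) -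
        entropy (empDist fun t => (z t, y t)))) := by rw [Finset.sum_map]; rfl
      _ ≤ _ := by
          rw [Finset.mul_sum]
          exact Finset.sum_le_sum_of_subset_of_nonneg (Finset.subset_univ _)
            fun _ _ _ => by positivity
  refine h1.trans ?_
  have h2 := exp_entropy_le_card_typeClass (n := n) hQX
  calc _ ≤ ((Real.exp 1 * (n + 1)) ^ Fintype.card X * Fintype.card (typeClass n QX)) *
        ((n : ℝ) + 1) ^ (Fintype.card A * Fintype.card X) :=
        mul_le_mul h2 h (Finset.sum_nonneg fun _ _ => (Real.exp_pos _).le) (by positivity)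
    _ = _ := by ring

/-- Lower bound on the fraction of the type class having a given (realizable) joint type with
`z`. -/
theorem le_card_typeClass_filter (hQX : QX ∈ stdSimplex ℝ X) (z : Fin n → A) {Q : X × A → ℝ}
    (hQ : ∃ x : typeClass n QX, empDist (fun t => (x.1 t, z t)) = Q) :
    Real.exp (-(n * mutualInfo Q)) * Fintype.card (typeClass n QX) ≤
      (Real.exp 1 * (n + 1)) ^ (Fintype.card A * Fintype.card X) * (n + 1) ^ Fintype.card X *
      (Finset.univ.filter fun x : typeClass n QX => empDist (fun t => (x.1 t, z t)) = Q).card := by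
  obtain ⟨x₀, rfl⟩ := hQ
  have h := exp_entropy_sub_le_card z x₀.1
  have h1 := card_typeClass_le (n := n) hQX
  have hcard : ((Finset.univ.filter fun y' : Fin n → X =>
      empDist (fun t => (z t, y' t)) = empDist (fun t => (z t, x₀.1 t))).card : ℝ) ≤
      (Finset.univ.filter fun x : typeClass n QX => empDist (fun t => (x.1 t, z t)) =
        empDist (fun t => (x₀.1 t, z t))).card := by
    have hmem : ∀ y' : Fin n → X,
        empDist (fun t => (z t, y' t)) = empDist (fun t => (z t, x₀.1 t)) → y' ∈ typeClass n QX := by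
      intro y' hy'
      have h3 := congrArg sndMarg hy'
      rw [sndMarg_empDist, sndMarg_empDist] at h3
      exact h3.trans x₀.2
    refine Nat.cast_le.2 (Finset.card_le_card_of_surjOn (fun x => x.1) ?_)
    intro y' hy'
    simp only [Finset.coe_filter, Finset.mem_univ, true_and, Set.mem_ofPred_eq] at hy'
    refine ⟨⟨y', hmem y' hy'⟩, ?_, rfl⟩
    simp only [Finset.coe_filter, Finset.mem_univ, true_and, Set.mem_ofPred_eq]
    have e1 := empDist_equiv (Equiv.prodComm A X) (fun t => (z t, y' t))
    have e2 := empDist_equiv (Equiv.prodComm A X) (fun t => (z t, x₀.1 t))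
    rw [hy', ← e2] at e1
    exact e1
  rw [mutualInfo_empDist, show empDist x₀.1 = QX from x₀.2, entropy_empDist_swap]
  have hexp : Real.exp (-(n * (entropy QX + entropy (empDist z) -
      entropy (empDist fun t => (z t, x₀.1 t))))) * Real.exp (n * entropy QX) =
      Real.exp (n * (entropy (empDist fun t => (z t, x₀.1 t)) - entropy (empDist z))) := by
    rw [← Real.exp_add]; ring_nf
  calc _ ≤ Real.exp (-(n * (entropy QX + entropy (empDist z) -
      entropy (empDist fun t => (z t, x₀.1 t))))) *
        ((n + 1) ^ Fintype.card X * Real.exp (n * entropy QX)) := by gcongr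
    _ = (n + 1) ^ Fintype.card X * Real.exp (n * (entropy (empDist fun t => (z t, x₀.1 t)) -
        entropy (empDist z))) := by rw [← hexp]; ring
    _ ≤ (n + 1) ^ Fintype.card X * ((Real.exp 1 * (n + 1)) ^ (Fintype.card A * Fintype.card X) *
        ((Finset.univ.filter fun x : typeClass n QX => empDist (fun t => (x.1 t, z t)) =
        empDist (fun t => (x₀.1 t, z t))).card : ℝ)) := by
        refine mul_le_mul_of_nonneg_left (h.trans ?_) (by positivity)
        exact mul_le_mul_of_nonneg_left hcard (by positivity)
    _ = _ := by ring

omit [Fintype A] in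
/-- A joint type that is realized together with some `z₀` is realized with every `z` of the same
type. -/
lemma exists_empDist_pair {B : Type*} [DecidableEq B] (hn : 0 < n) {z z₀ : Fin n → A}
    (h : empDist z = empDist z₀) (x₀ : Fin n → B) :
    ∃ x : Fin n → B, empDist (fun t => (x t, z t)) = empDist (fun t => (x₀ t, z₀ t)) := by
  have hn' : (n : ℝ) ≠ 0 := by positivity
  obtain ⟨σ, hσ⟩ := exists_perm_of_letterCount_eq z z₀ (fun a => by
    have := congrFun h a
    rw [empDist_eq_letterCount_div, empDist_eq_letterCount_div, div_left_inj' hn'] at this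
    exact_mod_cast this)
  refine ⟨x₀ ∘ σ, ?_⟩
  ext p
  unfold empDist
  congr 2
  refine Finset.card_bij (fun t _ => σ t) ?_ (fun _ _ _ _ h => σ.injective h) ?_
  · intro t ht
    simp only [Finset.mem_filter, Finset.mem_univ, true_and, Function.comp] at ht ⊢
    rw [← ht, ← hσ]; rfl
  · intro t ht
    refine ⟨σ.symm t, ?_, by simp⟩
    simp only [Finset.mem_filter, Finset.mem_univ, true_and, Function.comp] at ht ⊢
    rw [← ht, ← hσ]; simp

end TypeClassSums

lemma empDist_comp_congr {A C : Type*} [Fintype A] [DecidableEq A] [DecidableEq C] {n : ℕ}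
    {z z' : Fin n → A} (h : empDist z = empDist z') (f : A → C) :
    empDist (fun t => f (z t)) = empDist fun t => f (z' t) := by
  ext c
  rw [empDist_comp, empDist_comp, h]

/-! ### Lower bound on the error probability of a code -/

section ErrorLowerBound

variable {X Y : Type*} [Fintype X] [Fintype Y] [DecidableEq X] [DecidableEq Y]
  {W : X → Y → ℝ} {g : (X × Y → ℝ) → ℝ} {QX : X → ℝ} {R : ℝ} {n : ℕ}

lemma empDist_mem_couplings {A B : Type*} [Fintype A] [Fintype B] [DecidableEq A] [DecidableEq B]
    (hn : 0 < n) (x : Fin n → A) (y : Fin n → B) :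
    empDist (fun t => (x t, y t)) ∈ couplings (empDist x) (empDist y) :=
  ⟨empDist_mem_stdSimplex hn _, fstMarg_empDist _, sndMarg_empDist _⟩

omit [Fintype X] [Fintype Y] in
lemma score_pos (x : Fin n → X) (y : Fin n → Y) : 0 < score g x y := Real.exp_pos _

/-- Except for few codes, the total score of the codewords exceeds `exp (n β)` at most by a
factor `t`, for all channel outputs: relative to `exp (n β)`, the score of each word is at most `1`,
and at most of order `exp (-n R)` on average. -/
theorem exists_sum_score_le (hg : ContinuousOn g (stdSimplex ℝ (X × Y)))
    (hQX : QX ∈ stdSimplex ℝ X) [Fintype (typeClass n QX)] [Nonempty (typeClass n QX)]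
    (M : ℕ) (t : ℝ) :
    ∃ S : Finset (Fin M → typeClass n QX),
      (S.card : ℝ) ≤ (Fintype.card (typeClass n QX) : ℝ) ^ M * ((Fintype.card Y : ℝ) ^ n *
        Real.exp (2 * M * (((n : ℝ) + 1) ^ (Fintype.card Y * Fintype.card X) *
          (Real.exp 1 * (n + 1)) ^ Fintype.card X * Real.exp (-(n * R))) - t)) ∧
      ∀ C ∉ S, ∀ y : Fin n → Y, ∑ m, score g (C m).1 y ≤
        t * Real.exp (n * beta g QX R (empDist y)) := by
  classical
  have hn : 0 < n := by
    obtain ⟨x, hx⟩ := ‹Nonempty (typeClass n QX)›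
    exact typeClass_pos hQX hx
  let u : (Fin n → Y) → typeClass n QX → ℝ := fun y x =>
    score g x.1 y * Real.exp (-(n * beta g QX R (empDist y)))
  have hu0 : ∀ y x, 0 ≤ u y x := fun y x => by
    have := score_pos (g := g) x.1 y
    positivity
  have hu : ∀ y x, u y x ≤ min 1 (Real.exp (-(n * R)) *
      Real.exp (n * mutualInfo (empDist fun t => (x.1 t, y t)))) := by
    intro y x
    have hc := empDist_mem_couplings hn x.1 y
    rw [show empDist x.1 = QX from x.2] at hc
    have hb := le_beta (R := R) hg hc
    simp only [u, score]
    rw [← Real.exp_add, ← Real.exp_add]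
    refine le_min (Real.exp_le_one_iff.2 ?_) (Real.exp_le_exp.2 ?_)
    · have h1 := le_max_left 0 (R - mutualInfo (empDist fun t => (x.1 t, y t)))
      have h2 : g (empDist fun t => (x.1 t, y t)) ≤ beta g QX R (empDist y) := by linarith
      have := mul_le_mul_of_nonneg_left h2 (Nat.cast_nonneg (α := ℝ) n)
      linarith
    · have h1 := le_max_right 0 (R - mutualInfo (empDist fun t => (x.1 t, y t)))
      have h2 : g (empDist fun t => (x.1 t, y t)) + (R - mutualInfo (empDist fun t => (x.1 t, y t)))
        ≤ beta g QX R (empDist y) := by linarith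
      have := mul_le_mul_of_nonneg_left h2 (Nat.cast_nonneg (α := ℝ) n)
      linarith
  let c : ℝ := ((n : ℝ) + 1) ^ (Fintype.card Y * Fintype.card X) *
          (Real.exp 1 * (n + 1)) ^ Fintype.card X * Real.exp (-(n * R))
  have hc : ∀ y, ∑ x, u y x ≤ c * Fintype.card (typeClass n QX) := by
    intro y
    calc ∑ x, u y x ≤ ∑ x : typeClass n QX, Real.exp (-(n * R)) *
          Real.exp (n * mutualInfo (empDist fun t => (x.1 t, y t))) :=
          Finset.sum_le_sum fun x _ => (hu y x).trans (min_le_right _ _)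
      _ ≤ Real.exp (-(n * R)) * (((n : ℝ) + 1) ^ (Fintype.card Y * Fintype.card X) *
          (Real.exp 1 * (n + 1)) ^ Fintype.card X * Fintype.card (typeClass n QX)) := by
          rw [← Finset.mul_sum]
          exact mul_le_mul_of_nonneg_left (sum_exp_mutualInfo_le hQX y) (Real.exp_pos _).le
      _ = _ := by simp only [c]; ring
  refine ⟨Finset.univ.biUnion fun y => Finset.univ.filter
    fun C : Fin M → typeClass n QX => t ≤ ∑ m, u y (C m), ?_, fun C hC y => ?_⟩
  · refine (Nat.cast_le.2 Finset.card_biUnion_le).trans ?_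
    push_cast
    refine (Finset.sum_le_sum fun y _ => card_le_of_sum_ge (hu0 y)
      (fun x => (hu y x).trans (min_le_left _ _)) (hc y) M t).trans (le_of_eq ?_)
    simp [c]
    ring
  · simp only [Finset.mem_biUnion, Finset.mem_filter, Finset.mem_univ, true_and, not_exists,
      not_le] at hC
    have h := (hC y).le
    simp only [u] at h
    rw [← Finset.sum_mul, Real.exp_neg, ← div_eq_mul_inv, div_le_iff₀ (Real.exp_pos _)] at h
    exact h

/-- Contribution of one pair of codewords to the error probability when the total score is
controlled by `exp (n β)`: the outputs of one given joint type already give `exp (-n Λ)`. -/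
lemma exp_lamCost_le_sum (hn : 0 < n) {x₀ x₀' : Fin n → X} {y₀ : Fin n → Y} {P : X × X × Y → ℝ}
    (hP : empDist (fun t => (x₀ t, x₀' t, y₀ t)) = P) (hW : ∀ x y, 0 ≤ W x y)
    (hfin : FiniteDiv W (margXY P)) {M : ℕ} {C : Fin M → Fin n → X} {t : ℝ} (ht : 0 < t)
    (hden : ∀ y : Fin n → Y, ∑ m, score g (C m) y ≤ t * Real.exp (n * beta g QX R (empDist y)))
    {i j : Fin M} (hij : empDist (fun t => (C i t, C j t)) = margXX P) :
    Real.exp (-(n * lamCost W g QX R P)) ≤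
      (Real.exp 1 * (n + 1)) ^ (Fintype.card (X × X) * Fintype.card Y) * t *
      ∑ y : Fin n → Y, (∏ s, W (C i s) (y s)) * decodeProb g C y j := by
  classical
  let cls : Finset (Fin n → Y) := Finset.univ.filter fun y =>
    empDist (fun s => (C i s, C j s, y s)) = P
  have hz : empDist (fun s => (C i s, C j s)) = empDist fun s => (x₀ s, x₀' s) := by
    rw [hij, ← hP, margXX_empDist]
  obtain ⟨y₁, hy₁⟩ := exists_empDist_pair hn hz y₀
  have hy₁' : empDist (fun s => (C i s, C j s, y₁ s)) = P := by
    rw [← hP]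
    exact empDist_comp_congr hy₁ (fun p : Y × X × X => (p.2.1, p.2.2, p.1))
  have hcls : Real.exp (n * (entropy P - entropy (margXX P))) ≤
      (Real.exp 1 * (n + 1)) ^ (Fintype.card (X × X) * Fintype.card Y) * cls.card := by
    have h := exp_entropy_sub_le_card (fun s => (C i s, C j s)) y₁
    have h1 := entropy_empDist_equiv (Equiv.prodAssoc X X Y) (fun s => ((C i s, C j s), y₁ s))
    simp only [Equiv.prodAssoc_apply] at h1
    rw [hy₁'] at h1
    rw [hij, ← h1] at h
    refine h.trans (mul_le_mul_of_nonneg_left ?_ (by positivity))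
    refine Nat.cast_le.2 (Finset.card_le_card fun y hy => ?_)
    simp only [cls, Finset.mem_filter, Finset.mem_univ, true_and] at hy ⊢
    rw [← hy₁']
    exact empDist_comp_congr hy (fun p : (X × X) × Y => (p.1.1, p.1.2, p.2))
  have hterm : ∀ y ∈ cls, Real.exp (n * ∑ x, ∑ y, margXY P (x, y) * Real.log (W x y)) *
      (Real.exp (n * g (margX'Y P)) / (t * Real.exp (n * beta g QX R (sndMarg (margXY P))))) ≤
      (∏ s, W (C i s) (y s)) * decodeProb g C y j := by
    intro y hy
    have hy' := (Finset.mem_filter.1 hy).2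
    have hXY : empDist (fun s => (C i s, y s)) = margXY P := by rw [← hy', margXY_empDist]
    have hX'Y : empDist (fun s => (C j s, y s)) = margX'Y P := by rw [← hy', margX'Y_empDist]
    have hY : empDist y = sndMarg (margXY P) := by rw [← hXY, sndMarg_empDist]
    have hWpos : ∀ s, 0 < W (C i s) (y s) := by
      intro s
      refine lt_of_le_of_ne (hW _ _) fun h0 => ?_
      have h1 := hfin _ _ h0.symm
      have h2 := empDist_apply_pos (fun s => (C i s, y s)) s
      rw [hXY, h1] at h2
      exact lt_irrefl _ h2
    have hprod : ∏ s, W (C i s) (y s) =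
        Real.exp (n * ∑ x, ∑ y, margXY P (x, y) * Real.log (W x y)) := by
      have h1 := sum_apply_eq_mul_sum_empDist (fun s => (C i s, y s))
        (fun p : X × Y => Real.log (W p.1 p.2))
      rw [hXY, Fintype.sum_prod_type] at h1
      rw [← h1, Real.exp_sum]
      exact Finset.prod_congr rfl fun s _ => (Real.exp_log (hWpos s)).symm
    rw [hprod]
    refine mul_le_mul_of_nonneg_left ?_ (Real.exp_pos _).le
    have h2 := hden y
    rw [hY] at h2
    have h3 : 0 < ∑ m, score g (C m) y :=
      Finset.sum_pos (fun m _ => score_pos _ _) ⟨i, Finset.mem_univ i⟩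
    rw [decodeProb]
    have h4 : score g (C j) y = Real.exp (n * g (margX'Y P)) := by rw [score, hX'Y]
    rw [h4]
    exact div_le_div_of_nonneg_left (Real.exp_pos _).le h3 h2
  have hsum : cls.card * (Real.exp (n * ∑ x, ∑ y, margXY P (x, y) * Real.log (W x y)) *
      (Real.exp (n * g (margX'Y P)) / (t * Real.exp (n * beta g QX R (sndMarg (margXY P)))))) ≤
      ∑ y : Fin n → Y, (∏ s, W (C i s) (y s)) * decodeProb g C y j := by
    rw [← nsmul_eq_mul, ← Finset.sum_const]
    refine (Finset.sum_le_sum hterm).trans (Finset.sum_le_sum_of_subset_of_nonneg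
      (Finset.subset_univ _) fun y _ _ => mul_nonneg (Finset.prod_nonneg fun s _ => hW _ _) ?_)
    exact div_nonneg (score_pos _ _).le (Finset.sum_nonneg fun _ _ => (score_pos _ _).le)
  have hexp : Real.exp (-(n * lamCost W g QX R P)) =
      Real.exp (n * (entropy P - entropy (margXX P))) *
      (Real.exp (n * ∑ x, ∑ y, margXY P (x, y) * Real.log (W x y)) *
      (Real.exp (n * g (margX'Y P)) / Real.exp (n * beta g QX R (sndMarg (margXY P))))) := by
    rw [← Real.exp_sub, ← Real.exp_add, ← Real.exp_add, lamCost, channelCost]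
    congr 1; ring
  set L := Real.exp (n * ∑ x, ∑ y, margXY P (x, y) * Real.log (W x y))
  set G := Real.exp (n * g (margX'Y P))
  set B := Real.exp (n * beta g QX R (sndMarg (margXY P))) with hB
  have hB0 : B ≠ 0 := (Real.exp_pos _).ne'
  rw [hexp]
  calc _ ≤ (Real.exp 1 * (n + 1)) ^ (Fintype.card (X × X) * Fintype.card Y) * cls.card *
        (L * (G / B)) := mul_le_mul_of_nonneg_right hcls (by positivity)
    _ = (Real.exp 1 * (n + 1)) ^ (Fintype.card (X × X) * Fintype.card Y) * t *
        (cls.card * (L * (G / (t * B)))) := by field_simp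
    _ ≤ _ := mul_le_mul_of_nonneg_left hsum (by positivity)

lemma le_errorProb (hn : 0 < n) {x₀ x₀' : Fin n → X} {y₀ : Fin n → Y} {P : X × X × Y → ℝ}
    (hP : empDist (fun t => (x₀ t, x₀' t, y₀ t)) = P) (hW : ∀ x y, 0 ≤ W x y)
    (hfin : FiniteDiv W (margXY P)) {M : ℕ} {C : Fin M → Fin n → X} {t : ℝ} (ht : 0 < t)
    (hden : ∀ y : Fin n → Y, ∑ m, score g (C m) y ≤ t * Real.exp (n * beta g QX R (empDist y)))
    (hr : ∀ i j, Decidable (i ≠ j ∧ empDist (fun t => (C i t, C j t)) = margXX P)) :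
    Real.exp (-(n * lamCost W g QX R P)) *
      (∑ i, ∑ j, if i ≠ j ∧ empDist (fun t => (C i t, C j t)) = margXX P then 1 else 0) ≤
      (Real.exp 1 * (n + 1)) ^ (Fintype.card (X × X) * Fintype.card Y) * t *
        (M * errorProb W g C) := by
  have hE : M * errorProb W g C = ∑ i, ∑ j ∈ Finset.univ.filter (fun k => k ≠ i),
      ∑ y : Fin n → Y, (∏ s, W (C i s) (y s)) * decodeProb g C y j := by
    rcases Nat.eq_zero_or_pos M with rfl | hM
    · simp
    · rw [errorProb]
      have : (M : ℝ) ≠ 0 := by positivity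
      field_simp
  rw [hE, Finset.mul_sum, Finset.mul_sum]
  refine Finset.sum_le_sum fun i _ => ?_
  rw [Finset.sum_filter, Finset.mul_sum, Finset.mul_sum]
  refine Finset.sum_le_sum fun j _ => ?_
  have h0 : 0 ≤ ∑ y : Fin n → Y, (∏ s, W (C i s) (y s)) * decodeProb g C y j :=
    Finset.sum_nonneg fun y _ => mul_nonneg (Finset.prod_nonneg fun s _ => hW _ _)
      (div_nonneg (score_pos _ _).le (Finset.sum_nonneg fun _ _ => (score_pos _ _).le))
  by_cases h : i ≠ j ∧ empDist (fun t => (C i t, C j t)) = margXX P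
  · rw [if_pos h, if_pos h.1.symm, mul_one]
    exact exp_lamCost_le_sum hn hP hW hfin ht hden h.2
  · rw [if_neg h, mul_zero]
    split_ifs
    · positivity
    · simp

omit [Fintype X] in
lemma le_codeExponent_iff (hn : 0 < n) {M : ℕ} {C : Fin M → Fin n → X} {E₀ : ℝ}
    (hpos : 0 < errorProb W g C) : E₀ ≤ codeExponent W g C ↔
      errorProb W g C ≤ Real.exp (-(n * E₀)) := by
  have hn' : (0 : ℝ) < n := by exact_mod_cast hn
  rw [← Real.log_le_iff_le_exp hpos, codeExponent]
  constructor
  · intro h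
    have := mul_le_mul_of_nonneg_left h hn'.le
    have e : (n : ℝ) * (-(1 / n) * Real.log (errorProb W g C)) = -Real.log (errorProb W g C) := by
      field_simp
    rw [e] at this
    linarith
  · intro h
    have e : -(1 / (n : ℝ)) * Real.log (errorProb W g C) = -Real.log (errorProb W g C) / n := by
      field_simp
    rw [e, le_div_iff₀ hn']
    linarith

omit [Fintype X] in
/-- With at least two messages the error probability is positive, so that its logarithm is
meaningful. -/
lemma errorProb_pos (hW : ∀ x, W x ∈ stdSimplex ℝ Y) {M : ℕ} (hM : 2 ≤ M) (C : Fin M → Fin n → X) :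
    0 < errorProb W g C := by
  have hM0 : (0 : ℝ) < M := by
    have : 0 < M := by omega
    exact_mod_cast this
  have hdec : ∀ y m, 0 < decodeProb g C y m := fun y m =>
    div_pos (score_pos _ _) (Finset.sum_pos (fun _ _ => score_pos _ _) ⟨m, Finset.mem_univ m⟩)
  have hprod : ∀ m (y : Fin n → Y), 0 ≤ ∏ t, W (C m t) (y t) := fun m y =>
    Finset.prod_nonneg fun t _ => (hW _).1 _
  have hone : ∀ m, ∑ y : Fin n → Y, ∏ t, W (C m t) (y t) = 1 := by
    intro m
    have := Finset.prod_univ_sum (fun _ : Fin n => (Finset.univ : Finset Y))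
      (fun t b => W (C m t) b)
    rw [Fintype.piFinset_univ] at this
    rw [← this]
    exact Finset.prod_eq_one fun t _ => (hW _).2
  have hpair : ∀ m m', 0 < ∑ y : Fin n → Y, (∏ t, W (C m t) (y t)) * decodeProb g C y m' := by
    intro m m'
    have hne : ∑ y : Fin n → Y, ∏ t, W (C m t) (y t) ≠ 0 := by rw [hone]; exact one_ne_zero
    obtain ⟨y, hy, hy0⟩ := Finset.exists_ne_zero_of_sum_ne_zero hne
    exact Finset.sum_pos' (fun y _ => mul_nonneg (hprod m y) (hdec y m').le)
      ⟨y, hy, mul_pos ((hprod m y).lt_of_ne' hy0) (hdec y m')⟩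
  refine mul_pos (by positivity) (Finset.sum_pos' (fun m _ => Finset.sum_nonneg
    fun m' _ => (hpair m m').le) ⟨⟨0, by omega⟩, Finset.mem_univ _, ?_⟩)
  exact Finset.sum_pos (fun m' _ => hpair _ m') ⟨⟨1, by omega⟩, by simp⟩

end ErrorLowerBound

/-! ### Upper bound on the upper tail -/

section UpperTailBound

variable {X Y : Type*} [Fintype X] [Fintype Y] [DecidableEq X] [DecidableEq Y]
  {W : X → Y → ℝ} {g : (X × Y → ℝ) → ℝ} {QX : X → ℝ} {R E₀ : ℝ} {n : ℕ}

omit [Fintype X] in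
lemma nat_mul_typeClass_apply (hn : 0 < n) {x : Fin n → X} (hx : x ∈ typeClass n QX) (a : X) :
    n * QX a = letterCount x a := by
  have hn' : (n : ℝ) ≠ 0 := by positivity
  rw [← (show empDist x = QX from hx), empDist_eq_letterCount_div]
  field_simp

omit [Fintype X] in
lemma mem_typeClass_of_letterCount_eq {x x' : Fin n → X} (hx : x ∈ typeClass n QX)
    (h : ∀ a, letterCount x' a = letterCount x a) : x' ∈ typeClass n QX := by
  rw [← (show empDist x = QX from hx)]
  ext a
  rw [empDist_eq_letterCount_div, empDist_eq_letterCount_div, h]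

/-- Types approximating a joint distribution of `(X,X',Y)`, with unchanged marginals of `X` and of
`X'`, and with the same finiteness of the divergence. -/
lemma exists_triple_near (hn : 0 < n) (hT : (typeClass n QX).Nonempty)
    (hW : ∀ x, W x ∈ stdSimplex ℝ Y) {Q : X × X → ℝ} (hQ : Q ∈ couplings QX QX)
    {P : X × X × Y → ℝ} (hP : P ∈ extensions W Q) :
    ∃ x x' : Fin n → X, ∃ y : Fin n → Y, x ∈ typeClass n QX ∧ x' ∈ typeClass n QX ∧
      FiniteDiv W (margXY (empDist fun t => (x t, x' t, y t))) ∧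
      dist (empDist fun t => (x t, x' t, y t)) P ≤ Fintype.card (X × X × Y) / n := by
  obtain ⟨x₀, hx₀⟩ := hT
  obtain ⟨hPs, hPQ, hfin⟩ := hP
  have hd : ∀ x, ∃ y, W x y ≠ 0 := by
    intro x
    have : ∑ y, W x y ≠ 0 := by rw [(hW x).2]; exact one_ne_zero
    obtain ⟨y, -, hy⟩ := Finset.exists_ne_zero_of_sum_ne_zero this
    exact ⟨y, hy⟩
  choose d hd using hd
  have hmarg : ∀ a b, ∑ y, P (a, b, y) = Q (a, b) := fun a b => congrFun hPQ (a, b)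
  obtain ⟨w, h1, h2, h3, h4⟩ := exists_empDist_near hn P hPs.1 (letterCount x₀) (letterCount x₀)
    (fun a => by
      simp_rw [hmarg]
      rw [← nat_mul_typeClass_apply hn hx₀, ← hQ.2.1]; rfl)
    (fun b => by
      simp_rw [hmarg]
      rw [← nat_mul_typeClass_apply hn hx₀]
      congr 1
      exact congrFun hQ.2.2 b)
    (sum_letterCount x₀) d
  refine ⟨fun t => (w t).1, fun t => (w t).2.1, fun t => (w t).2.2,
    mem_typeClass_of_letterCount_eq hx₀ h1, mem_typeClass_of_letterCount_eq hx₀ h2, ?_, ?_⟩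
  · intro x y hxy
    have h0 := hfin x y hxy
    refine Finset.sum_eq_zero fun x' _ => h4 x x' y ?_ fun hyd => hd x (hyd ▸ hxy)
    exact (Finset.sum_eq_zero_iff_of_nonneg fun x' _ => hPs.1 _).1 h0 x' (Finset.mem_univ x')
  · refine (dist_pi_le_iff (by positivity)).2 fun z => ?_
    rw [Real.dist_eq]
    exact h3 z

/-- Bound on the upper tail at a fixed block length. Two unlikely events have to be excluded:
an excessive total score at some output, and a deficit of pairs of codewords of the joint
type `Q_{XX'}`. -/
lemma upperTail_le [MeasurableSpace X] [MeasurableSingletonClass X]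
    (hg : ContinuousOn g (stdSimplex ℝ (X × Y))) (hW : ∀ x, W x ∈ stdSimplex ℝ Y)
    (hQX : QX ∈ stdSimplex ℝ X) (hR : 0 < R)
    {x₀ x₀' : Fin n → X} {y₀ : Fin n → Y} (hx₀ : x₀ ∈ typeClass n QX)
    (hx₀' : x₀' ∈ typeClass n QX) {P : X × X × Y → ℝ}
    (hP : empDist (fun t => (x₀ t, x₀' t, y₀ t)) = P) (hfin : FiniteDiv W (margXY P))
    {ρ t : ℝ} (ht : 0 < t)
    (hρ0 : ((n : ℝ) + 1) ^ (Fintype.card Y * Fintype.card X) *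
          (Real.exp 1 * (n + 1)) ^ Fintype.card X ≤ ρ)
    (hρ1 : ((n : ℝ) + 1) ^ (Fintype.card X * Fintype.card X) *
          (Real.exp 1 * (n + 1)) ^ Fintype.card X ≤ ρ)
    (hρ2 : (Real.exp 1 * (n + 1)) ^ (Fintype.card X * Fintype.card X) *
          ((n : ℝ) + 1) ^ Fintype.card X ≤ ρ)
    (hρ3 : (Real.exp 1 * (n + 1)) ^ (Fintype.card (X × X) * Fintype.card Y) ≤ ρ)
    {L K H : ℕ} (hLK : L + K = numWords R n) (hH0 : 0 < H)
    (hH : 2 * L * (ρ * Real.exp (-(n * mutualInfo (margXX P)))) ≤ H)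
    (hkey : ρ * t * (numWords R n * Real.exp (-(n * E₀))) <
      Real.exp (-(n * lamCost W g QX R P)) *
        (K * L * (Real.exp (-(n * mutualInfo (margXX P))) / ρ) / 32)) :
    upperTail W g QX R E₀ n ≤ ENNReal.ofReal
      ((Fintype.card Y : ℝ) ^ n * Real.exp (2 * numWords R n * (ρ * Real.exp (-(n * R))) - t) +
        (Real.exp (-(L / (8 * ρ ^ 2))) +
          Real.exp (-(K * L * (Real.exp (-(n * mutualInfo (margXX P))) / ρ) / (32 * H))))) := by
  classical
  have hn : 0 < n := typeClass_pos hQX hx₀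
  have : Fintype (typeClass n QX) := Fintype.ofFinite _
  have : Nonempty (typeClass n QX) := ⟨⟨x₀, hx₀⟩⟩
  set N : ℝ := (Fintype.card (typeClass n QX) : ℝ) with hN
  have hN0 : 0 < N := by rw [hN]; exact_mod_cast Fintype.card_pos
  have hρpos : 0 < ρ := lt_of_lt_of_le (by positivity) hρ1
  have hρone : 1 ≤ ρ := by
    refine le_trans ?_ hρ3
    refine one_le_pow₀ ?_
    have : 1 ≤ Real.exp 1 := Real.one_le_exp zero_le_one
    have hn1 : (0 : ℝ) ≤ n := Nat.cast_nonneg _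
    nlinarith
  set Q := margXX P with hQdef
  have hQ : empDist (fun t => (x₀ t, x₀' t)) = Q := by rw [hQdef, ← hP, margXX_empDist]
  set q := Real.exp (-(n * mutualInfo Q)) with hq
  have hq0 : 0 < q := Real.exp_pos _
  let r : typeClass n QX → typeClass n QX → Prop := fun x x' =>
    empDist (fun t => (x.1 t, x'.1 t)) = Q
  have hrow : ∀ x, ((Finset.univ.filter fun x' => r x x').card : ℝ) ≤ ρ * q * N := by
    intro x
    have h := sum_exp_mutualInfo_le hQX x.1
    have h1 : ((Finset.univ.filter fun x' => r x x').card : ℝ) * Real.exp (n * mutualInfo Q) ≤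
        ∑ x' : typeClass n QX, Real.exp (n * mutualInfo (empDist fun t => (x'.1 t, x.1 t))) := by
      rw [← nsmul_eq_mul, ← Finset.sum_const]
      refine (Finset.sum_le_sum fun x' hx' => ?_).trans (Finset.sum_le_sum_of_subset_of_nonneg
        (Finset.subset_univ _) fun _ _ _ => (Real.exp_pos _).le)
      rw [mutualInfo_empDist_comm, show empDist (fun t => (x.1 t, x'.1 t)) = Q from
        (Finset.mem_filter.1 hx').2]
    have h2 := h1.trans (h.trans (mul_le_mul_of_nonneg_right hρ1 hN0.le))
    rw [← le_div_iff₀ (Real.exp_pos _)] at h2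
    refine h2.trans (le_of_eq ?_)
    rw [hq, Real.exp_neg, hN]
    field_simp
  have hcol : ∀ x', q / ρ * N ≤ (Finset.univ.filter fun x => r x x').card := by
    intro x'
    have hex : ∃ x : typeClass n QX, empDist (fun t => (x.1 t, x'.1 t)) = Q := by
      obtain ⟨x, hx⟩ := exists_empDist_pair hn (z := x'.1) (z₀ := x₀')
        ((show empDist x'.1 = QX from x'.2).trans (show empDist x₀' = QX from hx₀').symm) x₀
      refine ⟨⟨x, ?_⟩, hx.trans hQ⟩
      have := congrArg fstMarg hx
      rw [fstMarg_empDist, fstMarg_empDist] at this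
      exact this.trans hx₀
    have h := le_card_typeClass_filter hQX x'.1 hex
    have h2 := h.trans (mul_le_mul_of_nonneg_right hρ2 (Nat.cast_nonneg _))
    rw [div_mul_eq_mul_div, div_le_iff₀ hρpos, mul_comm _ ρ]
    exact h2
  have hab : q / ρ ≤ ρ * q := by
    rw [div_le_iff₀ hρpos]
    have : 1 ≤ ρ * ρ := one_le_mul_of_one_le_of_one_le hρone hρone
    nlinarith
  obtain ⟨S₁, hS₁, hS₁'⟩ := exists_few_pairs_finset r (div_pos hq0 hρpos) hab hrow hcol L K H hH hH0
  obtain ⟨S₂, hS₂, hS₂'⟩ := exists_sum_score_le (R := R) (n := n) hg hQX (L + K) t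
  have hM2 := two_le_numWords hR hn
  rw [upperTail, ← hLK]
  rw [← hLK] at hM2 hkey
  refine (codeLaw_le (S₂ ∪ S₁) fun C hC => ?_).trans (ENNReal.ofReal_le_ofReal ?_)
  · simp only [Finset.mem_union, not_or] at hC
    have hpairs := hS₁' C hC.2
    have hden := hS₂' C hC.1
    have herr := le_errorProb (R := R) (QX := QX) (C := fun m => (C m).1) hn hP
      (fun x y => (hW x).1 y) hfin ht hden (fun _ _ => inferInstance)
    change ¬ E₀ ≤ codeExponent W g fun m => (C m).1
    rw [le_codeExponent_iff hn (errorProb_pos hW hM2 _)]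
    intro hle
    refine absurd hkey (not_lt.2 ?_)
    refine (mul_le_mul_of_nonneg_left hpairs (Real.exp_pos _).le).trans ?_
    have h3 : Real.exp (-(n * lamCost W g QX R P)) *
        (∑ i, ∑ j, if i ≠ j ∧ r (C i) (C j) then (1 : ℝ) else 0) ≤ _ := herr
    refine h3.trans ?_
    have h4 : 0 ≤ errorProb W g fun m => (C m).1 := (errorProb_pos hW hM2 _).le
    gcongr
  · rw [div_le_iff₀ (pow_pos hN0 _)]
    have h1 : ((S₂ ∪ S₁).card : ℝ) ≤ S₂.card + S₁.card := by exact_mod_cast Finset.card_union_le _ _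
    have h2 : q / ρ / (8 * (ρ * q)) = 1 / (8 * ρ ^ 2) := by field_simp
    have h3 : L * (q / ρ) / (8 * (ρ * q)) = L / (8 * ρ ^ 2) := by field_simp
    have h4 : (S₂.card : ℝ) ≤ N ^ (L + K) * ((Fintype.card Y : ℝ) ^ n *
        Real.exp (2 * ((L + K : ℕ) : ℝ) * (ρ * Real.exp (-(n * R))) - t)) := by
      refine hS₂.trans ?_
      gcongr
    rw [h3] at hS₁
    calc _ ≤ _ := h1
      _ ≤ _ := add_le_add h4 hS₁
      _ = _ := by ring

lemma eventually_const_le_exp (c : ℝ) {ε : ℝ} (hε : 0 < ε) :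
    ∀ᶠ n : ℕ in atTop, c ≤ Real.exp (n * ε) := by
  simpa using eventually_mul_pow_le_exp c 0 hε

lemma eventually_poly_le_exp (k l : ℕ) {ε : ℝ} (hε : 0 < ε) :
    ∀ᶠ n : ℕ in atTop, ((n : ℝ) + 1) ^ k * (Real.exp 1 * (n + 1)) ^ l ≤ Real.exp (n * ε) := by
  filter_upwards [eventually_mul_pow_le_exp (Real.exp 1 ^ l) (k + l) hε] with n hn
  refine le_trans (le_of_eq ?_) hn
  rw [mul_pow, pow_add]; ring

lemma eventually_total_le (c : ℕ) {F ε : ℝ} (hε : 0 < ε) (hF : 2 * ε < F) :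
    ∀ᶠ n : ℕ in atTop, (c : ℝ) ^ n * Real.exp (4 * Real.exp (n * ε) - Real.exp (n * F)) +
      (Real.exp (-Real.exp (n * F)) + Real.exp (-Real.exp (n * F))) ≤
      Real.exp (-Real.exp (n * (F - ε))) := by
  have hG : 0 < F - ε - ε := by linarith
  have hG' : 0 < F - ε := by linarith
  filter_upwards [eventually_const_le_exp 3 hε, eventually_const_le_exp 8 hG,
    eventually_mul_pow_le_exp (2 * c) 1 hG'] with n h3 h8 hc
  set u := Real.exp (n * (F - ε)) with hu
  have hu1 : 1 ≤ u := Real.one_le_exp (by positivity)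
  have h3u : 3 * u ≤ Real.exp (n * F) := by
    have : Real.exp (n * F) = Real.exp (n * ε) * u := by rw [hu, ← Real.exp_add]; ring_nf
    rw [this]; gcongr
  have h8u : 8 * Real.exp (n * ε) ≤ u := by
    have : u = Real.exp (n * (F - ε - ε)) * Real.exp (n * ε) := by
      rw [hu, ← Real.exp_add]; ring_nf
    rw [this]; gcongr
  have hcn : (c : ℝ) ^ n ≤ Real.exp (u / 2) := by
    have h1 : (c : ℝ) ≤ Real.exp c := by linarith [Real.add_one_le_exp (c : ℝ)]
    calc (c : ℝ) ^ n ≤ Real.exp c ^ n := by gcongr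
      _ = Real.exp (n * c) := by rw [← Real.exp_nat_mul]
      _ ≤ _ := by
        refine Real.exp_le_exp.2 ?_
        have hc0 : (0 : ℝ) ≤ c := Nat.cast_nonneg _
        rw [pow_one] at hc
        linarith
  have h2 : 2 ≤ Real.exp u := by linarith [Real.add_one_le_exp u]
  have hA : (c : ℝ) ^ n * Real.exp (4 * Real.exp (n * ε) - Real.exp (n * F)) ≤
      Real.exp (-u) * Real.exp (-u) := by
    calc _ ≤ Real.exp (u / 2) * Real.exp (4 * Real.exp (n * ε) - Real.exp (n * F)) := by gcongr
      _ = Real.exp (u / 2 + (4 * Real.exp (n * ε) - Real.exp (n * F))) := by rw [Real.exp_add]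
      _ ≤ Real.exp (-u + -u) := Real.exp_le_exp.2 (by linarith)
      _ = _ := Real.exp_add _ _
  have hB : Real.exp (-Real.exp (n * F)) ≤ Real.exp (-u) * Real.exp (-u) * Real.exp (-u) := by
    rw [← Real.exp_add, ← Real.exp_add]
    exact Real.exp_le_exp.2 (by linarith)
  set v := Real.exp (-u) with hv
  have hv2 : v ≤ 1 / 2 := by
    rw [hv, Real.exp_neg, inv_eq_one_div]
    exact one_div_le_one_div_of_le two_pos h2
  have hv0 : 0 < v := Real.exp_pos _
  nlinarith [mul_pos hv0 hv0, mul_le_mul_of_nonneg_left hv2 hv0.le,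
    mul_le_mul_of_nonneg_left hv2 (mul_pos hv0 hv0).le]

/-- Comparison of the exponents in `upperTail_le` when the polynomial factors are absorbed in
`ρ = exp (n ε)`. -/
lemma exponent_bounds {R I Λ E₀ F ε : ℝ} {n : ℕ}
    (hc : 2048 ≤ Real.exp (n * ε)) (h1 : 4 * ε + F ≤ R + E₀ - Λ - I) (h2 : F + 3 * ε ≤ R)
    (h3 : F + 2 * ε ≤ 2 * R - I) {L K H : ℕ} (hL : L = numWords R n / 2)
    (hK : K = numWords R n - numWords R n / 2) (hM : 2 ≤ numWords R n)
    (hH : H = ⌈2 * L * (Real.exp (n * ε) * Real.exp (-(n * I)))⌉₊ + 1) :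
    Real.exp (n * ε) * Real.exp (n * F) * (numWords R n * Real.exp (-(n * E₀))) <
      Real.exp (-(n * Λ)) * (K * L * (Real.exp (-(n * I)) / Real.exp (n * ε)) / 32) ∧
    Real.exp (n * F) ≤ L / (8 * Real.exp (n * ε) ^ 2) ∧
    Real.exp (n * F) ≤ K * L * (Real.exp (-(n * I)) / Real.exp (n * ε)) / (32 * H) := by
  set M := numWords R n with hMdef
  set ρ := Real.exp (n * ε) with hρ
  set q := Real.exp (-(n * I)) with hq
  have hρ0 : 0 < ρ := Real.exp_pos _
  have hq0 : 0 < q := Real.exp_pos _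
  have hM1 := exp_le_numWords R n
  rw [← hMdef] at hM1
  set m := Real.exp (n * R) with hm
  have hm0 : 0 < m := Real.exp_pos _
  have hL4 : m / 4 ≤ L := by
    have : M ≤ 4 * L := by omega
    have : (M : ℝ) ≤ 4 * L := by exact_mod_cast this
    linarith
  have hLM : (M : ℝ) / 4 ≤ L := by
    have : M ≤ 4 * L := by omega
    have : (M : ℝ) ≤ 4 * L := by exact_mod_cast this
    linarith
  have hK4 : m / 4 ≤ K := by
    have : M ≤ 4 * K := by omega
    have : (M : ℝ) ≤ 4 * K := by exact_mod_cast this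
    linarith
  have hL0 : (0 : ℝ) < L := by linarith [div_pos hm0 four_pos]
  have hK0 : (0 : ℝ) < K := by linarith [div_pos hm0 four_pos]
  have hM0 : (0 : ℝ) < M := by linarith
  set f := Real.exp (n * F) with hf
  have hf0 : 0 < f := Real.exp_pos _
  have hfm : 2048 * ρ ^ 2 * f ≤ m := by
    calc 2048 * ρ ^ 2 * f ≤ ρ * ρ ^ 2 * f := by gcongr
      _ = Real.exp (n * (F + 3 * ε)) := by
          rw [hρ, hf, ← Real.exp_nat_mul, ← Real.exp_add, ← Real.exp_add]; push_cast; ring_nf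
      _ ≤ m := Real.exp_le_exp.2 (by gcongr)
  have hfq : 2048 * ρ * f ≤ m * m * q := by
    calc 2048 * ρ * f ≤ ρ * ρ * f := by gcongr
      _ = Real.exp (n * (F + 2 * ε)) := by
          rw [hρ, hf, ← Real.exp_add, ← Real.exp_add]; ring_nf
      _ ≤ Real.exp (n * (2 * R - I)) := Real.exp_le_exp.2 (by gcongr)
      _ = m * m * q := by rw [hm, hq, ← Real.exp_add, ← Real.exp_add]; ring_nf
  refine ⟨?_, ?_, ?_⟩
  · set e := Real.exp (-(n * E₀)) with he
    set l := Real.exp (-(n * Λ)) with hl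
    have he0 : 0 < e := Real.exp_pos _
    have hl0 : 0 < l := Real.exp_pos _
    have hmain : 2048 * (ρ * ρ * f * e) ≤ l * m * q := by
      calc 2048 * (ρ * ρ * f * e) ≤ ρ * ρ * (ρ * ρ * f * e) := by
            have : 2048 ≤ ρ * ρ := by nlinarith
            gcongr
        _ = Real.exp (n * (4 * ε + F - E₀)) := by
            rw [hρ, hf, he, ← Real.exp_add, ← Real.exp_add, ← Real.exp_add, ← Real.exp_add]
            ring_nf
        _ ≤ Real.exp (n * (R - Λ - I)) := by
            refine Real.exp_le_exp.2 (mul_le_mul_of_nonneg_left ?_ (Nat.cast_nonneg _))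
            linarith
        _ = l * m * q := by rw [hl, hm, hq, ← Real.exp_add, ← Real.exp_add]; ring_nf
    have hKL : m * M / 16 ≤ K * L := by
      calc m * M / 16 = (m / 4) * (M / 4) := by ring
        _ ≤ K * L := by gcongr
    have h5 : ρ * f * (M * e) < l * ((m * M / 16) * (q / ρ) / 32) := by
      have : l * ((m * M / 16) * (q / ρ) / 32) = (l * m * q) * M / (512 * ρ) := by
        field_simp; ring
      rw [this, lt_div_iff₀ (by positivity)]
      have h6 : 0 < ρ * ρ * f * e * M := by positivity
      nlinarith [mul_le_mul_of_nonneg_right hmain hM0.le]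
    refine h5.trans_le ?_
    gcongr
  · rw [le_div_iff₀ (by positivity)]
    have : 0 < ρ ^ 2 * f := by positivity
    linarith
  · have hHle : (H : ℝ) ≤ 2 * L * (ρ * q) + 2 := by
      have := (Nat.ceil_lt_add_one (a := 2 * L * (ρ * q)) (by positivity)).le
      rw [hH]; push_cast; linarith
    have hH0 : (0 : ℝ) < H := by
      have : 0 < H := by omega
      exact_mod_cast this
    rw [le_div_iff₀ (by positivity), ← mul_div_assoc, le_div_iff₀ hρ0]
    have h5 : 128 * ρ ^ 2 * f ≤ K := by
      have : 0 < ρ ^ 2 * f := by positivity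
      linarith
    have h6 : 128 * ρ * f ≤ K * L * q := by
      calc 128 * ρ * f ≤ m * m * q / 16 := by linarith
        _ = (m / 4) * (m / 4) * q := by ring
        _ ≤ K * L * q := by gcongr
    calc f * (32 * H) * ρ ≤ f * (32 * (2 * L * (ρ * q) + 2)) * ρ := by gcongr
      _ = (128 * ρ ^ 2 * f) * (L * q) / 2 + (128 * ρ * f) / 2 := by ring
      _ ≤ K * (L * q) / 2 + (K * L * q) / 2 := by gcongr
      _ = K * L * q := by ring

/-- The upper tail is at most `exp (-exp (n E))` in the double-exponential scale, where `E` is the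
maximum over `V(R,E₀)`. -/
theorem dexpLE_upperTail [MeasurableSpace X] [MeasurableSingletonClass X]
    (hg : ContinuousOn g (stdSimplex ℝ (X × Y))) (hW : ∀ x, W x ∈ stdSimplex ℝ Y)
    (hQX : QX ∈ stdSimplex ℝ X) (hR : 0 < R) (hpos : 0 < EutUb W g QX R E₀) :
    DexpLE (blockLengths QX) (upperTail W g QX R E₀) (doubleExp (EutUb W g QX R E₀)) := by
  refine dexpLE_of_eventually_le inf_le_left fun ε₀ hε₀ => ?_
  set E := EutUb W g QX R E₀ with hE
  set ε := min ε₀ E / 12 with hε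
  have hε0 : 0 < ε := div_pos (lt_min hε₀ hpos) (by norm_num)
  have hε1 : 12 * ε ≤ ε₀ := by rw [hε]; linarith [min_le_left ε₀ E]
  have hε2 : 12 * ε ≤ E := by rw [hε]; linarith [min_le_right ε₀ E]
  -- a supremum over the empty set is `0`, so `hpos` excludes that `V(R,E₀)` is empty
  have hne : (setV W g QX R E₀).Nonempty := by
    by_contra h
    rw [Set.not_nonempty_iff_eq_empty] at h
    rw [hE, EutUb, h, Set.image_empty, Real.sSup_empty] at hpos
    exact lt_irrefl _ hpos
  obtain ⟨-, ⟨Q, ⟨hQ, -, -⟩, rfl⟩, hval⟩ :=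
    exists_lt_of_lt_csSup (hne.image _) (show E - ε < EutUb W g QX R E₀ by linarith)
  simp only [lt_min_iff] at hval
  obtain ⟨hv1, hv2, hv3⟩ := hval
  obtain ⟨-, ⟨P, hP, rfl⟩, hPval⟩ := exists_lt_of_csInf_lt
    ((extensions_nonempty hW hQ.1).image (lamCost W g QX R))
    (show sInf (lamCost W g QX R '' extensions W Q) < Lam W g QX R Q + ε by
      rw [← Lam_eq_sInf]; linarith)
  obtain ⟨δ₁, hδ₁, hlam⟩ := exists_dist_lt_of_continuousOn
    (continuousOn_lamCost hg hQX W (R := R)) hε0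
  obtain ⟨δ₂, hδ₂, hmi⟩ := exists_dist_lt_of_continuousOn
    (continuous_mutualInfo.comp (continuous_margXX (A := X) (B := Y))).continuousOn hε0
  have hnear : ∀ᶠ n : ℕ in atTop, (Fintype.card (X × X × Y) : ℝ) / n < min δ₁ δ₂ :=
    (tendsto_const_div_atTop_nhds_zero_nat _).eventually (gt_mem_nhds (lt_min hδ₁ hδ₂))
  have hev := ((eventually_gt_atTop 0).and (hnear.and
    ((eventually_const_le_exp 2048 hε0).and
    ((eventually_poly_le_exp (Fintype.card Y * Fintype.card X) (Fintype.card X) hε0).and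
    ((eventually_poly_le_exp (Fintype.card X * Fintype.card X) (Fintype.card X) hε0).and
    ((eventually_poly_le_exp (Fintype.card X) (Fintype.card X * Fintype.card X) hε0).and
    ((eventually_poly_le_exp 0 (Fintype.card (X × X) * Fintype.card Y) hε0).and
    (eventually_total_le (Fintype.card Y) hε0 (F := E - 8 * ε) (by linarith)))))))))
  filter_upwards [hev.filter_mono inf_le_left,
    mem_inf_of_right (mem_principal_self {n | (typeClass n QX).Nonempty})] with n hn hT
  obtain ⟨hn, hnear, hc, hp0, hp1, hp2, hp3, htot⟩ := hn
  obtain ⟨x, x', y, hx, hx', hfin, hdist⟩ := exists_triple_near hn hT hW hQ hP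
  set Pn := empDist fun t => (x t, x' t, y t) with hPn
  have hPns : Pn ∈ stdSimplex ℝ (X × X × Y) := empDist_mem_stdSimplex hn _
  have hd := hdist.trans_lt hnear
  have hl := (abs_lt.1 (hlam Pn hPns P hP.1 (hd.trans_le (min_le_left _ _)))).2
  have hm := (abs_lt.1 (hmi Pn hPns P hP.1 (hd.trans_le (min_le_right _ _)))).2
  simp only [Function.comp_apply] at hm
  rw [hP.2.1] at hm
  -- the words are split into two halves, and `H` is twice the mean number of words of the first
  -- half related to a given word, up to the polynomial factor
  set L := numWords R n / 2 with hL
  set K := numWords R n - numWords R n / 2 with hK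
  set H := ⌈2 * L * (Real.exp (n * ε) * Real.exp (-(n * mutualInfo (margXX Pn))))⌉₊ + 1 with hH
  obtain ⟨hk1, hk2, hk3⟩ := exponent_bounds (R := R) (I := mutualInfo (margXX Pn))
    (Λ := lamCost W g QX R Pn) (E₀ := E₀) (F := E - 8 * ε) hc (by linarith) (by linarith)
    (by linarith) hL hK (two_le_numWords hR hn) hH
  have hbound := upperTail_le (E₀ := E₀) hg hW hQX hR hx hx' hPn.symm hfin
    (ρ := Real.exp (n * ε)) (Real.exp_pos (n * (E - 8 * ε))) hp0 hp1 (by rw [mul_comm]; exact hp2)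
    (by simpa using hp3) (L := L) (K := K) (H := H) (by omega) (by omega)
    ((Nat.le_ceil _).trans (by rw [hH]; push_cast; linarith)) hk1
  refine hbound.trans (ENNReal.ofReal_le_ofReal ?_)
  refine (add_le_add (mul_le_mul_of_nonneg_left (Real.exp_le_exp.2 (sub_le_sub_right ?_ _))
    (by positivity)) (add_le_add (Real.exp_le_exp.2 (neg_le_neg hk2))
    (Real.exp_le_exp.2 (neg_le_neg hk3)))).trans (htot.trans ?_)
  · have h1 := numWords_le hR n
    have h2 : Real.exp (n * R) * Real.exp (-(n * R)) = 1 := by rw [← Real.exp_add]; simp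
    calc 2 * (numWords R n : ℝ) * (Real.exp (n * ε) * Real.exp (-(n * R)))
        ≤ 2 * (2 * Real.exp (n * R)) * (Real.exp (n * ε) * Real.exp (-(n * R))) := by gcongr
      _ = 4 * Real.exp (n * ε) * (Real.exp (n * R) * Real.exp (-(n * R))) := by ring
      _ = _ := by rw [h2, mul_one]
  · refine Real.exp_le_exp.2 (neg_le_neg (Real.exp_le_exp.2 ?_))
    exact mul_le_mul_of_nonneg_left (by linarith) (Nat.cast_nonneg _)

end UpperTailBound

/-! ### Upper bound on the error probability of a code -/

section ErrorUpperBound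

variable {X Y : Type*} [Fintype X] [Fintype Y] [DecidableEq X] [DecidableEq Y]
  {W : X → Y → ℝ} {g : (X × Y → ℝ) → ℝ} {QX : X → ℝ} {R E₀ : ℝ} {n : ℕ}

/-- Near-maximizers in the definition of `α` can be taken to be joint types of `y` with words of
the type class, uniformly in `y` and with mutual information bounded away from `R`. -/
lemma exists_word_alpha (hg : ContinuousOn g (stdSimplex ℝ (X × Y))) (hQX : QX ∈ stdSimplex ℝ X)
    (hR : 0 < R) {ε : ℝ} (hε : 0 < ε) :
    ∃ δ > 0, ∀ᶠ n : ℕ in blockLengths QX, ∀ y : Fin n → Y, ∃ x ∈ typeClass n QX,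
      mutualInfo (empDist fun t => (x t, y t)) ≤ R - δ ∧
      alpha g QX R (empDist y) - ε ≤ g (empDist fun t => (x t, y t)) -
        mutualInfo (empDist fun t => (x t, y t)) + R := by
  obtain ⟨δ, hδ, hα⟩ := exists_coupling_alpha hg hQX hR (half_pos hε)
  have hcont : ContinuousOn (fun Q => g Q - mutualInfo Q) (stdSimplex ℝ (X × Y)) :=
    hg.sub continuous_mutualInfo.continuousOn
  obtain ⟨δ₁, hδ₁, h1⟩ := exists_dist_lt_of_continuousOn hcont (half_pos hε)
  obtain ⟨δ₂, hδ₂, h2⟩ := exists_dist_lt_of_continuousOn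
    (continuous_mutualInfo (A := X) (B := Y)).continuousOn (half_pos hδ)
  have hnear : ∀ᶠ n : ℕ in atTop, (Fintype.card (X × Y × Unit) : ℝ) / n < min δ₁ δ₂ :=
    (tendsto_const_div_atTop_nhds_zero_nat _).eventually (gt_mem_nhds (lt_min hδ₁ hδ₂))
  refine ⟨δ / 2, half_pos hδ, ?_⟩
  filter_upwards [((eventually_gt_atTop 0).and hnear).filter_mono inf_le_left,
    mem_inf_of_right (mem_principal_self {n | (typeClass n QX).Nonempty})] with n hn hT y
  obtain ⟨hn, hnear⟩ := hn
  obtain ⟨x₀, hx₀⟩ := hT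
  obtain ⟨Q, hQ, hQI, hQα⟩ := hα (empDist y) (empDist_mem_stdSimplex hn y)
  have hn' : (n : ℝ) ≠ 0 := by positivity
  obtain ⟨w, hw1, hw2, hw3, -⟩ := exists_empDist_near hn (fun p : X × Y × Unit => Q (p.1, p.2.1))
    (fun p => hQ.1.1 _) (letterCount x₀) (letterCount y)
    (fun a => by
      rw [← nat_mul_typeClass_apply hn hx₀, ← hQ.2.1]
      simp [fstMarg])
    (fun b => by
      have : empDist y b = ∑ a, Q (a, b) := by rw [← hQ.2.2]; rfl
      rw [empDist_eq_letterCount_div, div_eq_iff hn'] at this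
      rw [this, mul_comm]
      simp)
    (sum_letterCount x₀) (fun _ => ())
  have hy : empDist y = empDist fun t => (w t).2.1 := by
    ext b
    rw [empDist_eq_letterCount_div, empDist_eq_letterCount_div, hw2]
  obtain ⟨x, hx⟩ := exists_empDist_pair hn hy fun t => (w t).1
  have hxT : x ∈ typeClass n QX := by
    have := congrArg fstMarg hx
    rw [fstMarg_empDist, fstMarg_empDist] at this
    exact (this : empDist x = _).trans (mem_typeClass_of_letterCount_eq hx₀ hw1)
  have hd : dist (empDist fun t => (x t, y t)) Q < min δ₁ δ₂ := by
    refine lt_of_le_of_lt ((dist_pi_le_iff (by positivity)).2 fun p => ?_) hnear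
    let e : X × Y × Unit ≃ X × Y :=
      ⟨fun p => (p.1, p.2.1), fun p => (p.1, p.2, ()), fun _ => rfl, fun _ => rfl⟩
    have h := congrFun (empDist_equiv e w) p
    rw [Real.dist_eq, hx]
    exact (congrArg (fun r => |r - Q p|) h).trans_le (hw3 (p.1, p.2, ()))
  have hs := empDist_mem_stdSimplex hn fun t => (x t, y t)
  have h1' := (abs_lt.1 (h1 _ hs Q hQ.1 (hd.trans_le (min_le_left _ _)))).1
  have h2' := (abs_lt.1 (h2 _ hs Q hQ.1 (hd.trans_le (min_le_right _ _)))).2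
  exact ⟨x, hxT, by linarith, by linarith⟩

omit [Fintype X] [Fintype Y] in
/-- The decoder decides on a wrong codeword with small probability when the total score is bounded
from below, both by the score of the correct codeword and by `exp (n a)`. -/
lemma decodeProb_le {M : ℕ} {C : Fin M → Fin n → X} {y : Fin n → Y} {a ε : ℝ} (hε : 0 ≤ ε)
    (hden : Real.exp (n * (a - ε)) ≤ ∑ k, score g (C k) y) (i j : Fin M) :
    decodeProb g C y j ≤ Real.exp (n * ε - n * max 0 (max (g (empDist fun t => (C i t, y t))) a -
      g (empDist fun t => (C j t, y t)))) := by
  have hle : ∀ k, score g (C k) y ≤ ∑ k, score g (C k) y := fun k =>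
    Finset.single_le_sum (f := fun k => score g (C k) y) (fun k _ => (score_pos _ _).le)
      (Finset.mem_univ k)
  have hpos : 0 < ∑ k, score g (C k) y := (score_pos _ _).trans_le (hle i)
  have hn : (0 : ℝ) ≤ n := Nat.cast_nonneg n
  have key : ∀ b, Real.exp (n * (b - ε)) ≤ ∑ k, score g (C k) y → decodeProb g C y j ≤
      Real.exp (n * ε - n * (b - g (empDist fun t => (C j t, y t)))) := by
    intro b hb
    rw [decodeProb, div_le_iff₀ hpos]
    refine le_trans (le_of_eq ?_) (mul_le_mul_of_nonneg_left hb (Real.exp_pos _).le)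
    rw [score, ← Real.exp_add]
    congr 1; ring
  have hmono : ∀ k, Real.exp (n * (g (empDist fun t => (C k t, y t)) - ε)) ≤
      ∑ k, score g (C k) y := fun k =>
    le_trans (Real.exp_le_exp.2 (mul_le_mul_of_nonneg_left (by linarith) hn)) (hle k)
  rcases max_choice 0 (max (g (empDist fun t => (C i t, y t))) a -
      g (empDist fun t => (C j t, y t))) with h | h <;> rw [h]
  · have := key _ (hmono j)
    rwa [sub_self] at this
  · refine key _ ?_
    rcases max_choice (g (empDist fun t => (C i t, y t))) a with h' | h' <;> rw [h']
    · exact hmono i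
    · exact hden

/-- Contribution of one pair of codewords to the error probability when the total scores are not
smaller than `exp (n α)`, up to `exp (n ε)`. -/
lemma sum_prod_mul_decodeProb_le (hn : 0 < n) (hW : ∀ x y, 0 ≤ W x y) {M : ℕ}
    {C : Fin M → Fin n → X} {ε L : ℝ} (hε : 0 ≤ ε)
    (hden : ∀ y : Fin n → Y,
      Real.exp (n * (alpha g QX R (empDist y) - ε)) ≤ ∑ k, score g (C k) y) {i j : Fin M}
    (hL : ∀ P ∈ stdSimplex ℝ (X × X × Y), margXX P = empDist (fun t => (C i t, C j t)) →
      FiniteDiv W (margXY P) → L ≤ gamCost W g QX R P) :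
    ∑ y : Fin n → Y, (∏ s, W (C i s) (y s)) * decodeProb g C y j ≤
      ((n : ℝ) + 1) ^ (Fintype.card (X × X) * Fintype.card Y) * Real.exp (n * (ε - L)) := by
  have h := sum_exp_entropy_sub_le (B := Y) fun t => (C i t, C j t)
  refine le_trans ?_ (mul_le_mul_of_nonneg_right h (Real.exp_pos (n * (ε - L))).le)
  rw [Finset.sum_mul]
  refine Finset.sum_le_sum fun y _ => ?_
  -- outputs of probability zero contribute nothing; for the others the divergence is finite
  by_cases h0 : ∃ s, W (C i s) (y s) = 0
  · obtain ⟨s, hs⟩ := h0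
    rw [Finset.prod_eq_zero (Finset.mem_univ s) hs, zero_mul]
    positivity
  push Not at h0
  set P := empDist fun t => (C i t, C j t, y t) with hP
  have hXX : margXX P = empDist fun t => (C i t, C j t) := margXX_empDist _ _ _
  have hXY : margXY P = empDist fun t => (C i t, y t) := margXY_empDist _ _ _
  have hX'Y : margX'Y P = empDist fun t => (C j t, y t) := margX'Y_empDist _ _ _
  have hY : sndMarg (margXY P) = empDist y := by rw [hXY, sndMarg_empDist]
  have hfin : FiniteDiv W (margXY P) := by
    intro a b hab
    rw [hXY, empDist_eq_letterCount_div, letterCount, Finset.card_eq_zero.2, Nat.cast_zero,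
      zero_div]
    refine Finset.filter_eq_empty_iff.2 fun s _ hs => h0 s ?_
    obtain ⟨rfl, rfl⟩ := Prod.mk.inj hs
    exact hab
  have hcost := hL P (empDist_mem_stdSimplex hn _) hXX hfin
  have hent : entropy (empDist fun t => ((C i t, C j t), y t)) = entropy P :=
    (entropy_empDist_equiv (Equiv.prodAssoc X X Y) fun t => ((C i t, C j t), y t)).symm
  have hprod : ∏ s, W (C i s) (y s) =
      Real.exp (n * ∑ x, ∑ y, margXY P (x, y) * Real.log (W x y)) := by
    have h1 := sum_apply_eq_mul_sum_empDist (fun s => (C i s, y s))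
      (fun p : X × Y => Real.log (W p.1 p.2))
    rw [← hXY, Fintype.sum_prod_type] at h1
    rw [← h1, Real.exp_sum]
    exact Finset.prod_congr rfl fun s _ =>
      (Real.exp_log ((hW _ _).lt_of_ne' (h0 s))).symm
  have hdec := decodeProb_le hε (hden y) i j
  rw [← hXY, ← hX'Y, ← hY] at hdec
  rw [hprod, hent, ← hXX]
  refine (mul_le_mul_of_nonneg_left hdec (Real.exp_pos _).le).trans ?_
  rw [← Real.exp_add, ← Real.exp_add]
  refine Real.exp_le_exp.2 ?_
  have h2 := mul_le_mul_of_nonneg_left hcost (Nat.cast_nonneg (α := ℝ) n)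
  rw [gamCost, channelCost] at h2
  linarith

lemma sum_filter_ne_eq_two_mul_pairSum {T : Type*} {J : T → T → ℝ}
    (hJ : ∀ x x', J x x' = J x' x) {M : ℕ} (C : Fin M → T) :
    ∑ i, ∑ j ∈ Finset.univ.filter (fun k => k ≠ i), J (C i) (C j) = 2 * pairSum J C := by
  have h : ∑ i, ∑ j, (if j < i then J (C i) (C j) else 0) = pairSum J C := by
    rw [Finset.sum_comm, pairSum]
    refine Finset.sum_congr rfl fun i _ => Finset.sum_congr rfl fun j _ => ?_
    rw [hJ]
  rw [two_mul]
  nth_rewrite 1 [← h]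
  rw [pairSum, ← Finset.sum_add_distrib]
  refine Finset.sum_congr rfl fun i _ => ?_
  rw [Finset.sum_filter, ← Finset.sum_add_distrib]
  refine Finset.sum_congr rfl fun j _ => ?_
  rcases lt_trichotomy i j with h | h | h
  · simp [h, h.ne', h.not_gt]
  · simp [h]
  · simp [h, h.ne, h.not_gt]

/-- If the pairs of codewords avoid large mutual information, have pair costs of the order of the
mean, and if the total scores are not too small, then the error probability is of order
`exp (-n V)`. -/
lemma errorProb_le (hn : 0 < n) (hW : ∀ x y, 0 ≤ W x y) {M : ℕ}
    (hM : 0 < M) {C : Fin M → typeClass n QX} {ε A V c : ℝ} (hε : 0 ≤ ε)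
    (hV : ∀ P ∈ stdSimplex ℝ (X × X × Y), margXX P ∈ couplings QX QX →
      mutualInfo (margXX P) ≤ A → FiniteDiv W (margXY P) →
      V ≤ gamCost W g QX R P + mutualInfo (margXX P) - R)
    (hden : ∀ y : Fin n → Y,
      Real.exp (n * (alpha g QX R (empDist y) - ε)) ≤ ∑ k, score g (C k).1 y)
    (hbad : ∀ i j, i ≠ j → mutualInfo (empDist fun t => ((C i).1 t, (C j).1 t)) ≤ A)
    (hsum : pairSum (fun x x' : typeClass n QX =>
      Real.exp (n * mutualInfo (empDist fun t => (x.1 t, x'.1 t)))) C ≤ 8 * M ^ 2 * c) :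
    errorProb W g (fun m => (C m).1) ≤ 16 * M * c *
      (((n : ℝ) + 1) ^ (Fintype.card (X × X) * Fintype.card Y) *
        Real.exp (n * (ε - V - R))) := by
  have hM0 : (0 : ℝ) < M := by exact_mod_cast hM
  set J : typeClass n QX → typeClass n QX → ℝ := fun x x' =>
    Real.exp (n * mutualInfo (empDist fun t => (x.1 t, x'.1 t))) with hJ
  set p : ℝ := ((n : ℝ) + 1) ^ (Fintype.card (X × X) * Fintype.card Y) *
        Real.exp (n * (ε - V - R)) with hp
  have hp0 : 0 ≤ p := by positivity
  have hpair : ∀ i j, j ≠ i → ∑ y : Fin n → Y, (∏ s, W ((C i).1 s) (y s)) *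
      decodeProb g (fun m => (C m).1) y j ≤ p * J (C i) (C j) := by
    intro i j hij
    refine (sum_prod_mul_decodeProb_le (QX := QX) (R := R)
      (L := V + R - mutualInfo (empDist fun t => ((C i).1 t, (C j).1 t))) hn hW hε hden
      fun P hP hXX hfin => ?_).trans (le_of_eq ?_)
    · have hc := empDist_mem_couplings hn (C i).1 (C j).1
      rw [show empDist (C i).1 = QX from (C i).2, show empDist (C j).1 = QX from (C j).2] at hc
      have := hV P hP (hXX ▸ hc) (hXX ▸ hbad i j hij.symm) hfin
      rw [hXX] at this
      linarith
    · rw [hp, hJ, mul_assoc, ← Real.exp_add]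
      congr 2; ring
  have htot : ∑ i, ∑ j ∈ Finset.univ.filter (fun k => k ≠ i), ∑ y : Fin n → Y,
      (∏ s, W ((C i).1 s) (y s)) * decodeProb g (fun m => (C m).1) y j ≤
      p * (2 * pairSum J C) := by
    rw [← sum_filter_ne_eq_two_mul_pairSum (fun x x' => by
      simp only [hJ]; rw [mutualInfo_empDist_comm]) C, Finset.mul_sum]
    refine Finset.sum_le_sum fun i _ => ?_
    rw [Finset.mul_sum]
    exact Finset.sum_le_sum fun j hj => hpair i j (Finset.mem_filter.1 hj).2
  rw [errorProb, one_div, inv_mul_le_iff₀ hM0]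
  calc _ ≤ p * (2 * pairSum J C) := htot
    _ ≤ p * (2 * (8 * M ^ 2 * c)) := by gcongr
    _ = _ := by ring

end ErrorUpperBound

/-! ### Lower bound on the upper tail -/

section UpperTailLowerBound

variable {X Y : Type*} [Fintype X] [Fintype Y] [DecidableEq X] [DecidableEq Y]
  {W : X → Y → ℝ} {g : (X × Y → ℝ) → ℝ} {QX : X → ℝ} {R E₀ : ℝ} {n : ℕ}

/-- Lower bound on the upper tail at a fixed block length: the codes without pairs of codewords of
mutual information `A` or more have probability of order `exp (-M² exp (-n A))`, and most of
them have a small error probability. -/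
lemma le_upperTail [MeasurableSpace X] [MeasurableSingletonClass X]
    (hW : ∀ x, W x ∈ stdSimplex ℝ Y) (hQX : QX ∈ stdSimplex ℝ X) (hR : 0 < R)
    (hT : (typeClass n QX).Nonempty) {A V ε δ κ : ℝ} (hε : 0 ≤ ε) (hκ : 0 < κ)
    (hV : ∀ P ∈ stdSimplex ℝ (X × X × Y), margXX P ∈ couplings QX QX →
      mutualInfo (margXX P) ≤ A → FiniteDiv W (margXY P) →
      V ≤ gamCost W g QX R P + mutualInfo (margXX P) - R)
    (hα : ∀ y : Fin n → Y, ∃ x ∈ typeClass n QX,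
      mutualInfo (empDist fun t => (x t, y t)) ≤ R - δ ∧
      alpha g QX R (empDist y) - ε ≤ g (empDist fun t => (x t, y t)) -
        mutualInfo (empDist fun t => (x t, y t)) + R)
    (hδ : 4 * κ ≤ δ) (hA : R + 2 * κ ≤ A) (hE₀ : E₀ + ε + 6 * κ ≤ V)
    (hc : 32 ≤ Real.exp (n * κ))
    (hρ1 : ((n : ℝ) + 1) ^ (Fintype.card X * Fintype.card X) *
          (Real.exp 1 * (n + 1)) ^ Fintype.card X ≤ Real.exp (n * κ))
    (hρ2 : (Real.exp 1 * (n + 1)) ^ (Fintype.card Y * Fintype.card X) *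
          ((n : ℝ) + 1) ^ Fintype.card X ≤ Real.exp (n * κ))
    (hρ3 : ((n : ℝ) + 1) ^ (Fintype.card (X × X) * Fintype.card Y) ≤ Real.exp (n * κ))
    (huni : (Fintype.card Y : ℝ) ^ n *
      (Real.exp (-Real.exp (n * κ)) + Real.exp (-Real.exp (n * κ))) ≤ 1 / 4) :
    ENNReal.ofReal (Real.exp (-(8 * Real.exp (n * (2 * R - A + κ)))) / 2) ≤
      upperTail W g QX R E₀ n := by
  classical
  obtain ⟨x₀, hx₀⟩ := hT
  have hn : 0 < n := typeClass_pos hQX hx₀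
  have hn0 : (0 : ℝ) ≤ n := Nat.cast_nonneg n
  have : Fintype (typeClass n QX) := Fintype.ofFinite _
  have : Nonempty (typeClass n QX) := ⟨⟨x₀, hx₀⟩⟩
  set N : ℝ := (Fintype.card (typeClass n QX) : ℝ) with hN
  have hN0 : 0 < N := by rw [hN]; exact_mod_cast Fintype.card_pos
  set M := numWords R n with hMdef
  have hM1 : Real.exp (n * R) ≤ M := exp_le_numWords R n
  have hM2 : (M : ℝ) ≤ 2 * Real.exp (n * R) := numWords_le hR n
  have hMtwo : 2 ≤ M := two_le_numWords hR hn
  have hM0 : 0 < M := by omega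
  choose x hxT hxI hxα using hα
  set Q : (Fin n → Y) → X × Y → ℝ := fun y => empDist fun t => (x y t, y t) with hQ
  set J : typeClass n QX → typeClass n QX → ℝ := fun x x' =>
    Real.exp (n * mutualInfo (empDist fun t => (x.1 t, x'.1 t))) with hJ
  have hJsymm : ∀ x x', J x x' = J x' x := fun x x' => by
    simp only [hJ]; rw [mutualInfo_empDist_comm]
  let bad : typeClass n QX → typeClass n QX → Prop := fun x x' =>
    A ≤ mutualInfo (empDist fun t => (x.1 t, x'.1 t))
  have hJsum : ∀ x', ∑ x, J x' x ≤ Real.exp (n * κ) * N := fun x' => by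
    simp_rw [hJsymm x']
    exact (sum_exp_mutualInfo_le hQX x'.1).trans (mul_le_mul_of_nonneg_right hρ1 hN0.le)
  -- Markov's inequality
  have hbad : ∀ x', ((Finset.univ.filter fun x => bad x' x).card : ℝ) ≤
      Real.exp (-(n * (A - κ))) * N := by
    intro x'
    have h1 : ((Finset.univ.filter fun x => bad x' x).card : ℝ) * Real.exp (n * A) ≤
        ∑ x, J x' x := by
      rw [← nsmul_eq_mul, ← Finset.sum_const]
      refine (Finset.sum_le_sum fun x hx => ?_).trans (Finset.sum_le_sum_of_subset_of_nonneg
        (Finset.subset_univ _) fun _ _ _ => (Real.exp_pos _).le)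
      exact Real.exp_le_exp.2 (mul_le_mul_of_nonneg_left (Finset.mem_filter.1 hx).2 hn0)
    have h2 := h1.trans (hJsum x')
    rw [← le_div_iff₀ (Real.exp_pos _)] at h2
    refine h2.trans (le_of_eq ?_)
    rw [mul_div_right_comm, ← Real.exp_sub]
    congr 2; ring
  have hMθ : 16 * M * Real.exp (-(n * (A - κ))) ≤ 1 := by
    calc _ ≤ 16 * (2 * Real.exp (n * R)) * Real.exp (-(n * (A - κ))) := by gcongr
      _ = 32 * Real.exp (n * (R - A + κ)) := by
        rw [mul_assoc, mul_assoc, ← Real.exp_add, ← mul_assoc]; norm_num; ring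
      _ ≤ Real.exp (n * κ) * Real.exp (n * (R - A + κ)) := by gcongr
      _ = Real.exp (n * (R - A + 2 * κ)) := by rw [← Real.exp_add]; congr 1; ring
      _ ≤ 1 := Real.exp_le_one_iff.2 (mul_nonpos_of_nonneg_of_nonpos hn0 (by linarith))
  -- the words of a joint type with `y` that almost attains `α`: enough of them in the code keep the
  -- total score at `y` above `exp (n α)`, up to a small exponent
  let S : (Fin n → Y) → Finset (typeClass n QX) := fun y =>
    Finset.univ.filter fun x' => empDist (fun t => (x'.1 t, y t)) = Q y
  let p : (Fin n → Y) → ℝ := fun y => Real.exp (-(n * (mutualInfo (Q y) + κ)))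
  have hS : ∀ y, p y * N ≤ (S y).card := by
    intro y
    have h := (le_card_typeClass_filter hQX y (Q := Q y) ⟨⟨x y, hxT y⟩, rfl⟩).trans
      (mul_le_mul_of_nonneg_right hρ2 (Nat.cast_nonneg _))
    have hp : p y = Real.exp (-(n * mutualInfo (Q y))) / Real.exp (n * κ) := by
      rw [← Real.exp_sub]; simp only [p]; congr 1; ring
    rw [hp, div_mul_eq_mul_div, div_le_iff₀ (Real.exp_pos _), mul_comm _ (Real.exp (n * κ))]
    exact h
  have h32 : ∀ {a b : ℝ}, a + κ ≤ b → 32 * Real.exp (n * a) ≤ Real.exp (n * b) := by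
    intro a b hab
    calc _ ≤ Real.exp (n * κ) * Real.exp (n * a) := by gcongr
      _ = Real.exp (n * (a + κ)) := by rw [← Real.exp_add]; congr 1; ring
      _ ≤ _ := Real.exp_le_exp.2 (mul_le_mul_of_nonneg_left hab hn0)
  have hMp : ∀ y, Real.exp (n * (R - mutualInfo (Q y) - κ)) ≤ M * p y := by
    intro y
    calc _ = Real.exp (n * R) * p y := by
          simp only [p]; rw [← Real.exp_add]; congr 1; ring
      _ ≤ _ := mul_le_mul_of_nonneg_right hM1 (Real.exp_pos _).le
  have hι : ∑ y, (Real.exp (-(p y / (4 * Real.exp (-(n * (A - κ)))))) +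
      Real.exp (-(M * p y / 8))) ≤ 1 / 4 := by
    have hterm : ∀ y ∈ Finset.univ, Real.exp (-(p y / (4 * Real.exp (-(n * (A - κ)))))) +
        Real.exp (-(M * p y / 8)) ≤
        Real.exp (-Real.exp (n * κ)) + Real.exp (-Real.exp (n * κ)) := fun y _ => by
      refine add_le_add (Real.exp_le_exp.2 (neg_le_neg ?_)) (Real.exp_le_exp.2 (neg_le_neg ?_))
      · have h1 : p y / (4 * Real.exp (-(n * (A - κ)))) =
            Real.exp (n * (A - mutualInfo (Q y) - 2 * κ)) / 4 := by
          rw [mul_comm, ← div_div]; simp only [p]; rw [← Real.exp_sub]; congr 2; ring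
        have h2 := h32 (a := κ) (b := A - mutualInfo (Q y) - 2 * κ) (by linarith [hxI y])
        have h3 := Real.exp_pos (n * κ)
        rw [h1]
        linarith
      · have h2 := h32 (a := κ) (b := R - mutualInfo (Q y) - κ) (by linarith [hxI y])
        have h3 := Real.exp_pos (n * κ)
        linarith [hMp y]
    exact (Finset.sum_le_sum hterm).trans (le_of_eq_of_le (by simp [mul_add]) huni)
  obtain ⟨𝒢, h𝒢, h𝒢'⟩ := exists_good_codes (bad := bad) (M := M) (J := J) (Real.exp_pos _)
    (p := p) (fun _ => Real.exp_pos _) hbad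
    (fun x x' h => by simp only [bad] at h ⊢; rwa [mutualInfo_empDist_comm])
    hM0 hMθ (fun _ _ => (Real.exp_pos _).le) (Real.exp_pos _) hJsum S hS hι
  refine le_trans (ENNReal.ofReal_le_ofReal ?_) (le_codeLaw 𝒢 fun C hC => ?_)
  · rw [le_div_iff₀ (pow_pos hN0 _)]
    refine le_trans (mul_le_mul_of_nonneg_right (div_le_div_of_nonneg_right
      (Real.exp_le_exp.2 (neg_le_neg ?_)) two_pos.le) (pow_pos hN0 _).le) h𝒢
    calc 2 * (M : ℝ) ^ 2 * Real.exp (-(n * (A - κ)))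
        ≤ 2 * (2 * Real.exp (n * R)) ^ 2 * Real.exp (-(n * (A - κ))) := by gcongr
      _ = 8 * Real.exp (n * (2 * R - A + κ)) := by
        rw [mul_pow, ← Real.exp_nat_mul, mul_assoc, mul_assoc, ← Real.exp_add]
        rw [← mul_assoc]
        push_cast
        ring_nf
  · obtain ⟨hC1, hC2, hC3⟩ := h𝒢' C hC
    change E₀ ≤ codeExponent W g fun m => (C m).1
    rw [le_codeExponent_iff hn (errorProb_pos hW hMtwo _)]
    have hden : ∀ y : Fin n → Y, Real.exp (n * (alpha g QX R (empDist y) - (ε + 2 * κ))) ≤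
        ∑ k, score g (C k).1 y := by
      intro y
      have h1 : (M * p y / 8) * Real.exp (n * g (Q y)) ≤ ∑ k, score g (C k).1 y := by
        refine (mul_le_mul_of_nonneg_right (hC3 y) (Real.exp_pos _).le).trans ?_
        rw [Finset.sum_mul]
        refine Finset.sum_le_sum fun k _ => ?_
        split_ifs with hk
        · rw [one_mul, score, (Finset.mem_filter.1 hk).2]
        · rw [zero_mul]; exact (score_pos _ _).le
      refine le_trans ?_ h1
      have h2 : 8 * Real.exp (n * (alpha g QX R (empDist y) - (ε + 2 * κ))) ≤
          Real.exp (n * (R - mutualInfo (Q y) - κ + g (Q y))) :=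
        le_trans (by gcongr; norm_num) (h32 (by linarith [hxα y]))
      have h3 : Real.exp (n * (R - mutualInfo (Q y) - κ + g (Q y))) ≤
          M * p y * Real.exp (n * g (Q y)) := by
        rw [mul_add, Real.exp_add]
        exact mul_le_mul_of_nonneg_right (hMp y) (Real.exp_pos _).le
      linarith
    have herr := errorProb_le (g := g) (V := V) hn (fun x y => (hW x).1 y) hM0
      (by linarith) hV hden (fun i j hij => (not_le.1 (hC1 i j hij)).le) hC2
    refine herr.trans ?_
    calc _ ≤ 16 * (2 * Real.exp (n * R)) * Real.exp (n * κ) *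
          (Real.exp (n * κ) * Real.exp (n * (ε + 2 * κ - V - R))) := by gcongr
      _ = 32 * Real.exp (n * (ε + 4 * κ - V)) := by
        have : n * (ε + 4 * κ - V) = n * R + n * κ + (n * κ + n * (ε + 2 * κ - V - R)) := by ring
        rw [this, Real.exp_add, Real.exp_add, Real.exp_add]; ring
      _ ≤ Real.exp (n * -E₀) := h32 (by linarith)
      _ = _ := by rw [mul_neg]

lemma eventually_pow_mul_le (c : ℕ) {κ : ℝ} (hκ : 0 < κ) :
    ∀ᶠ n : ℕ in atTop, (c : ℝ) ^ n *
      (Real.exp (-Real.exp (n * κ)) + Real.exp (-Real.exp (n * κ))) ≤ 1 / 4 := by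
  filter_upwards [eventually_total_le c (ε := κ / 4) (F := κ) (by linarith) (by linarith),
    eventually_const_le_exp 8 (ε := κ - κ / 4) (by linarith)] with n h1 h2
  have h3 : (c : ℝ) ^ n * Real.exp (-Real.exp (n * κ)) ≤
      (c : ℝ) ^ n * Real.exp (4 * Real.exp (n * (κ / 4)) - Real.exp (n * κ)) := by
    gcongr
    linarith [Real.exp_pos (n * (κ / 4))]
  have h4 : Real.exp (-Real.exp (n * (κ - κ / 4))) ≤ 1 / 8 := by
    rw [Real.exp_neg, inv_eq_one_div]
    exact one_div_le_one_div_of_le (by norm_num)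
      (h2.trans (by linarith [Real.add_one_le_exp (Real.exp (n * (κ - κ / 4)))]))
  have h5 := Real.exp_pos (-Real.exp (n * κ))
  linarith

/-- Joint distributions of `(X,X',Y)` that the definition of `Γ` runs over, for all `Q_{XX'}`
with both marginals `QX`. -/
def tripleSet (W : X → Y → ℝ) (QX : X → ℝ) : Set (X × X × Y → ℝ) :=
  {P | P ∈ stdSimplex ℝ (X × X × Y) ∧ margXX P ∈ couplings QX QX ∧ FiniteDiv W (margXY P)}

omit [DecidableEq X] [DecidableEq Y] in
lemma isCompact_tripleSet (W : X → Y → ℝ) (QX : X → ℝ) : IsCompact (tripleSet W QX) := by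
  have h : tripleSet W QX = stdSimplex ℝ (X × X × Y) ∩ ({P | margXX P ∈ stdSimplex ℝ (X × X)} ∩
      ({P | fstMarg (margXX P) = QX} ∩ ({P | sndMarg (margXX P) = QX} ∩
      ⋂ x, ⋂ y, ⋂ _ : W x y = 0, {P | margXY P (x, y) = 0}))) := by
    ext P
    simp only [tripleSet, couplings, FiniteDiv, Set.mem_ofPred_eq, Set.mem_inter_iff,
      Set.mem_iInter]
    tauto
  have hXX := continuous_margXX (A := X) (B := Y)
  have hXY := continuous_margXY (A := X) (B := Y)
  rw [h]
  refine (isCompact_stdSimplex ℝ _).inter_right (((isClosed_stdSimplex ℝ _).preimage hXX).inter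
    ((isClosed_eq (continuous_fstMarg.comp hXX) continuous_const).inter
    ((isClosed_eq (continuous_sndMarg.comp hXX) continuous_const).inter
    (isClosed_iInter fun x => isClosed_iInter fun y => isClosed_iInter fun _ =>
      isClosed_eq ((continuous_apply (x, y)).comp hXY) continuous_const))))

omit [DecidableEq X] [DecidableEq Y] in
lemma gam_le_gamCost (hg : ContinuousOn g (stdSimplex ℝ (X × Y))) (hQX : QX ∈ stdSimplex ℝ X)
    (hR : 0 < R) {P : X × X × Y → ℝ} (hP : P ∈ tripleSet W QX) :
    Gam W g QX R (margXX P) ≤ gamCost W g QX R P := by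
  rw [Gam_eq_sInf]
  exact csInf_le (bddBelow_image_of_subset_stdSimplex (continuousOn_gamCost hg hQX W hR)
    fun _ h => h.1) ⟨P, ⟨hP.1, rfl, hP.2.2⟩, rfl⟩

omit [DecidableEq X] [DecidableEq Y] in
/-- The minimum in the definition of `Γ` is attained. -/
lemma exists_gamCost_eq (hg : ContinuousOn g (stdSimplex ℝ (X × Y))) (hQX : QX ∈ stdSimplex ℝ X)
    (hW : ∀ x, W x ∈ stdSimplex ℝ Y) (hR : 0 < R) {Q : X × X → ℝ} (hQ : Q ∈ couplings QX QX) :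
    ∃ P ∈ tripleSet W QX, margXX P = Q ∧ gamCost W g QX R P = Gam W g QX R Q := by
  have hcomp : IsCompact (tripleSet W QX ∩ {P | margXX P = Q}) :=
    (isCompact_tripleSet W QX).inter_right (isClosed_eq continuous_margXX continuous_const)
  obtain ⟨P₀, hP₀⟩ := extensions_nonempty hW hQ.1
  obtain ⟨P, hP, hmin⟩ := hcomp.exists_isMinOn
    ⟨P₀, ⟨hP₀.1, hP₀.2.1 ▸ hQ, hP₀.2.2⟩, hP₀.2.1⟩
    ((continuousOn_gamCost hg hQX W hR).mono fun _ h => h.1.1)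
  refine ⟨P, hP.1, hP.2, le_antisymm ?_ ?_⟩
  · rw [Gam_eq_sInf]
    refine le_csInf ⟨_, P₀, hP₀, rfl⟩ ?_
    rintro - ⟨P', hP', rfl⟩
    exact hmin ⟨⟨hP'.1, hP'.2.1 ▸ hQ, hP'.2.2⟩, hP'.2.1⟩
  · have := gam_le_gamCost hg hQX hR hP.1
    rwa [hP.2] at this

omit [DecidableEq X] [DecidableEq Y] in
/-- For `E_trc < E₀ < E_ex`, the maximum in the definition of the exponent is attained by some
`Q_{XX'}` with `R < I(X;X') ≤ 2 R`. In particular `U(R,E₀)` contains no joint distribution of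
smaller mutual information. -/
lemma exists_eutLb_eq (hg : ContinuousOn g (stdSimplex ℝ (X × Y))) (hQX : QX ∈ stdSimplex ℝ X)
    (hW : ∀ x, W x ∈ stdSimplex ℝ Y) (hR : 0 < R)
    (h1 : Etrc W g QX R < E₀) (h2 : E₀ < Eex W g QX R) :
    ∃ I, R < I ∧ I ≤ 2 * R ∧ EutLb W g QX R E₀ = 2 * R - I ∧
      ∀ P ∈ tripleSet W QX, mutualInfo (margXX P) < I →
        E₀ < gamCost W g QX R P + mutualInfo (margXX P) - R := by
  have hcost := continuousOn_gamCost hg hQX W hR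
  have hI : Continuous fun P : X × X × Y → ℝ => mutualInfo (margXX P) :=
    continuous_mutualInfo.comp continuous_margXX
  have hf : ContinuousOn (fun P => gamCost W g QX R P + mutualInfo (margXX P) - R)
      (stdSimplex ℝ (X × X × Y)) := (hcost.add hI.continuousOn).sub continuousOn_const
  have hprod : prodDist QX QX ∈ couplings QX QX := prodDist_mem_couplings hQX hQX
  set K : Set (X × X × Y → ℝ) := tripleSet W QX ∩ ({P | mutualInfo (margXX P) ≤ 2 * R} ∩
    {P | P ∈ stdSimplex ℝ (X × X × Y) ∧
      gamCost W g QX R P + mutualInfo (margXX P) - R ≤ E₀}) with hK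
  have hKc : IsCompact K := (isCompact_tripleSet W QX).inter_right
    ((isClosed_le hI continuous_const).inter
      ((isClosed_stdSimplex ℝ _).isClosed_le hf continuousOn_const))
  have hKU : ∀ Q ∈ setU W g QX R E₀, ∃ P ∈ K, margXX P = Q := by
    rintro Q ⟨hQ, hQI, hQE⟩
    obtain ⟨P, hP, hPQ, hPG⟩ := exists_gamCost_eq hg hQX hW hR hQ
    refine ⟨P, ⟨hP, ?_, hP.1, ?_⟩, hPQ⟩
    · rw [Set.mem_ofPred_eq, hPQ]; exact hQI
    · rw [hPQ, hPG]; exact hQE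
  have hUK : ∀ P ∈ K, margXX P ∈ setU W g QX R E₀ := by
    rintro P ⟨hP, hPI, -, hPE⟩
    exact ⟨hP.2.1, hPI, by linarith [gam_le_gamCost hg hQX hR hP]⟩
  have hUne : (setU W g QX R E₀).Nonempty := by
    have hne : {Q | Q ∈ couplings QX QX ∧ mutualInfo Q ≤ 2 * R}.Nonempty :=
      ⟨prodDist QX QX, hprod, by rw [mutualInfo_prodDist hQX hQX]; linarith⟩
    obtain ⟨-, ⟨Q, ⟨hQ, hQI⟩, rfl⟩, hlt⟩ := exists_lt_of_csInf_lt (hne.image _) h1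
    exact ⟨Q, hQ, hQI, hlt.le⟩
  obtain ⟨Q₀, hQ₀⟩ := hUne
  obtain ⟨P₀, hP₀, -⟩ := hKU Q₀ hQ₀
  obtain ⟨P, hP, hmin⟩ := hKc.exists_isMinOn ⟨P₀, hP₀⟩ hI.continuousOn
  refine ⟨mutualInfo (margXX P), ?_, hP.2.1, ?_, fun P' hP' hlt => ?_⟩
  · by_contra! hle
    have hbdd : BddBelow ((fun Q => Gam W g QX R Q + mutualInfo Q - R) ''
        {Q | Q ∈ couplings QX QX ∧ mutualInfo Q ≤ R}) := by
      obtain ⟨b, hb⟩ := bddBelow_image_of_subset_stdSimplex hf subset_rfl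
      refine ⟨b, ?_⟩
      rintro - ⟨Q, ⟨hQ, -⟩, rfl⟩
      obtain ⟨P, hP, hPQ, hPG⟩ := exists_gamCost_eq hg hQX hW hR hQ
      have := hb ⟨P, hP.1, rfl⟩
      simp only [hPQ, hPG] at this
      exact this
    have hex : Eex W g QX R ≤ Gam W g QX R (margXX P) + mutualInfo (margXX P) - R :=
      csInf_le hbdd ⟨margXX P, ⟨hP.1.2.1, hle⟩, rfl⟩
    linarith [(hUK P hP).2.2]
  · refine IsGreatest.csSup_eq ⟨⟨margXX P, hUK P hP, rfl⟩, ?_⟩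
    rintro - ⟨Q, hQ, rfl⟩
    obtain ⟨P', hP', rfl⟩ := hKU Q hQ
    have : mutualInfo (margXX P) ≤ mutualInfo (margXX P') := hmin hP'
    simp only
    linarith
  · by_contra! hle
    have : mutualInfo (margXX P) ≤ mutualInfo (margXX P') :=
      hmin ⟨hP', (hlt.trans_le hP.2.1).le, hP'.1, hle⟩
    linarith

/-- The upper tail is at least `exp (-exp (n E))` in the double-exponential scale, where `E` is the
maximum over `U(R,E₀)`. -/
theorem dexpGE_upperTail [MeasurableSpace X] [MeasurableSingletonClass X]
    (hg : ContinuousOn g (stdSimplex ℝ (X × Y))) (hW : ∀ x, W x ∈ stdSimplex ℝ Y)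
    (hQX : QX ∈ stdSimplex ℝ X) (hR : 0 < R)
    (h1 : Etrc W g QX R < E₀) (h2 : E₀ < Eex W g QX R) :
    DexpGE (blockLengths QX) (upperTail W g QX R E₀) (doubleExp (EutLb W g QX R E₀)) := by
  obtain ⟨I, hRI, hIR, hE, hU⟩ := exists_eutLb_eq hg hQX hW hR h1 h2
  refine dexpGE_of_eventually_le inf_le_left fun ε₀ hε₀ => ?_
  rw [hE]
  -- `γ` is chosen so that `I - γ` still exceeds `R`, and then `η`, `δ` and `κ` in this order;
  -- `κ` absorbs the polynomial factors
  set γ := min ε₀ (I - R) / 8 with hγ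
  have hγ0 : 0 < γ := div_pos (lt_min hε₀ (by linarith)) (by norm_num)
  have hγ1 : 8 * γ ≤ ε₀ := by rw [hγ]; linarith [min_le_left ε₀ (I - R)]
  have hγ2 : 8 * γ ≤ I - R := by rw [hγ]; linarith [min_le_right ε₀ (I - R)]
  have hcost : ContinuousOn (fun P => gamCost W g QX R P + mutualInfo (margXX P) - R)
      (stdSimplex ℝ (X × X × Y)) :=
    ((continuousOn_gamCost hg hQX W hR).add
      (continuous_mutualInfo.comp continuous_margXX).continuousOn).sub continuousOn_const
  -- by compactness, the cost stays away from `E₀` as long as `I(X;X') ≤ I - γ`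
  obtain ⟨η, hη, hV⟩ : ∃ η > 0, ∀ P ∈ tripleSet W QX, mutualInfo (margXX P) ≤ I - γ →
      E₀ + η ≤ gamCost W g QX R P + mutualInfo (margXX P) - R := by
    have hKc : IsCompact (tripleSet W QX ∩ {P | mutualInfo (margXX P) ≤ I - γ}) :=
      (isCompact_tripleSet W QX).inter_right (isClosed_le
        (continuous_mutualInfo.comp continuous_margXX) continuous_const)
    rcases (tripleSet W QX ∩ {P | mutualInfo (margXX P) ≤ I - γ}).eq_empty_or_nonempty with h | h
    · refine ⟨1, one_pos, fun P hP hPI => ?_⟩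
      exact absurd (h ▸ (⟨hP, hPI⟩ : P ∈ tripleSet W QX ∩ {P | mutualInfo (margXX P) ≤ I - γ}))
        (Set.notMem_empty P)
    · obtain ⟨P, ⟨hP, hPI⟩, hmin⟩ := hKc.exists_isMinOn h (hcost.mono fun _ h => h.1.1)
      have hPI : mutualInfo (margXX P) ≤ I - γ := hPI
      refine ⟨_, sub_pos.2 (hU P hP (by linarith)), fun P' hP' hPI' => ?_⟩
      have := hmin (show P' ∈ tripleSet W QX ∩ {P | mutualInfo (margXX P) ≤ I - γ} from ⟨hP', hPI'⟩)
      simp only [Set.mem_ofPred_eq] at this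
      linarith
  obtain ⟨δ, hδ, hα⟩ := exists_word_alpha (Y := Y) hg hQX hR (half_pos hη)
  set κ := min γ (min δ η) / 12 with hκ
  have hκ0 : 0 < κ := div_pos (lt_min hγ0 (lt_min hδ hη)) (by norm_num)
  have hκ1 : 12 * κ ≤ γ := by rw [hκ]; linarith [min_le_left γ (min δ η)]
  have hκ2 : 12 * κ ≤ δ := by
    rw [hκ]; linarith [min_le_right γ (min δ η), min_le_left δ η]
  have hκ3 : 12 * κ ≤ η := by
    rw [hκ]; linarith [min_le_right γ (min δ η), min_le_right δ η]
  have hev := ((eventually_const_le_exp 32 hκ0).and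
    ((eventually_poly_le_exp (Fintype.card X * Fintype.card X) (Fintype.card X) hκ0).and
    ((eventually_poly_le_exp (Fintype.card X) (Fintype.card Y * Fintype.card X) hκ0).and
    ((eventually_poly_le_exp (Fintype.card (X × X) * Fintype.card Y) 0 hκ0).and
    (eventually_pow_mul_le (Fintype.card Y) hκ0)))))
  filter_upwards [hα, hev.filter_mono inf_le_left,
    mem_inf_of_right (mem_principal_self {n | (typeClass n QX).Nonempty})] with n hα hn hT
  obtain ⟨hc, hp1, hp2, hp3, huni⟩ := hn
  have hn0 : (0 : ℝ) ≤ n := Nat.cast_nonneg n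
  have hmain := le_upperTail (E₀ := E₀) (A := I - γ) (V := E₀ + η) hW hQX hR hT (half_pos hη).le hκ0
    (fun P hP hXX hPI hfin => hV P ⟨hP, hXX, hfin⟩ hPI) hα (by linarith) (by linarith)
    (by linarith) hc hp1 (by rw [mul_comm]; exact hp2) (by simpa using hp3) huni
  refine le_trans (ENNReal.ofReal_le_ofReal ?_) hmain
  set u := Real.exp (n * (2 * R - (I - γ) + κ)) with hu
  have hu1 : 1 ≤ u := Real.one_le_exp (mul_nonneg hn0 (by linarith))
  have hexp : 9 * u ≤ Real.exp (n * (2 * R - I + ε₀)) := by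
    calc 9 * u ≤ Real.exp (n * κ) * u := by gcongr; linarith
      _ = Real.exp (n * (2 * R - (I - γ) + κ + κ)) := by
        rw [hu, ← Real.exp_add]; congr 1; ring
      _ ≤ _ := Real.exp_le_exp.2 (mul_le_mul_of_nonneg_left (by linarith) hn0)
  calc Real.exp (-Real.exp (n * (2 * R - I + ε₀))) ≤ Real.exp (-(8 * u) + -1) :=
        Real.exp_le_exp.2 (by linarith)
    _ = Real.exp (-(8 * u)) * Real.exp (-1) := Real.exp_add _ _
    _ ≤ Real.exp (-(8 * u)) * (1 / 2) := by
      refine mul_le_mul_of_nonneg_left ?_ (Real.exp_pos _).le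
      rw [Real.exp_neg, inv_eq_one_div]
      exact one_div_le_one_div_of_le two_pos (by linarith [Real.add_one_le_exp 1])
    _ = _ := by ring

end UpperTailLowerBound

end RandomCode

theorem theorem2 {X Y : Type*} [Fintype X] [Fintype Y] [DecidableEq X] [DecidableEq Y]
    [MeasurableSpace X] [MeasurableSingletonClass X]
    (W : X → Y → ℝ) (hW : ∀ x, W x ∈ stdSimplex ℝ Y)
    (g : (X × Y → ℝ) → ℝ) (hg : ContinuousOn g (stdSimplex ℝ (X × Y)))
    (QX : X → ℝ) (hQX : QX ∈ stdSimplex ℝ X)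
    (htype : ∃ n : ℕ, 0 < n ∧ (typeClass n QX).Nonempty)
    (R E₀ : ℝ) (hR : 0 < R) :
    (0 < EutUb W g QX R E₀ →
      DexpLE (blockLengths QX) (upperTail W g QX R E₀) (doubleExp (EutUb W g QX R E₀))) ∧
    (E₀ ∈ Set.Ioo (Etrc W g QX R) (Eex W g QX R) →
      DexpGE (blockLengths QX) (upperTail W g QX R E₀) (doubleExp (EutLb W g QX R E₀))) :=
  ⟨fun h => dexpLE_upperTail hg hW hQX hR h, fun h => dexpGE_upperTail hg hW hQX hR h.1 h.2⟩
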